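/- Let $(Q,\mathfrak m)$ be a regular local ring, let $f\in\mathfrak m$ be a non-zero element, and put $R=Q/(f)$. Assume that $R$ is an isolated singularity, i.e. $R_{\mathfrak p}$ is regular for every non-maximal prime $\mathfrak p$ of $R$. For $g\in Q$, a matrix factorization of $g$ is a pair $P=(\alpha:P_1\to P_0,\ \beta:P_0\to P_1)$ of maps of finitely generated projective $Q$-modules with $\alpha\beta=g$ and $\beta\alpha=g$, where $P_0$ is the even part and $P_1$ the odd part. Let $K_0(\mathrm{mf}(Q,g))$ be the abelian group generated by the classes of matrix factorizations of $g$, modulo $[P]=[P']+[P'']$ for every short exact sequence $0\to P'\to P\to P''\to 0$ and $[P]=[P']$ whenever $P$ and $P'$ are homotopy equivalent. Let $K_0(\mathrm{mf}^{\mathfrak m}(Q,0))$ be the group defined in the same way from the matrix factorizations of $0$ (the $\mathbb Z/2$-graded complexes of finitely generated projective $Q$-modules) whose two homology modules $H^0=\ker\beta/\operatorname{im}\alpha$ and $H^1=\ker\alpha/\operatorname{im}\beta$ have finite length. Let $\chi:K_0(\mathrm{mf}^{\mathfrak m}(Q,0))\to\mathbb Z$ be the homomorphism $[P]\mapsto\operatorname{length}H^0(P)-\operatorname{length}H^1(P)$.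 Let $(-)^\circ:K_0(\mathrm{mf}(Q,f))\to K_0(\mathrm{mf}(Q,-f))$ be the homomorphism induced by $(\alpha,\beta)\mapsto(\alpha,-\beta)$. Then the following hold. 1. $f$ is a non-zero-divisor, and $[(\alpha,\beta)]\mapsto[\operatorname{coker}\alpha]$ is an isomorphism from $K_0(\mathrm{mf}(Q,f))$ onto $G_0(R)/\operatorname{im}(K_0(R)\to G_0(R))$, where $G_0(R)$ is the Grothendieck group of finitely generated $R$-modules. For a finitely generated $R$-module $M$, let $[M]_{\mathrm{stable}}\in K_0(\mathrm{mf}(Q,f))$ be the element corresponding to the class of $M$ under this isomorphism. 2. For all matrix factorizations $X$ of $f$ and $Y$ of $-f$, the tensor product $X\otimes_Q Y$, with differential $d(x\otimes y)=dx\otimes y+(-1)^{|x|}x\otimes dy$, is a $\mathbb Z/2$-graded complex whose homology has finite length. Hence $[X]\cup[Y]=[X\otimes_Q Y]$ defines a bilinear pairing $\cup:K_0(\mathrm{mf}(Q,f))\times K_0(\mathrm{mf}(Q,-f))\to K_0(\mathrm{mf}^{\mathfrak m}(Q,0))$. 3. For all finitely generated $R$-modules $M$ and $N$, the modules $\operatorname{Tor}^R_{2n}(M,N)$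 and $\operatorname{Tor}^R_{2n+1}(M,N)$ have finite length for all sufficiently large $n$, the integer $$\theta_R(M,N)=\operatorname{length}\operatorname{Tor}^R_{2n}(M,N)-\operatorname{length}\operatorname{Tor}^R_{2n+1}(M,N)$$ does not depend on $n$ for $n\gg0$, and $$\theta_R(M,N)=\chi\bigl([M]_{\mathrm{stable}}\cup[N]_{\mathrm{stable}}^{\circ}\bigr).$$ -/

import Mathlib

open scoped TensorProduct

universe u

/-- A matrix factorization of `f` in `Q`: finitely generated projective `Q`-modules `P0` (even part)
and `P1` (odd part) with maps `α : P1 → P0` and `β : P0 → P1` whose two composites are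
multiplication by `f`. -/
structure MatrixFactorization (Q : Type u) [CommRing Q] (f : Q) : Type (u + 1) where
  P0 : Type u
  P1 : Type u
  [addCommGroup0 : AddCommGroup P0]
  [addCommGroup1 : AddCommGroup P1]
  [module0 : Module Q P0]
  [module1 : Module Q P1]
  [finite0 : Module.Finite Q P0]
  [finite1 : Module.Finite Q P1]
  [projective0 : Module.Projective Q P0]
  [projective1 : Module.Projective Q P1]
  α : P1 →ₗ[Q] P0
  β : P0 →ₗ[Q] P1
  α_β : ∀ x, α (β x) = f • x
  β_α : ∀ x, β (α x) = f • x

namespace MatrixFactorization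

attribute [instance] addCommGroup0 addCommGroup1 module0 module1 finite0 finite1 projective0
  projective1

variable {Q : Type u} [CommRing Q] {f g e : Q}

/-- Morphisms of matrix factorizations: degree zero linear maps commuting with the odd maps. -/
structure Hom (X Y : MatrixFactorization Q f) where
  φ0 : X.P0 →ₗ[Q] Y.P0
  φ1 : X.P1 →ₗ[Q] Y.P1
  comm_α : ∀ x, φ0 (X.α x) = Y.α (φ1 x)
  comm_β : ∀ x, φ1 (X.β x) = Y.β (φ0 x)

/-- The identity morphism. -/
def Hom.id (X : MatrixFactorization Q f) : Hom X X where
  φ0 := LinearMap.id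
  φ1 := LinearMap.id
  comm_α _ := rfl
  comm_β _ := rfl

/-- Composition of morphisms, `ψ` after `φ`. -/
def Hom.comp {X Y Z : MatrixFactorization Q f} (ψ : Hom Y Z) (φ : Hom X Y) : Hom X Z where
  φ0 := ψ.φ0 ∘ₗ φ.φ0
  φ1 := ψ.φ1 ∘ₗ φ.φ1
  comm_α x := by simp [φ.comm_α, ψ.comm_α]
  comm_β x := by simp [φ.comm_β, ψ.comm_β]

/-- Two morphisms are homotopic if there is an odd linear map `h` with `d h + h d = φ - ψ`. -/
def Homotopic {X Y : MatrixFactorization Q f} (φ ψ : Hom X Y) : Prop :=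
  ∃ (h0 : X.P0 →ₗ[Q] Y.P1) (h1 : X.P1 →ₗ[Q] Y.P0),
    (∀ x, Y.α (h0 x) + h1 (X.β x) = φ.φ0 x - ψ.φ0 x) ∧
    (∀ x, Y.β (h1 x) + h0 (X.α x) = φ.φ1 x - ψ.φ1 x)

/-- Homotopy equivalence of matrix factorizations. -/
def HomotopyEquivalent (X Y : MatrixFactorization Q f) : Prop :=
  ∃ (φ : Hom X Y) (ψ : Hom Y X),
    Homotopic (ψ.comp φ) (Hom.id X) ∧ Homotopic (φ.comp ψ) (Hom.id Y)

/-- Degreewise short exact sequences `0 → X → Y → Z → 0` of matrix factorizations. -/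
structure IsShortExact {X Y Z : MatrixFactorization Q f} (φ : Hom X Y) (ψ : Hom Y Z) : Prop where
  inj0 : Function.Injective φ.φ0
  inj1 : Function.Injective φ.φ1
  exact0 : Function.Exact φ.φ0 ψ.φ0
  exact1 : Function.Exact φ.φ1 ψ.φ1
  surj0 : Function.Surjective ψ.φ0
  surj1 : Function.Surjective ψ.φ1

/-! ### Grothendieck groups -/

/-- The relations of the Grothendieck group of a full subcategory `C`: additivity on short exact
sequences in `C` and invariance under homotopy equivalence in `C`. -/
def k0Relations (C : Set (MatrixFactorization Q f)) : Set (FreeAbelianGroup C) :=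
  {z | (∃ (X Y Z : C) (φ : Hom X.1 Y.1) (ψ : Hom Y.1 Z.1), IsShortExact φ ψ ∧
          z = FreeAbelianGroup.of Y - (FreeAbelianGroup.of X + FreeAbelianGroup.of Z)) ∨
       (∃ X Y : C, HomotopyEquivalent X.1 Y.1 ∧
          z = FreeAbelianGroup.of X - FreeAbelianGroup.of Y)}

/-- The Grothendieck group of a full subcategory `C` of matrix factorizations of `f`. -/
abbrev K0On (C : Set (MatrixFactorization Q f)) : Type (u + 1) :=
  FreeAbelianGroup C ⧸ AddSubgroup.closure (k0Relations C)

/-- The class in `K0On C` of an object of `C`. -/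
def K0On.mk {C : Set (MatrixFactorization Q f)} (X : C) : K0On C :=
  QuotientAddGroup.mk (FreeAbelianGroup.of X)

variable (Q f) in
/-- `K₀(mf(Q, f))`, the Grothendieck group of all matrix factorizations of `f`. -/
abbrev K0 : Type (u + 1) := K0On (Set.univ : Set (MatrixFactorization Q f))

/-- The homomorphism out of `K0On C` induced by a function on objects respecting the relations. -/
def K0On.lift {C : Set (MatrixFactorization Q f)} {A : Type*} [AddCommGroup A] (F : C → A)
    (hses : ∀ (X Y Z : C) (φ : Hom X.1 Y.1) (ψ : Hom Y.1 Z.1), IsShortExact φ ψ →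
      F Y = F X + F Z)
    (hhtpy : ∀ X Y : C, HomotopyEquivalent X.1 Y.1 → F X = F Y) : K0On C →+ A :=
  QuotientAddGroup.lift _ (FreeAbelianGroup.lift F) <| by
    rw [AddSubgroup.closure_le]
    rintro z (⟨X, Y, Z, φ, ψ, h, rfl⟩ | ⟨X, Y, h, rfl⟩)
    · simp [AddMonoidHom.mem_ker, hses X Y Z φ ψ h]
    · simp [AddMonoidHom.mem_ker, hhtpy X Y h]

@[simp]
theorem K0On.lift_mk {C : Set (MatrixFactorization Q f)} {A : Type*} [AddCommGroup A] (F : C → A)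
    (hses) (hhtpy) (X : C) : K0On.lift F hses hhtpy (K0On.mk X) = F X := by
  simp [K0On.lift, K0On.mk]

theorem K0On.mk_eq_add {C : Set (MatrixFactorization Q f)} {X Y Z : C} {φ : Hom X.1 Y.1}
    {ψ : Hom Y.1 Z.1} (h : IsShortExact φ ψ) : K0On.mk Y = K0On.mk X + K0On.mk Z := by
  have : (FreeAbelianGroup.of Y - (FreeAbelianGroup.of X + FreeAbelianGroup.of Z)) ∈
      AddSubgroup.closure (k0Relations C) :=
    AddSubgroup.subset_closure (Or.inl ⟨X, Y, Z, φ, ψ, h, rfl⟩)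
  have h2 := (QuotientAddGroup.eq_zero_iff _).2 this
  exact sub_eq_zero.1 h2

theorem K0On.mk_eq_of_homotopyEquivalent {C : Set (MatrixFactorization Q f)} {X Y : C}
    (h : HomotopyEquivalent X.1 Y.1) : K0On.mk X = K0On.mk Y := by
  have : (FreeAbelianGroup.of X - FreeAbelianGroup.of Y) ∈
      AddSubgroup.closure (k0Relations C) :=
    AddSubgroup.subset_closure (Or.inr ⟨X, Y, h, rfl⟩)
  have h2 := (QuotientAddGroup.eq_zero_iff _).2 this
  exact sub_eq_zero.1 h2

theorem K0On.hom_ext {C : Set (MatrixFactorization Q f)} {A : Type*} [AddCommGroup A]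
    {F G : K0On C →+ A} (h : ∀ X : C, F (K0On.mk X) = G (K0On.mk X)) : F = G := by
  apply QuotientAddGroup.addMonoidHom_ext
  ext X
  exact h X

/-! ### Negating one map -/

/-- `X° = (α, -β)`, a matrix factorization of `-f`. -/
@[simps]
def circ (X : MatrixFactorization Q f) : MatrixFactorization Q (-f) where
  P0 := X.P0
  P1 := X.P1
  α := X.α
  β := -X.β
  α_β x := by simp [X.α_β]
  β_α x := by simp [X.β_α]

/-- Functoriality of `X ↦ X°`. -/
def Hom.circ {X Y : MatrixFactorization Q f} (φ : Hom X Y) : Hom X.circ Y.circ where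
  φ0 := φ.φ0
  φ1 := φ.φ1
  comm_α := φ.comm_α
  comm_β x := by
    refine (map_neg φ.φ1 (X.β x)).trans ?_
    exact congrArg _ (φ.comm_β x)

theorem Homotopic.circ {X Y : MatrixFactorization Q f} {φ ψ : Hom X Y} (h : Homotopic φ ψ) :
    Homotopic φ.circ ψ.circ := by
  obtain ⟨h0, h1, H0, H1⟩ := h
  refine ⟨h0, -h1, fun x => ?_, fun x => ?_⟩
  · refine Eq.trans ?_ (H0 x)
    show Y.α (h0 x) + -h1 (-X.β x) = _
    simp
  · refine Eq.trans ?_ (H1 x)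
    show -Y.β (-h1 x) + h0 (X.α x) = _
    simp

/-- The homomorphism `(-)° : K₀(mf(Q, f)) → K₀(mf(Q, -f))`. -/
def circK0 : K0 Q f →+ K0 Q (-f) :=
  K0On.lift (fun X => K0On.mk ⟨X.1.circ, trivial⟩)
    (fun _ _ _ φ ψ h => K0On.mk_eq_add (φ := φ.circ) (ψ := ψ.circ)
      ⟨h.inj0, h.inj1, h.exact0, h.exact1, h.surj0, h.surj1⟩)
    (fun _ _ ⟨φ, ψ, h, h'⟩ => K0On.mk_eq_of_homotopyEquivalent ⟨φ.circ, ψ.circ, h.circ, h'.circ⟩)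

/-! ### Tensor products -/

/-- Linear maps out of a direct sum of two tensor products agree if they agree on pure tensors. -/
theorem prodTensor_ext {Q A B C D M : Type*} [CommRing Q] [AddCommGroup A] [AddCommGroup B]
    [AddCommGroup C] [AddCommGroup D] [AddCommGroup M] [Module Q A] [Module Q B] [Module Q C]
    [Module Q D] [Module Q M] (F G : (A ⊗[Q] B) × (C ⊗[Q] D) →ₗ[Q] M)
    (h1 : ∀ a b, F (a ⊗ₜ b, 0) = G (a ⊗ₜ b, 0)) (h2 : ∀ c d, F (0, c ⊗ₜ d) = G (0, c ⊗ₜ d)) (x) :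
    F x = G x := by
  refine LinearMap.congr_fun (LinearMap.prod_ext ?_ ?_) x
  · exact TensorProduct.ext' fun a b => h1 a b
  · exact TensorProduct.ext' fun a b => h2 a b

/-- The odd-to-even part of the differential `d (x ⊗ y) = d x ⊗ y + (-1)^|x| x ⊗ d y`. -/
def tensorα (X : MatrixFactorization Q f) (Y : MatrixFactorization Q g) :
    (X.P1 ⊗[Q] Y.P0) × (X.P0 ⊗[Q] Y.P1) →ₗ[Q] (X.P0 ⊗[Q] Y.P0) × (X.P1 ⊗[Q] Y.P1) :=
  LinearMap.coprod
    (LinearMap.prod (X.α.rTensor Y.P0) (-Y.β.lTensor X.P1))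
    (LinearMap.prod (Y.α.lTensor X.P0) (X.β.rTensor Y.P1))

/-- The even-to-odd part of the differential `d (x ⊗ y) = d x ⊗ y + (-1)^|x| x ⊗ d y`. -/
def tensorβ (X : MatrixFactorization Q f) (Y : MatrixFactorization Q g) :
    (X.P0 ⊗[Q] Y.P0) × (X.P1 ⊗[Q] Y.P1) →ₗ[Q] (X.P1 ⊗[Q] Y.P0) × (X.P0 ⊗[Q] Y.P1) :=
  LinearMap.coprod
    (LinearMap.prod (X.β.rTensor Y.P0) (Y.β.lTensor X.P0))
    (LinearMap.prod (-Y.α.lTensor X.P1) (X.α.rTensor Y.P1))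

/-- The tensor product of a matrix factorization of `f` and one of `g` is a matrix factorization of
`e = f + g`, with `d (x ⊗ y) = d x ⊗ y + (-1)^|x| x ⊗ d y`. -/
def tensor (h : f + g = e) (X : MatrixFactorization Q f) (Y : MatrixFactorization Q g) :
    MatrixFactorization Q e where
  P0 := (X.P0 ⊗[Q] Y.P0) × (X.P1 ⊗[Q] Y.P1)
  P1 := (X.P1 ⊗[Q] Y.P0) × (X.P0 ⊗[Q] Y.P1)
  α := tensorα X Y
  β := tensorβ X Y
  α_β := by
    subst h
    intro x
    refine (prodTensor_ext (tensorα X Y ∘ₗ tensorβ X Y) ((f + g) • LinearMap.id) ?_ ?_ x).trans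
      (by simp) <;> intro x y <;>
      simp [tensorα, tensorβ, X.α_β, X.β_α, Y.α_β, Y.β_α, TensorProduct.smul_tmul', add_smul,
        add_comm]
  β_α := by
    subst h
    intro x
    refine (prodTensor_ext (tensorβ X Y ∘ₗ tensorα X Y) ((f + g) • LinearMap.id) ?_ ?_ x).trans
      (by simp) <;> intro x y <;>
      simp [tensorα, tensorβ, X.α_β, X.β_α, Y.α_β, Y.β_α, TensorProduct.smul_tmul', add_smul,
        add_comm]

/-- Functoriality of the tensor product in the left factor. -/
def Hom.tensorRight {X X' : MatrixFactorization Q f} (h : f + g = e) (φ : Hom X X')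
    (Y : MatrixFactorization Q g) : Hom (tensor h X Y) (tensor h X' Y) where
  φ0 := LinearMap.prodMap (φ.φ0.rTensor Y.P0) (φ.φ1.rTensor Y.P1)
  φ1 := LinearMap.prodMap (φ.φ1.rTensor Y.P0) (φ.φ0.rTensor Y.P1)
  comm_α := by
    apply prodTensor_ext
      (LinearMap.prodMap (φ.φ0.rTensor Y.P0) (φ.φ1.rTensor Y.P1) ∘ₗ tensorα X Y)
      (tensorα X' Y ∘ₗ LinearMap.prodMap (φ.φ1.rTensor Y.P0) (φ.φ0.rTensor Y.P1)) <;>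
      intro x y <;> simp [tensorα, φ.comm_α, φ.comm_β]
  comm_β := by
    apply prodTensor_ext
      (LinearMap.prodMap (φ.φ1.rTensor Y.P0) (φ.φ0.rTensor Y.P1) ∘ₗ tensorβ X Y)
      (tensorβ X' Y ∘ₗ LinearMap.prodMap (φ.φ0.rTensor Y.P0) (φ.φ1.rTensor Y.P1)) <;>
      intro x y <;> simp [tensorβ, φ.comm_α, φ.comm_β]

/-- Functoriality of the tensor product in the right factor. -/
def Hom.tensorLeft {Y Y' : MatrixFactorization Q g} (h : f + g = e) (X : MatrixFactorization Q f)
    (φ : Hom Y Y') : Hom (tensor h X Y) (tensor h X Y') where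
  φ0 := LinearMap.prodMap (φ.φ0.lTensor X.P0) (φ.φ1.lTensor X.P1)
  φ1 := LinearMap.prodMap (φ.φ0.lTensor X.P1) (φ.φ1.lTensor X.P0)
  comm_α := by
    apply prodTensor_ext
      (LinearMap.prodMap (φ.φ0.lTensor X.P0) (φ.φ1.lTensor X.P1) ∘ₗ tensorα X Y)
      (tensorα X Y' ∘ₗ LinearMap.prodMap (φ.φ0.lTensor X.P1) (φ.φ1.lTensor X.P0)) <;>
      intro x y <;> simp [tensorα, φ.comm_α, φ.comm_β]
  comm_β := by
    apply prodTensor_ext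
      (LinearMap.prodMap (φ.φ0.lTensor X.P1) (φ.φ1.lTensor X.P0) ∘ₗ tensorβ X Y)
      (tensorβ X Y' ∘ₗ LinearMap.prodMap (φ.φ0.lTensor X.P0) (φ.φ1.lTensor X.P1)) <;>
      intro x y <;> simp [tensorβ, φ.comm_α, φ.comm_β]

theorem Homotopic.tensorRight {X X' : MatrixFactorization Q f} (h : f + g = e) {φ ψ : Hom X X'}
    (H : Homotopic φ ψ) (Y : MatrixFactorization Q g) :
    Homotopic (φ.tensorRight h Y) (ψ.tensorRight h Y) := by
  obtain ⟨h0, h1, H0, H1⟩ := H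
  refine ⟨LinearMap.prodMap (h0.rTensor Y.P0) (h1.rTensor Y.P1),
    LinearMap.prodMap (h1.rTensor Y.P0) (h0.rTensor Y.P1), ?_, ?_⟩
  · apply prodTensor_ext
      (tensorα X' Y ∘ₗ LinearMap.prodMap (h0.rTensor Y.P0) (h1.rTensor Y.P1) +
        LinearMap.prodMap (h1.rTensor Y.P0) (h0.rTensor Y.P1) ∘ₗ tensorβ X Y)
      (LinearMap.prodMap (φ.φ0.rTensor Y.P0) (φ.φ1.rTensor Y.P1) -
        LinearMap.prodMap (ψ.φ0.rTensor Y.P0) (ψ.φ1.rTensor Y.P1)) <;> intro x y <;>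
      simp [tensorα, tensorβ, ← TensorProduct.add_tmul,
        ← TensorProduct.sub_tmul, H0, H1]
  · apply prodTensor_ext
      (tensorβ X' Y ∘ₗ LinearMap.prodMap (h1.rTensor Y.P0) (h0.rTensor Y.P1) +
        LinearMap.prodMap (h0.rTensor Y.P0) (h1.rTensor Y.P1) ∘ₗ tensorα X Y)
      (LinearMap.prodMap (φ.φ1.rTensor Y.P0) (φ.φ0.rTensor Y.P1) -
        LinearMap.prodMap (ψ.φ1.rTensor Y.P0) (ψ.φ0.rTensor Y.P1)) <;> intro x y <;>
      simp [tensorα, tensorβ, ← TensorProduct.add_tmul,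
        ← TensorProduct.sub_tmul, H0, H1]

theorem Homotopic.tensorLeft {Y Y' : MatrixFactorization Q g} (h : f + g = e)
    (X : MatrixFactorization Q f) {φ ψ : Hom Y Y'} (H : Homotopic φ ψ) :
    Homotopic (φ.tensorLeft h X) (ψ.tensorLeft h X) := by
  obtain ⟨h0, h1, H0, H1⟩ := H
  let k0 : (X.P0 ⊗[Q] Y.P0) × (X.P1 ⊗[Q] Y.P1) →ₗ[Q] (X.P1 ⊗[Q] Y'.P0) × (X.P0 ⊗[Q] Y'.P1) :=
    LinearMap.coprod (LinearMap.prod 0 (h0.lTensor X.P0)) (LinearMap.prod (-h1.lTensor X.P1) 0)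
  let k1 : (X.P1 ⊗[Q] Y.P0) × (X.P0 ⊗[Q] Y.P1) →ₗ[Q] (X.P0 ⊗[Q] Y'.P0) × (X.P1 ⊗[Q] Y'.P1) :=
    LinearMap.coprod (LinearMap.prod 0 (-h0.lTensor X.P1)) (LinearMap.prod (h1.lTensor X.P0) 0)
  refine ⟨k0, k1, ?_, ?_⟩
  · apply prodTensor_ext (tensorα X Y' ∘ₗ k0 + k1 ∘ₗ tensorβ X Y)
      (LinearMap.prodMap (φ.φ0.lTensor X.P0) (φ.φ1.lTensor X.P1) -
        LinearMap.prodMap (ψ.φ0.lTensor X.P0) (ψ.φ1.lTensor X.P1)) <;> intro x y <;>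
      simp [k0, k1, tensorα, tensorβ, ← TensorProduct.tmul_add,
        ← TensorProduct.tmul_sub, H0, H1]
  · apply prodTensor_ext (tensorβ X Y' ∘ₗ k1 + k0 ∘ₗ tensorα X Y)
      (LinearMap.prodMap (φ.φ0.lTensor X.P1) (φ.φ1.lTensor X.P0) -
        LinearMap.prodMap (ψ.φ0.lTensor X.P1) (ψ.φ1.lTensor X.P0)) <;> intro x y <;>
      simp [k0, k1, tensorα, tensorβ, ← TensorProduct.tmul_add,
        ← TensorProduct.tmul_sub, H0, H1]

theorem Homotopic.congr {X Y : MatrixFactorization Q f} {φ ψ φ' ψ' : Hom X Y} (H : Homotopic φ ψ)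
    (h0 : ∀ x, φ.φ0 x = φ'.φ0 x) (h1 : ∀ x, φ.φ1 x = φ'.φ1 x)
    (h0' : ∀ x, ψ.φ0 x = ψ'.φ0 x) (h1' : ∀ x, ψ.φ1 x = ψ'.φ1 x) : Homotopic φ' ψ' := by
  obtain ⟨k0, k1, H0, H1⟩ := H
  exact ⟨k0, k1, fun x => by rw [H0, h0, h0'], fun x => by rw [H1, h1, h1']⟩

theorem HomotopyEquivalent.tensorRight {X X' : MatrixFactorization Q f} (h : f + g = e)
    (H : HomotopyEquivalent X X') (Y : MatrixFactorization Q g) :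
    HomotopyEquivalent (tensor h X Y) (tensor h X' Y) := by
  obtain ⟨φ, ψ, H0, H1⟩ := H
  exact ⟨φ.tensorRight h Y, ψ.tensorRight h Y,
    (H0.tensorRight h Y).congr
      (fun _ => Prod.ext (LinearMap.rTensor_comp_apply ..) (LinearMap.rTensor_comp_apply ..))
      (fun _ => Prod.ext (LinearMap.rTensor_comp_apply ..) (LinearMap.rTensor_comp_apply ..))
      (fun _ => Prod.ext (LinearMap.rTensor_id_apply ..) (LinearMap.rTensor_id_apply ..))
      (fun _ => Prod.ext (LinearMap.rTensor_id_apply ..) (LinearMap.rTensor_id_apply ..)),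
    (H1.tensorRight h Y).congr
      (fun _ => Prod.ext (LinearMap.rTensor_comp_apply ..) (LinearMap.rTensor_comp_apply ..))
      (fun _ => Prod.ext (LinearMap.rTensor_comp_apply ..) (LinearMap.rTensor_comp_apply ..))
      (fun _ => Prod.ext (LinearMap.rTensor_id_apply ..) (LinearMap.rTensor_id_apply ..))
      (fun _ => Prod.ext (LinearMap.rTensor_id_apply ..) (LinearMap.rTensor_id_apply ..))⟩

theorem HomotopyEquivalent.tensorLeft {Y Y' : MatrixFactorization Q g} (h : f + g = e)
    (X : MatrixFactorization Q f) (H : HomotopyEquivalent Y Y') :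
    HomotopyEquivalent (tensor h X Y) (tensor h X Y') := by
  obtain ⟨φ, ψ, H0, H1⟩ := H
  exact ⟨φ.tensorLeft h X, ψ.tensorLeft h X,
    (H0.tensorLeft h X).congr
      (fun _ => Prod.ext (LinearMap.lTensor_comp_apply ..) (LinearMap.lTensor_comp_apply ..))
      (fun _ => Prod.ext (LinearMap.lTensor_comp_apply ..) (LinearMap.lTensor_comp_apply ..))
      (fun _ => Prod.ext (LinearMap.lTensor_id_apply ..) (LinearMap.lTensor_id_apply ..))
      (fun _ => Prod.ext (LinearMap.lTensor_id_apply ..) (LinearMap.lTensor_id_apply ..)),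
    (H1.tensorLeft h X).congr
      (fun _ => Prod.ext (LinearMap.lTensor_comp_apply ..) (LinearMap.lTensor_comp_apply ..))
      (fun _ => Prod.ext (LinearMap.lTensor_comp_apply ..) (LinearMap.lTensor_comp_apply ..))
      (fun _ => Prod.ext (LinearMap.lTensor_id_apply ..) (LinearMap.lTensor_id_apply ..))
      (fun _ => Prod.ext (LinearMap.lTensor_id_apply ..) (LinearMap.lTensor_id_apply ..))⟩

theorem exact_prodMap {A A' B B' C C' : Type*} [AddCommGroup A] [AddCommGroup A'] [AddCommGroup B]
    [AddCommGroup B'] [AddCommGroup C] [AddCommGroup C'] [Module Q A] [Module Q A'] [Module Q B]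
    [Module Q B'] [Module Q C] [Module Q C'] {u : A →ₗ[Q] B} {v : B →ₗ[Q] C} {u' : A' →ₗ[Q] B'}
    {v' : B' →ₗ[Q] C'} (h : Function.Exact u v) (h' : Function.Exact u' v') :
    Function.Exact (u.prodMap u') (v.prodMap v') := by
  rintro ⟨x, y⟩
  simp only [LinearMap.prodMap_apply, Prod.mk_eq_zero, h x, h' y, Set.mem_range, Prod.exists,
    Prod.mk.injEq]
  exact ⟨fun ⟨⟨a, ha⟩, b, hb⟩ => ⟨a, b, ha, hb⟩, fun ⟨a, b, ha, hb⟩ => ⟨⟨a, ha⟩, b, hb⟩⟩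

theorem IsShortExact.tensorRight {X X' X'' : MatrixFactorization Q f} (h : f + g = e)
    {φ : Hom X X'} {ψ : Hom X' X''} (H : IsShortExact φ ψ) (Y : MatrixFactorization Q g) :
    IsShortExact (φ.tensorRight h Y) (ψ.tensorRight h Y) where
  inj0 := Function.Injective.prodMap (Module.Flat.rTensor_preserves_injective_linearMap _ H.inj0)
    (Module.Flat.rTensor_preserves_injective_linearMap _ H.inj1)
  inj1 := Function.Injective.prodMap (Module.Flat.rTensor_preserves_injective_linearMap _ H.inj1)
    (Module.Flat.rTensor_preserves_injective_linearMap _ H.inj0)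
  exact0 := exact_prodMap (rTensor_exact _ H.exact0 H.surj0) (rTensor_exact _ H.exact1 H.surj1)
  exact1 := exact_prodMap (rTensor_exact _ H.exact1 H.surj1) (rTensor_exact _ H.exact0 H.surj0)
  surj0 := Function.Surjective.prodMap (LinearMap.rTensor_surjective _ H.surj0)
    (LinearMap.rTensor_surjective _ H.surj1)
  surj1 := Function.Surjective.prodMap (LinearMap.rTensor_surjective _ H.surj1)
    (LinearMap.rTensor_surjective _ H.surj0)

theorem IsShortExact.tensorLeft {Y Y' Y'' : MatrixFactorization Q g} (h : f + g = e)
    (X : MatrixFactorization Q f) {φ : Hom Y Y'} {ψ : Hom Y' Y''} (H : IsShortExact φ ψ) :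
    IsShortExact (φ.tensorLeft h X) (ψ.tensorLeft h X) where
  inj0 := Function.Injective.prodMap (Module.Flat.lTensor_preserves_injective_linearMap _ H.inj0)
    (Module.Flat.lTensor_preserves_injective_linearMap _ H.inj1)
  inj1 := Function.Injective.prodMap (Module.Flat.lTensor_preserves_injective_linearMap _ H.inj0)
    (Module.Flat.lTensor_preserves_injective_linearMap _ H.inj1)
  exact0 := exact_prodMap (lTensor_exact _ H.exact0 H.surj0) (lTensor_exact _ H.exact1 H.surj1)
  exact1 := exact_prodMap (lTensor_exact _ H.exact0 H.surj0) (lTensor_exact _ H.exact1 H.surj1)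
  surj0 := Function.Surjective.prodMap (LinearMap.lTensor_surjective _ H.surj0)
    (LinearMap.lTensor_surjective _ H.surj1)
  surj1 := Function.Surjective.prodMap (LinearMap.lTensor_surjective _ H.surj0)
    (LinearMap.lTensor_surjective _ H.surj1)

/-- The cup product `K₀(mf(Q, f)) × K₀(mf(Q, g)) → K₀(C)`, `[X] ∪ [Y] = [X ⊗ Y]`, for a full
subcategory `C` of `mf(Q, f + g)` that contains all tensor products `X ⊗ Y`. -/
def cup (h : f + g = e) (C : Set (MatrixFactorization Q e))
    (hC : ∀ (X : MatrixFactorization Q f) (Y : MatrixFactorization Q g), tensor h X Y ∈ C) :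
    K0 Q f →+ K0 Q g →+ K0On C :=
  K0On.lift
    (fun X => K0On.lift (fun Y => K0On.mk ⟨tensor h X.1 Y.1, hC X.1 Y.1⟩)
      (fun _ _ _ _ _ H => K0On.mk_eq_add (H.tensorLeft h X.1))
      (fun _ _ H => K0On.mk_eq_of_homotopyEquivalent (H.tensorLeft h X.1)))
    (fun _ _ _ _ _ H => K0On.hom_ext fun Y => by
      simpa using K0On.mk_eq_add (C := C) (X := ⟨_, hC _ _⟩) (Y := ⟨_, hC _ _⟩)
        (Z := ⟨_, hC _ _⟩) (H.tensorRight h Y.1))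
    (fun _ _ H => K0On.hom_ext fun Y => by
      simpa using K0On.mk_eq_of_homotopyEquivalent (C := C) (X := ⟨_, hC _ _⟩) (Y := ⟨_, hC _ _⟩)
        (H.tensorRight h Y.1))

/-! ### Homology and the Euler characteristic -/

/-- The even homology `ker β / im α` of a `ℤ/2`-graded complex. -/
abbrev H0 (X : MatrixFactorization Q (0 : Q)) : Type u :=
  LinearMap.ker X.β ⧸ (LinearMap.range X.α).submoduleOf (LinearMap.ker X.β)

/-- The odd homology `ker α / im β` of a `ℤ/2`-graded complex. -/
abbrev H1 (X : MatrixFactorization Q (0 : Q)) : Type u :=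
  LinearMap.ker X.α ⧸ (LinearMap.range X.β).submoduleOf (LinearMap.ker X.α)

variable (Q) in
/-- The `ℤ/2`-graded complexes of finitely generated projective modules with finite length
homology. -/
def finiteLengthHomology : Set (MatrixFactorization Q (0 : Q)) :=
  {X | Module.length Q X.H0 ≠ ⊤ ∧ Module.length Q X.H1 ≠ ⊤}

/-- The Euler characteristic `length H⁰ - length H¹`. -/
noncomputable def eulerChar (X : MatrixFactorization Q (0 : Q)) : ℤ :=
  ((Module.length Q X.H0).toNat : ℤ) - ((Module.length Q X.H1).toNat : ℤ)

/-- Exchanging the two parts. -/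
def swap (X : MatrixFactorization Q f) : MatrixFactorization Q f where
  P0 := X.P1
  P1 := X.P0
  α := X.β
  β := X.α
  α_β := X.β_α
  β_α := X.α_β

/-- Exchanging the two parts of a morphism. -/
def Hom.swap {X Y : MatrixFactorization Q f} (φ : Hom X Y) : Hom X.swap Y.swap where
  φ0 := φ.φ1
  φ1 := φ.φ0
  comm_α := φ.comm_β
  comm_β := φ.comm_α

theorem IsShortExact.swap {X Y Z : MatrixFactorization Q f} {φ : Hom X Y} {ψ : Hom Y Z}
    (h : IsShortExact φ ψ) : IsShortExact φ.swap ψ.swap :=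
  ⟨h.inj1, h.inj0, h.exact1, h.exact0, h.surj1, h.surj0⟩

/-- The map induced on even homology. -/
def Hom.mapH0 {X Y : MatrixFactorization Q (0 : Q)} (φ : Hom X Y) : X.H0 →ₗ[Q] Y.H0 :=
  Submodule.mapQ _ _
    ((φ.φ0 ∘ₗ (LinearMap.ker X.β).subtype).codRestrict (LinearMap.ker Y.β) (fun x => by
      simp [LinearMap.mem_ker, ← φ.comm_β]))
    (by
      rintro ⟨x, hx⟩ ⟨y, hy⟩
      exact ⟨φ.φ1 y, by rw [← φ.comm_α, hy]; rfl⟩)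

/-- The class in even homology of a cycle. -/
def H0.mk {X : MatrixFactorization Q (0 : Q)} (x : X.P0) (hx : X.β x = 0) : X.H0 :=
  Submodule.Quotient.mk ⟨x, hx⟩

theorem H0.ind {X : MatrixFactorization Q (0 : Q)} {p : X.H0 → Prop}
    (h : ∀ x hx, p (H0.mk x hx)) (z) : p z := by
  induction z using Submodule.Quotient.induction_on with
  | H z => exact h z.1 z.2

theorem H0.mk_eq_zero {X : MatrixFactorization Q (0 : Q)} {x : X.P0} {hx : X.β x = 0} :
    H0.mk x hx = 0 ↔ ∃ y, X.α y = x :=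
  Submodule.Quotient.mk_eq_zero _

theorem H0.mk_eq_mk {X : MatrixFactorization Q (0 : Q)} {x x' : X.P0} {hx : X.β x = 0}
    {hx' : X.β x' = 0} : H0.mk x hx = H0.mk x' hx' ↔ ∃ y, X.α y = x - x' :=
  Submodule.Quotient.eq _

theorem Hom.mapH0_mk {X Y : MatrixFactorization Q (0 : Q)} (φ : Hom X Y) (x : X.P0)
    (hx : X.β x = 0) :
    φ.mapH0 (H0.mk x hx) = H0.mk (φ.φ0 x) (by rw [← φ.comm_β, hx, map_zero]) := rfl

theorem length_H0_eq_of_homotopyEquivalent {X Y : MatrixFactorization Q (0 : Q)}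
    (h : HomotopyEquivalent X Y) : Module.length Q X.H0 = Module.length Q Y.H0 := by
  obtain ⟨φ, ψ, ⟨k0, k1, hk, -⟩, l0, l1, hl, -⟩ := h
  refine LinearEquiv.length_eq (LinearEquiv.ofLinearMap φ.mapH0 ψ.mapH0 ?_ ?_)
  · refine LinearMap.ext fun z => ?_
    refine H0.ind (p := fun z => φ.mapH0 (ψ.mapH0 z) = z) (fun x hx => ?_) z
    rw [Hom.mapH0_mk, Hom.mapH0_mk, H0.mk_eq_mk]
    refine ⟨l0 x, ?_⟩
    have := hl x
    rw [hx, map_zero, add_zero] at this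
    exact this
  · refine LinearMap.ext fun z => ?_
    refine H0.ind (p := fun z => ψ.mapH0 (φ.mapH0 z) = z) (fun x hx => ?_) z
    rw [Hom.mapH0_mk, Hom.mapH0_mk, H0.mk_eq_mk]
    refine ⟨k0 x, ?_⟩
    have := hk x
    rw [hx, map_zero, add_zero] at this
    exact this

theorem HomotopyEquivalent.swap {X Y : MatrixFactorization Q f} (h : HomotopyEquivalent X Y) :
    HomotopyEquivalent X.swap Y.swap := by
  obtain ⟨φ, ψ, ⟨k0, k1, H0, H1⟩, l0, l1, H0', H1'⟩ := h
  exact ⟨φ.swap, ψ.swap, ⟨k1, k0, H1, H0⟩, l1, l0, H1', H0'⟩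

theorem eulerChar_eq_of_homotopyEquivalent {X Y : MatrixFactorization Q (0 : Q)}
    (h : HomotopyEquivalent X Y) : X.eulerChar = Y.eulerChar := by
  have h1 : Module.length Q X.H1 = Module.length Q Y.H1 :=
    length_H0_eq_of_homotopyEquivalent h.swap
  rw [eulerChar, eulerChar, length_H0_eq_of_homotopyEquivalent h, h1]

theorem IsShortExact.exact_mapH0 {X Y Z : MatrixFactorization Q (0 : Q)} {φ : Hom X Y}
    {ψ : Hom Y Z} (h : IsShortExact φ ψ) : Function.Exact φ.mapH0 ψ.mapH0 := by
  intro z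
  refine H0.ind (p := fun z => ψ.mapH0 z = 0 ↔ z ∈ Set.range φ.mapH0) (fun y hy => ?_) z
  constructor
  · intro H
    rw [Hom.mapH0_mk, H0.mk_eq_zero] at H
    obtain ⟨c, hc⟩ := H
    obtain ⟨b, rfl⟩ := h.surj1 c
    rw [← ψ.comm_α] at hc
    obtain ⟨a, ha⟩ := (h.exact0 (y - Y.α b)).1 (by rw [map_sub, hc, sub_self])
    have hβ : X.β a = 0 := by
      apply h.inj1
      rw [φ.comm_β, ha, map_sub, hy, Y.β_α]
      simp
    refine ⟨H0.mk a hβ, ?_⟩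
    rw [Hom.mapH0_mk, H0.mk_eq_mk]
    exact ⟨-b, by rw [ha]; simp⟩
  · rintro ⟨w, hw⟩
    rw [← hw]
    refine H0.ind (p := fun w => ψ.mapH0 (φ.mapH0 w) = 0) (fun x hx => ?_) w
    rw [Hom.mapH0_mk, Hom.mapH0_mk, H0.mk_eq_zero]
    exact ⟨0, by rw [map_zero, h.exact0.apply_apply_eq_zero]⟩

/-- The connecting isomorphism, on the level of lengths. -/
theorem IsShortExact.length_connecting {X Y Z : MatrixFactorization Q (0 : Q)} {φ : Hom X Y}
    {ψ : Hom Y Z} (h : IsShortExact φ ψ) :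
    Module.length Q (Z.H0 ⧸ LinearMap.range ψ.mapH0) =
      Module.length Q (LinearMap.ker φ.swap.mapH0) := by
  let W : Submodule Q Y.P0 := (LinearMap.range φ.φ1).comap Y.β
  let j : X.P1 ≃ₗ[Q] LinearMap.range φ.φ1 := LinearEquiv.ofInjective φ.φ1 h.inj1
  let ρ : W →ₗ[Q] X.P1 := j.symm.toLinearMap ∘ₗ (Y.β.restrict (fun x hx => hx))
  have hρ : ∀ w : W, φ.φ1 (ρ w) = Y.β w := fun w => by
    have := congrArg Subtype.val (j.apply_symm_apply ((Y.β.restrict (fun x hx => hx)) w))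
    exact this
  have hρα : ∀ w : W, X.α (ρ w) = 0 := fun w => by
    apply h.inj0
    rw [φ.comm_α, hρ, Y.α_β]
    simp
  have hψβ : ∀ w : W, Z.β (ψ.φ0 w) = 0 := fun w => by
    rw [← ψ.comm_β, ← hρ, h.exact1.apply_apply_eq_zero]
  let s : W →ₗ[Q] Z.H0 ⧸ LinearMap.range ψ.mapH0 :=
    (LinearMap.range ψ.mapH0).mkQ ∘ₗ Submodule.mkQ _ ∘ₗ
      ((ψ.φ0 ∘ₗ W.subtype).codRestrict (LinearMap.ker Z.β) hψβ)
  let t0 : W →ₗ[Q] X.swap.H0 := Submodule.mkQ _ ∘ₗ (ρ.codRestrict (LinearMap.ker X.α) hρα)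
  have ht0 : ∀ w : W, t0 w = H0.mk (X := X.swap) (ρ w) (hρα w) := fun w => rfl
  have hs0 : ∀ w : W, s w = (LinearMap.range ψ.mapH0).mkQ (H0.mk (ψ.φ0 w) (hψβ w)) :=
    fun w => rfl
  let t : W →ₗ[Q] LinearMap.ker φ.swap.mapH0 := t0.codRestrict _ (fun w => by
    show H0.mk (X := Y.swap) _ _ = 0
    exact H0.mk_eq_zero.2 ⟨(w : Y.P0), (hρ w).symm⟩)
  have hs : Function.Surjective s := by
    intro z
    obtain ⟨z, rfl⟩ := Submodule.mkQ_surjective _ z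
    refine H0.ind (p := fun z => ∃ w, s w = (LinearMap.range ψ.mapH0).mkQ z) (fun c hc => ?_) z
    obtain ⟨b, rfl⟩ := h.surj0 c
    exact ⟨⟨b, (h.exact1 _).1 (by rw [ψ.comm_β, hc])⟩, rfl⟩
  have ht : Function.Surjective t := by
    rintro ⟨z, hz⟩
    revert hz
    refine H0.ind (p := fun z => ∀ hz : z ∈ LinearMap.ker φ.swap.mapH0, ∃ w, t w = ⟨z, hz⟩)
      (fun a ha hz => ?_) z
    have hz' := hz
    rw [LinearMap.mem_ker, Hom.mapH0_mk, H0.mk_eq_zero] at hz'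
    obtain ⟨b, hb⟩ := hz'
    refine ⟨⟨b, ⟨a, hb.symm⟩⟩, Subtype.ext ?_⟩
    have : ρ ⟨b, ⟨a, hb.symm⟩⟩ = a := h.inj1 ((hρ _).trans hb)
    show t0 _ = _
    rw [ht0]
    congr 1
  have hker : LinearMap.ker s = LinearMap.ker t := by
    ext w
    have e1 : w ∈ LinearMap.ker s ↔ ∃ b, Y.β b = 0 ∧ ∃ c, Z.α c = ψ.φ0 b - ψ.φ0 w := by
      rw [LinearMap.mem_ker, hs0, Submodule.mkQ_apply, Submodule.Quotient.mk_eq_zero]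
      constructor
      · rintro ⟨y, hy⟩
        revert hy
        refine H0.ind (p := fun y => ψ.mapH0 y = _ → _) (fun b hb hy => ?_) y
        rw [Hom.mapH0_mk, H0.mk_eq_mk] at hy
        exact ⟨b, hb, hy⟩
      · rintro ⟨b, hb, hc⟩
        exact ⟨H0.mk b hb, by rw [Hom.mapH0_mk, H0.mk_eq_mk]; exact hc⟩
    have e2 : w ∈ LinearMap.ker t ↔ ∃ a, X.β a = ρ w := by
      rw [LinearMap.mem_ker, ← Subtype.coe_inj]
      exact H0.mk_eq_zero (X := X.swap)
    rw [e1, e2]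
    constructor
    · rintro ⟨b, hb, c, hc⟩
      obtain ⟨b', rfl⟩ := h.surj1 c
      rw [← ψ.comm_α] at hc
      obtain ⟨a, ha⟩ := (h.exact0 ((w : Y.P0) - b + Y.α b')).1 (by
        rw [map_add, map_sub, hc, sub_add_sub_cancel, sub_self])
      refine ⟨a, h.inj1 ?_⟩
      rw [φ.comm_β, ha, hρ, map_add, map_sub, hb, Y.β_α]
      simp
    · rintro ⟨a, ha⟩
      refine ⟨(w : Y.P0) - φ.φ0 a, ?_, 0, ?_⟩
      · rw [map_sub, ← φ.comm_β, ha, hρ, sub_self]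
      · rw [map_zero, map_sub, h.exact0.apply_apply_eq_zero, sub_zero, sub_self]
  rw [← (s.quotKerEquivOfSurjective hs).length_eq, ← (t.quotKerEquivOfSurjective ht).length_eq,
    hker]

theorem length_ker_add_length_range {M N : Type*} [AddCommGroup M] [AddCommGroup N] [Module Q M]
    [Module Q N] (u : M →ₗ[Q] N) :
    Module.length Q M = Module.length Q (LinearMap.ker u) + Module.length Q (LinearMap.range u) :=
  Module.length_eq_add_of_exact (LinearMap.ker u).subtype u.rangeRestrict
    (Submodule.subtype_injective _) u.surjective_rangeRestrict (by
      rw [LinearMap.exact_iff, LinearMap.ker_rangeRestrict, Submodule.range_subtype])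

theorem length_add_length_quotient {M : Type*} [AddCommGroup M] [Module Q M]
    (N : Submodule Q M) :
    Module.length Q M = Module.length Q N + Module.length Q (M ⧸ N) :=
  Module.length_eq_add_of_exact N.subtype N.mkQ N.subtype_injective N.mkQ_surjective
    (LinearMap.exact_subtype_mkQ N)

theorem eulerChar_add {X Y Z : MatrixFactorization Q (0 : Q)} (hX : X ∈ finiteLengthHomology Q)
    (hY : Y ∈ finiteLengthHomology Q) (hZ : Z ∈ finiteLengthHomology Q) {φ : Hom X Y}
    {ψ : Hom Y Z} (h : IsShortExact φ ψ) : Y.eulerChar = X.eulerChar + Z.eulerChar := by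
  have a0 := length_ker_add_length_range φ.mapH0
  have a1 := length_ker_add_length_range φ.swap.mapH0
  have b0 := length_ker_add_length_range ψ.mapH0
  have b1 := length_ker_add_length_range ψ.swap.mapH0
  rw [h.exact_mapH0.linearMap_ker_eq] at b0
  rw [h.swap.exact_mapH0.linearMap_ker_eq] at b1
  have c0 := length_add_length_quotient (LinearMap.range ψ.mapH0)
  have c1 := length_add_length_quotient (LinearMap.range ψ.swap.mapH0)
  rw [h.length_connecting] at c0
  rw [h.swap.length_connecting] at c1
  change Module.length Q X.H1 = _ at a1
  change Module.length Q Y.H1 = _ at b1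
  change Module.length Q Z.H1 = _ + Module.length Q (LinearMap.ker φ.mapH0) at c1
  obtain ⟨hX0, hX1⟩ := hX
  obtain ⟨hY0, hY1⟩ := hY
  obtain ⟨hZ0, hZ1⟩ := hZ
  simp only [eulerChar]
  generalize Module.length Q X.H0 = x0 at *
  generalize Module.length Q Y.H0 = y0 at *
  generalize Module.length Q Z.H0 = z0 at *
  generalize Module.length Q X.H1 = x1 at *
  generalize Module.length Q Y.H1 = y1 at *
  generalize Module.length Q Z.H1 = z1 at *
  generalize Module.length Q (LinearMap.ker φ.mapH0) = k0 at *
  generalize Module.length Q (LinearMap.ker φ.swap.mapH0) = k1 at *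
  generalize Module.length Q (LinearMap.range φ.mapH0) = i0 at *
  generalize Module.length Q (LinearMap.range φ.swap.mapH0) = i1 at *
  generalize Module.length Q (LinearMap.range ψ.mapH0) = j0 at *
  generalize Module.length Q (LinearMap.range ψ.swap.mapH0) = j1 at *
  subst a0 a1 b0 b1 c0 c1
  simp only [ne_eq, ENat.add_eq_top, not_or] at *
  rw [ENat.toNat_add hX0.1 hX0.2, ENat.toNat_add hX1.1 hX1.2, ENat.toNat_add hY0.1 hY0.2,
    ENat.toNat_add hY1.1 hY1.2, ENat.toNat_add hZ0.1 hZ0.2, ENat.toNat_add hZ1.1 hZ1.2]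
  push_cast
  ring

variable (Q) in
/-- The Euler characteristic `χ : K₀ → ℤ` on the Grothendieck group of `ℤ/2`-graded complexes of
finitely generated projective modules with finite length homology, `χ [X] = eulerChar X`. -/
noncomputable def chi : K0On (finiteLengthHomology Q) →+ ℤ :=
  K0On.lift (fun X => X.1.eulerChar) (fun X Y Z _ _ h => eulerChar_add X.2 Y.2 Z.2 h)
    (fun _ _ h => eulerChar_eq_of_homotopyEquivalent h)

end MatrixFactorization

/-! ### The Grothendieck group of finitely generated modules -/

section G0

variable (R : Type u) [CommRing R]

/-- The relations of `G₀(R)`: additivity on short exact sequences. -/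
def g0Relations : Set (FreeAbelianGroup (FGModuleCat.{u} R)) :=
  {z | ∃ (A B C : FGModuleCat.{u} R) (i : A →ₗ[R] B) (p : B →ₗ[R] C),
    Function.Injective i ∧ Function.Exact i p ∧ Function.Surjective p ∧
      z = FreeAbelianGroup.of B - (FreeAbelianGroup.of A + FreeAbelianGroup.of C)}

/-- `G₀(R)`, the Grothendieck group of finitely generated `R`-modules. -/
abbrev G0 : Type (u + 1) :=
  FreeAbelianGroup (FGModuleCat.{u} R) ⧸ AddSubgroup.closure (g0Relations R)

/-- The class `[M] ∈ G₀(R)` of a finitely generated module. -/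
def G0.mk (M : Type u) [AddCommGroup M] [Module R M] [Module.Finite R M] : G0 R :=
  QuotientAddGroup.mk (FreeAbelianGroup.of (FGModuleCat.of R M))

/-- The image of `K₀(R) → G₀(R)`: the subgroup generated by the finitely generated projective
modules. -/
def projectiveClasses : AddSubgroup (G0 R) :=
  AddSubgroup.closure {z | ∃ P : FGModuleCat.{u} R, Module.Projective R P ∧ z = G0.mk R P}

variable {R}

theorem G0.mk_eq_add {A B C : Type u} [AddCommGroup A] [Module R A] [Module.Finite R A]
    [AddCommGroup B] [Module R B] [Module.Finite R B] [AddCommGroup C] [Module R C]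
    [Module.Finite R C] (i : A →ₗ[R] B) (p : B →ₗ[R] C) (hi : Function.Injective i)
    (h : Function.Exact i p) (hp : Function.Surjective p) :
    G0.mk R B = G0.mk R A + G0.mk R C := by
  have : (FreeAbelianGroup.of (FGModuleCat.of R B) -
      (FreeAbelianGroup.of (FGModuleCat.of R A) + FreeAbelianGroup.of (FGModuleCat.of R C))) ∈
      AddSubgroup.closure (g0Relations R) :=
    AddSubgroup.subset_closure ⟨FGModuleCat.of R A, FGModuleCat.of R B, FGModuleCat.of R C,
      i, p, hi, h, hp, rfl⟩
  have h2 := (QuotientAddGroup.eq_zero_iff _).2 this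
  exact sub_eq_zero.1 h2

variable (R) in
/-- The class of a finitely generated module in `G₀(R) / im (K₀(R) → G₀(R))`. -/
def G0.stableMk (M : Type u) [AddCommGroup M] [Module R M] [Module.Finite R M] :
    G0 R ⧸ projectiveClasses R :=
  QuotientAddGroup.mk (G0.mk R M)

theorem G0.stableMk_eq_zero (P : Type u) [AddCommGroup P] [Module R P] [Module.Finite R P]
    [Module.Projective R P] : G0.stableMk R P = 0 :=
  (QuotientAddGroup.eq_zero_iff _).2 (AddSubgroup.subset_closure
    ⟨FGModuleCat.of R P, ‹Module.Projective R P›, rfl⟩)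

theorem G0.stableMk_eq_add {A B C : Type u} [AddCommGroup A] [Module R A] [Module.Finite R A]
    [AddCommGroup B] [Module R B] [Module.Finite R B] [AddCommGroup C] [Module R C]
    [Module.Finite R C] (i : A →ₗ[R] B) (p : B →ₗ[R] C) (hi : Function.Injective i)
    (h : Function.Exact i p) (hp : Function.Surjective p) :
    G0.stableMk R B = G0.stableMk R A + G0.stableMk R C := by
  rw [G0.stableMk, G0.mk_eq_add i p hi h hp]; rfl

/-- Two modules which are inverse to each other up to maps factoring through finitely generated
projective modules have the same class in `G₀(R) / im K₀(R)`. -/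
theorem G0.stableMk_eq_of_stableEquiv {A B F F' : Type u} [AddCommGroup A]
    [Module R A] [Module.Finite R A] [AddCommGroup B] [Module R B] [Module.Finite R B]
    [AddCommGroup F] [Module R F] [Module.Finite R F] [Module.Projective R F]
    [AddCommGroup F'] [Module R F'] [Module.Finite R F'] [Module.Projective R F']
    (u : A →ₗ[R] B) (v : B →ₗ[R] A) (φ : A →ₗ[R] F) (ψ : F →ₗ[R] A) (φ' : B →ₗ[R] F')
    (ψ' : F' →ₗ[R] B) (h : ∀ a, v (u a) - a = ψ (φ a)) (h' : ∀ b, u (v b) - b = ψ' (φ' b)) :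
    G0.stableMk R A = G0.stableMk R B := by
  -- `r` is a split surjection with projective kernel
  let r : B × F →ₗ[R] A := LinearMap.coprod v (-ψ)
  let i : A →ₗ[R] B × F := LinearMap.prod u φ
  have hri : ∀ a, r (i a) = a := fun a => by
    have := h a
    show v (u a) + -ψ (φ a) = a
    rw [← this, ← sub_eq_add_neg, sub_sub_cancel]
  have hr : Function.Surjective r := fun a => ⟨i a, hri a⟩
  let K := LinearMap.ker r
  let a : K →ₗ[R] F × F' := LinearMap.prod (LinearMap.snd R B F ∘ₗ K.subtype)
    (φ' ∘ₗ LinearMap.fst R B F ∘ₗ K.subtype)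
  let b0 : F × F' →ₗ[R] B × F := LinearMap.prod
    (LinearMap.coprod (u ∘ₗ ψ) (-ψ')) (LinearMap.fst R F F')
  let b1 : B × F →ₗ[R] K := (LinearMap.id - i ∘ₗ r).codRestrict K (fun x => by
    simp [K, LinearMap.mem_ker, hri])
  have hab : (b1 ∘ₗ b0) ∘ₗ a = LinearMap.id := by
    ext1 ⟨⟨x, y⟩, hx⟩
    have hx' : v x = ψ y := by
      have : v x + -ψ y = 0 := by simpa [K, r] using hx
      exact add_neg_eq_zero.1 this
    have e : b0 (a ⟨⟨x, y⟩, hx⟩) = (x, y) := by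
      have := h' x
      rw [hx'] at this
      show (u (ψ y) + -ψ' (φ' x), y) = (x, y)
      rw [← this, ← sub_eq_add_neg, sub_sub_cancel]
    refine Subtype.ext ?_
    show b0 (a ⟨⟨x, y⟩, hx⟩) - i (r (b0 (a ⟨⟨x, y⟩, hx⟩))) = (x, y)
    rw [e, LinearMap.mem_ker.1 hx, map_zero, sub_zero]
  have : Module.Finite R K := Module.Finite.of_surjective (b1 ∘ₗ b0)
    fun k => ⟨a k, LinearMap.congr_fun hab k⟩
  have : Module.Projective R K := Module.Projective.of_split a (b1 ∘ₗ b0) hab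
  have e1 : G0.stableMk R (B × F) = G0.stableMk R K + G0.stableMk R A :=
    G0.stableMk_eq_add K.subtype r K.subtype_injective (LinearMap.exact_subtype_ker_map r) hr
  have e2 : G0.stableMk R (B × F) = G0.stableMk R B + G0.stableMk R F :=
    G0.stableMk_eq_add (LinearMap.inl R B F) (LinearMap.snd R B F) LinearMap.inl_injective
      Function.Exact.inl_snd LinearMap.snd_surjective
  rw [G0.stableMk_eq_zero K, zero_add] at e1
  rw [G0.stableMk_eq_zero F, add_zero] at e2
  exact e1.symm.trans e2

end G0

namespace MatrixFactorization

variable {Q : Type u} [CommRing Q] {f : Q}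

/-! ### Cokernels and stable classes -/

/-- `coker α`, which is a module over `Q / (f)`. -/
def coker (X : MatrixFactorization Q f) : Type u := X.P0 ⧸ LinearMap.range X.α

instance (X : MatrixFactorization Q f) : AddCommGroup X.coker :=
  inferInstanceAs (AddCommGroup (X.P0 ⧸ LinearMap.range X.α))

instance (X : MatrixFactorization Q f) : Module Q X.coker :=
  inferInstanceAs (Module Q (X.P0 ⧸ LinearMap.range X.α))

/-- The projection `P0 → coker α`. -/
def toCoker (X : MatrixFactorization Q f) : X.P0 →ₗ[Q] X.coker := (LinearMap.range X.α).mkQ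

theorem toCoker_surjective (X : MatrixFactorization Q f) : Function.Surjective X.toCoker :=
  Submodule.mkQ_surjective _

theorem toCoker_eq_zero {X : MatrixFactorization Q f} {x : X.P0} :
    X.toCoker x = 0 ↔ ∃ y, X.α y = x :=
  Submodule.Quotient.mk_eq_zero _

theorem isTorsionBySet_coker (X : MatrixFactorization Q f) :
    Module.IsTorsionBySet Q X.coker (Ideal.span {f} : Ideal Q) := by
  rw [Module.isTorsionBySet_span_singleton_iff]
  intro x
  obtain ⟨x, rfl⟩ := X.toCoker_surjective x
  rw [← map_smul, toCoker_eq_zero]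
  exact ⟨X.β x, X.α_β x⟩

instance (X : MatrixFactorization Q f) : Module (Q ⧸ Ideal.span {f}) X.coker :=
  X.isTorsionBySet_coker.module

instance (X : MatrixFactorization Q f) :
    @IsScalarTower Q (Q ⧸ Ideal.span {f}) X.coker Algebra.toSMul _ _ :=
  X.isTorsionBySet_coker.isScalarTower

instance (X : MatrixFactorization Q f) : Module.Finite Q X.coker :=
  Module.Finite.of_surjective X.toCoker X.toCoker_surjective

instance (X : MatrixFactorization Q f) : Module.Finite (Q ⧸ Ideal.span {f}) X.coker :=
  Module.Finite.of_restrictScalars_finite Q _ _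

/-- The `Q`-linear map out of `coker α` induced by a map vanishing on the image of `α`. -/
def cokerLift (X : MatrixFactorization Q f) {M : Type*} [AddCommGroup M] [Module Q M]
    (u : X.P0 →ₗ[Q] M) (hu : ∀ y, u (X.α y) = 0) : X.coker →ₗ[Q] M :=
  Submodule.liftQ (LinearMap.range X.α) u (by rintro _ ⟨x, rfl⟩; exact hu x)

/-- The map induced on cokernels. -/
def Hom.mapCoker {X Y : MatrixFactorization Q f} (φ : Hom X Y) :
    X.coker →ₗ[Q ⧸ Ideal.span {f}] Y.coker :=
  LinearMap.extendScalarsOfSurjective (R := Q) Ideal.Quotient.mk_surjective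
    (X.cokerLift (Y.toCoker ∘ₗ φ.φ0) (fun y => toCoker_eq_zero.2
      ⟨φ.φ1 y, (φ.comm_α y).symm⟩))

theorem Hom.mapCoker_toCoker {X Y : MatrixFactorization Q f} (φ : Hom X Y) (x : X.P0) :
    φ.mapCoker (X.toCoker x) = Y.toCoker (φ.φ0 x) := rfl

theorem smul_tmul_quot_eq_zero {P : Type*} [AddCommGroup P] [Module Q P] (x : P) :
    (1 : Q ⧸ Ideal.span {f}) ⊗ₜ[Q] (f • x) = 0 := by
  rw [← TensorProduct.smul_tmul, Algebra.smul_def, Ideal.Quotient.algebraMap_eq,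
    Ideal.Quotient.eq_zero_iff_mem.2 (Ideal.mem_span_singleton_self f), zero_mul,
    TensorProduct.zero_tmul]

/-- The map `coker α → P1 / f P1` induced by `β`. -/
def cokerβ (X : MatrixFactorization Q f) :
    X.coker →ₗ[Q ⧸ Ideal.span {f}] (Q ⧸ Ideal.span {f}) ⊗[Q] X.P1 :=
  LinearMap.extendScalarsOfSurjective (R := Q) Ideal.Quotient.mk_surjective
    (X.cokerLift (TensorProduct.mk Q (Q ⧸ Ideal.span {f}) X.P1 1 ∘ₗ X.β) (fun y => by
      rw [LinearMap.comp_apply, X.β_α, TensorProduct.mk_apply, smul_tmul_quot_eq_zero]))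

theorem cokerβ_toCoker (X : MatrixFactorization Q f) (x : X.P0) :
    X.cokerβ (X.toCoker x) = 1 ⊗ₜ X.β x := rfl

theorem stableMk_coker_eq_of_homotopyEquivalent {X Y : MatrixFactorization Q f}
    (h : HomotopyEquivalent X Y) :
    G0.stableMk (Q ⧸ Ideal.span {f}) X.coker = G0.stableMk (Q ⧸ Ideal.span {f}) Y.coker := by
  obtain ⟨φ, ψ, ⟨k0, k1, hk, -⟩, l0, l1, hl, -⟩ := h
  refine G0.stableMk_eq_of_stableEquiv φ.mapCoker ψ.mapCoker X.cokerβ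
    (LinearMap.liftBaseChange _ (X.toCoker ∘ₗ k1)) Y.cokerβ
    (LinearMap.liftBaseChange _ (Y.toCoker ∘ₗ l1)) (fun a => ?_) (fun b => ?_)
  · obtain ⟨x, rfl⟩ := X.toCoker_surjective a
    rw [cokerβ_toCoker, Hom.mapCoker_toCoker, Hom.mapCoker_toCoker,
      LinearMap.liftBaseChange_tmul, one_smul, LinearMap.comp_apply, ← map_sub, ← sub_eq_zero,
      ← map_sub, toCoker_eq_zero]
    refine ⟨k0 x, ?_⟩
    have := hk x
    exact eq_sub_of_add_eq this
  · obtain ⟨x, rfl⟩ := Y.toCoker_surjective b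
    rw [cokerβ_toCoker, Hom.mapCoker_toCoker, Hom.mapCoker_toCoker,
      LinearMap.liftBaseChange_tmul, one_smul, LinearMap.comp_apply, ← map_sub, ← sub_eq_zero,
      ← map_sub, toCoker_eq_zero]
    refine ⟨l0 x, ?_⟩
    have := hl x
    exact eq_sub_of_add_eq this

theorem α_injective (hf : f ∈ nonZeroDivisors Q) (X : MatrixFactorization Q f) :
    Function.Injective X.α := by
  rw [injective_iff_map_eq_zero]
  intro x hx
  have h : f • x = f • 0 := by rw [← X.β_α, hx, map_zero, smul_zero]
  exact Module.Flat.isSMulRegular_of_nonZeroDivisors hf h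

theorem stableMk_coker_eq_add (hf : f ∈ nonZeroDivisors Q) {X Y Z : MatrixFactorization Q f}
    {φ : Hom X Y} {ψ : Hom Y Z} (h : IsShortExact φ ψ) :
    G0.stableMk (Q ⧸ Ideal.span {f}) Y.coker =
      G0.stableMk (Q ⧸ Ideal.span {f}) X.coker + G0.stableMk (Q ⧸ Ideal.span {f}) Z.coker := by
  refine G0.stableMk_eq_add φ.mapCoker ψ.mapCoker ?_ ?_ ?_
  · rw [injective_iff_map_eq_zero]
    intro a ha
    obtain ⟨x, rfl⟩ := X.toCoker_surjective a
    rw [Hom.mapCoker_toCoker, toCoker_eq_zero] at ha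
    obtain ⟨y, hy⟩ := ha
    have hz : ψ.φ1 y = 0 := by
      apply Z.α_injective hf
      rw [← ψ.comm_α, hy, h.exact0.apply_apply_eq_zero, map_zero]
    obtain ⟨w, rfl⟩ := (h.exact1 y).1 hz
    rw [toCoker_eq_zero]
    exact ⟨w, h.inj0 (by rw [φ.comm_α, hy])⟩
  · intro b
    obtain ⟨y, rfl⟩ := Y.toCoker_surjective b
    constructor
    · intro hb
      rw [Hom.mapCoker_toCoker, toCoker_eq_zero] at hb
      obtain ⟨z, hz⟩ := hb
      obtain ⟨w, rfl⟩ := h.surj1 z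
      rw [← ψ.comm_α] at hz
      obtain ⟨x, hx⟩ := (h.exact0 (y - Y.α w)).1 (by rw [map_sub, hz, sub_self])
      refine ⟨X.toCoker x, ?_⟩
      rw [Hom.mapCoker_toCoker, hx, map_sub, toCoker_eq_zero.2 ⟨w, rfl⟩, sub_zero]
    · rintro ⟨a, ha⟩
      obtain ⟨x, rfl⟩ := X.toCoker_surjective a
      rw [← ha, Hom.mapCoker_toCoker, Hom.mapCoker_toCoker, h.exact0.apply_apply_eq_zero, map_zero]
  · intro c
    obtain ⟨z, rfl⟩ := Z.toCoker_surjective c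
    obtain ⟨y, rfl⟩ := h.surj0 z
    exact ⟨Y.toCoker y, rfl⟩

/-- The homomorphism `K₀(mf(Q, f)) → G₀(R) / im (K₀(R) → G₀(R))`, `R = Q / (f)`, sending the class
of `(α, β)` to that of `coker α`. -/
def cokerK0 (hf : f ∈ nonZeroDivisors Q) :
    K0 Q f →+ G0 (Q ⧸ Ideal.span {f}) ⧸ projectiveClasses (Q ⧸ Ideal.span {f}) :=
  K0On.lift (fun X => G0.stableMk (Q ⧸ Ideal.span {f}) X.1.coker)
    (fun _ _ _ _ _ h => stableMk_coker_eq_add hf h)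
    (fun _ _ h => stableMk_coker_eq_of_homotopyEquivalent h)

/-- The surjection `G₀(R) → K₀(mf(Q, f))` obtained from the isomorphism
`K₀(mf(Q, f)) ≅ G₀(R) / im (K₀(R) → G₀(R))`, `[(α, β)] ↦ [coker α]`. -/
noncomputable def stabilization (hf : f ∈ nonZeroDivisors Q)
    (h : Function.Bijective (cokerK0 hf)) : G0 (Q ⧸ Ideal.span {f}) →+ K0 Q f :=
  (AddEquiv.ofBijective (cokerK0 hf) h).symm.toAddMonoidHom.comp (QuotientAddGroup.mk' _)

/-- `[M]_stable ∈ K₀(mf(Q, f))` for a finitely generated `Q / (f)`-module `M`. -/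
noncomputable def stableClass (hf : f ∈ nonZeroDivisors Q)
    (h : Function.Bijective (cokerK0 hf)) (M : Type u) [AddCommGroup M]
    [Module (Q ⧸ Ideal.span {f}) M] [Module.Finite (Q ⧸ Ideal.span {f}) M] : K0 Q f :=
  stabilization hf h (G0.mk _ M)

end MatrixFactorization

/-! ### Hochster's theta pairing -/

section Theta

open CategoryTheory

variable (R : Type u) [CommRing R]

/-- The length of `Tor_n^R(M, N)`. -/
noncomputable def lengthTor (n : ℕ) (M N : Type u) [AddCommGroup M] [Module R M] [AddCommGroup N]
    [Module R N] : ℕ∞ :=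
  Module.length R (((Tor (ModuleCat.{u} R) n).obj (ModuleCat.of R M)).obj (ModuleCat.of R N))

/-- `HasTheta R M N t`: the theta pairing of `M` and `N` is defined and has value `t`, that is, for
all large `n` the modules `Tor_{2n}` and `Tor_{2n+1}` have finite length and
`t = length Tor_{2n} - length Tor_{2n+1}`. -/
def HasTheta (M N : Type u) [AddCommGroup M] [Module R M] [AddCommGroup N] [Module R N] (t : ℤ) :
    Prop :=
  ∀ᶠ n : ℕ in Filter.atTop,
    lengthTor R (2 * n) M N ≠ ⊤ ∧ lengthTor R (2 * n + 1) M N ≠ ⊤ ∧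
      ((lengthTor R (2 * n) M N).toNat : ℤ) - ((lengthTor R (2 * n + 1) M N).toNat : ℤ) = t

end Theta

/-! The bridge between factorizations and modules is Eisenbud's. A regular local ring `Q` is a
domain, so `f` is regular, and its finitely generated modules have bounded projective dimension. If
an `R`-module `M` has projective dimension at most one over `Q`, a presentation `0 → K → P → M → 0`
has `K` projective. Since `f` kills `M`, multiplication by `f` maps `P` into `K`, and this is a
matrix factorization with cokernel `M`. It is determined by `M` up to homotopy, because maps of
cokernels lift uniquely up to homotopy. For arbitrary `M`, a syzygy over `R` lowers the projective
dimension over `Q` and changes the sign of the class modulo projectives. Induction on this dimension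
gives surjectivity of the cokernel map and a left inverse (`cokerK0_bijective`).

Finite length comes from the ideal of elements of `Q` that act null-homotopically on `X`. An element
`s` lies in it once multiplication by `s` on `coker α` factors through a free `R`-module
(`exists_homotopy_of_factor`). At a non-maximal prime containing `f` the localization of `R` is
regular. There `coker α` has finite projective dimension and is a syzygy of arbitrarily high order,
hence is projective. Clearing denominators gives such an `s` outside the prime. The ideal therefore
lies in no non-maximal prime (`isMaximal_of_nullIdeal_le`), and it kills the homology of `X ⊗ Y`.

For the theta pairing, `coker α` and `coker β` are syzygies of each other over `R`, so the Tor
lengths of cokernels are two-periodic in positive degrees. `Tor₁` is the kernel of a tensored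
inclusion, and a direct comparison identifies this kernel with the homology of `X ⊗ Y°`
(`length_H0_tensor_circ`). Arbitrary modules are reached through syzygies in each variable, each of
which negates both sides (`hasPeriodicTor_stableClass`). -/

section RegularLocalRing

/-! ### Regular local rings: domains whose maximal ideal is generated by a regular sequence. -/

open IsLocalRing RingTheory.Sequence

/-- An element of the maximal ideal outside its square and outside all minimal primes. -/
theorem IsLocalRing.exists_mem_maximalIdeal_notMem_sq_notMem_minimalPrimes (Q : Type u) [CommRing Q]
    [IsLocalRing Q] [IsNoetherianRing Q] (h : 1 ≤ ringKrullDim Q) :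
    ∃ x ∈ maximalIdeal Q, x ∉ maximalIdeal Q ^ 2 ∧ ∀ p ∈ minimalPrimes Q, x ∉ p := by
  have hheight : (maximalIdeal Q).height ≠ 0 := by
    intro h0
    rw [← maximalIdeal_height_eq_ringKrullDim, h0] at h
    exact absurd h (by decide)
  by_contra! H
  have hsub : (maximalIdeal Q : Set Q) ⊆
      ⋃ i ∈ insert (maximalIdeal Q ^ 2) (minimalPrimes Q), (i : Ideal Q) := by
    intro x hx
    by_cases hx2 : x ∈ maximalIdeal Q ^ 2
    · exact Set.mem_biUnion (Set.mem_insert _ _) hx2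
    · obtain ⟨p, hp, hxp⟩ := H x hx hx2
      exact Set.mem_biUnion (Set.mem_insert_of_mem _ hp) hxp
  have hfin : (insert (maximalIdeal Q ^ 2) (minimalPrimes Q)).Finite :=
    (minimalPrimes.finite_of_isNoetherianRing Q).insert _
  -- Prime avoidance tolerates two members of the union that are not prime; both exceptional slots
  -- are filled with the square of the maximal ideal.
  obtain ⟨i, hi, hle⟩ := (Ideal.subset_union_prime_finite hfin (f := id) (maximalIdeal Q ^ 2)
    (maximalIdeal Q ^ 2) (fun i hi h _ => by
      rcases hi with rfl | hi
      · exact absurd rfl h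
      · exact hi.1.1)).1 hsub
  rcases hi with rfl | hi
  -- If the maximal ideal equals its square, Nakayama makes it zero, which contradicts positive
  -- height.
  · have : maximalIdeal Q = ⊥ := by
      refine Submodule.eq_bot_of_le_smul_of_le_jacobson_bot (maximalIdeal Q) _
        (maximalIdeal Q).fg_of_isNoetherianRing ?_ (maximalIdeal_le_jacobson _)
      rwa [smul_eq_mul, ← pow_two]
    apply hheight
    rw [Ideal.height_eq_zero_iff, this]
    have : (⊥ : Ideal Q).IsPrime := this ▸ inferInstance
    exact ⟨⟨this, le_rfl⟩, fun _ _ _ => bot_le⟩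
  · have := hi.1.1
    have he : maximalIdeal Q = i := le_antisymm hle (le_maximalIdeal this.ne_top)
    exact hheight (Ideal.height_eq_zero_iff.2 (he ▸ hi))

/-- Dividing by an element outside the square of the maximal ideal lowers the number of generators
of the maximal ideal. -/
theorem IsLocalRing.spanFinrank_maximalIdeal_quotient_le {Q : Type u} [CommRing Q]
    [IsLocalRing Q] [IsNoetherianRing Q] {x : Q} (hx : x ∈ maximalIdeal Q)
    (hx2 : x ∉ maximalIdeal Q ^ 2) [IsLocalRing (Q ⧸ Ideal.span {x})] :
    (maximalIdeal (Q ⧸ Ideal.span {x})).spanFinrank + 1 ≤ (maximalIdeal Q).spanFinrank := by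
  let k := ResidueField Q
  let V := CotangentSpace Q
  let v : V := (maximalIdeal Q).toCotangent ⟨x, hx⟩
  have hv : v ≠ 0 := by
    intro h
    exact hx2 (((maximalIdeal Q).toCotangent_eq_zero _).1 h)
  let b := Module.finBasis k (V ⧸ Submodule.span k {v})
  have hdim : Module.finrank k (V ⧸ Submodule.span k {v}) + 1 = Module.finrank k V := by
    rw [← finrank_span_singleton (K := k) hv, Submodule.finrank_quotient_add_finrank]
  have hy : ∀ i, ∃ y : maximalIdeal Q, Submodule.Quotient.mk ((maximalIdeal Q).toCotangent y) = b i := by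
    intro i
    obtain ⟨w, hw⟩ := Submodule.Quotient.mk_surjective _ (b i)
    obtain ⟨y, rfl⟩ := (maximalIdeal Q).toCotangent_surjective w
    exact ⟨y, hw⟩
  choose y hy using hy
  let s : Set (maximalIdeal Q) := insert ⟨x, hx⟩ (Set.range y)
  -- By Nakayama it is enough to generate the cotangent space: the `y i` give a basis modulo the
  -- line of `x`, and `x` supplies the line. In `Q / (x)` the generator `x` disappears.
  have hs : Submodule.span k ((maximalIdeal Q).toCotangent '' s) = ⊤ := by
    have hmap : (Submodule.span k ((maximalIdeal Q).toCotangent '' s)).map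
        (Submodule.span k {v}).mkQ = ⊤ := by
      rw [eq_top_iff, ← b.span_eq, Submodule.span_le]
      rintro _ ⟨i, rfl⟩
      exact ⟨_, Submodule.subset_span ⟨y i, Set.mem_insert_of_mem _ ⟨i, rfl⟩, rfl⟩, hy i⟩
    have hvs : Submodule.span k {v} ≤ Submodule.span k ((maximalIdeal Q).toCotangent '' s) :=
      Submodule.span_mono (Set.singleton_subset_iff.2 ⟨_, Set.mem_insert _ _, rfl⟩)
    rwa [Submodule.map_mkQ_eq_top, sup_eq_right.2 hvs] at hmap
  rw [CotangentSpace.span_image_eq_top_iff] at hs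
  let π := Ideal.Quotient.mk (Ideal.span {x})
  have hm : maximalIdeal (Q ⧸ Ideal.span {x}) =
      Ideal.span (Set.range fun i => π (y i)) := by
    have h2 : maximalIdeal Q = Ideal.span (Subtype.val '' s) := by
      have := congrArg (Submodule.map (maximalIdeal Q).subtype) hs
      rw [Submodule.map_span, Submodule.map_top, Submodule.range_subtype] at this
      exact this.symm
    rw [← map_maximalIdeal_of_surjective π Ideal.Quotient.mk_surjective]
    refine (congrArg (Ideal.map π) h2).trans ?_
    rw [Ideal.map_span]
    refine le_antisymm (Ideal.span_le.2 ?_) (Ideal.span_mono ?_)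
    · rintro _ ⟨_, ⟨w, rfl | ⟨i, rfl⟩, rfl⟩, rfl⟩
      · rw [Ideal.Quotient.eq_zero_iff_mem.2 (Ideal.mem_span_singleton_self x)]
        exact Submodule.zero_mem _
      · exact Ideal.subset_span ⟨i, rfl⟩
    · rintro _ ⟨i, rfl⟩
      exact ⟨_, ⟨y i, Set.mem_insert_of_mem _ ⟨i, rfl⟩, rfl⟩, rfl⟩
  rw [spanFinrank_maximalIdeal_eq_finrank_cotangentSpace (R := Q), ← hdim, hm]
  refine Nat.succ_le_succ ?_
  refine (Submodule.spanFinrank_span_le_ncard_of_finite (Set.finite_range _)).trans ?_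
  rw [← Set.image_univ]
  refine (Set.ncard_image_le Set.finite_univ).trans ?_
  simp

/-- A regular local ring is a domain, and its maximal ideal is generated by a regular sequence. -/
theorem IsRegularLocalRing.isDomain_and_exists_isWeaklyRegular (n : ℕ) : ∀ (Q : Type u)
    [CommRing Q] [IsRegularLocalRing Q], (maximalIdeal Q).spanFinrank = n →
    IsDomain Q ∧ ∃ rs : List Q, IsWeaklyRegular Q rs ∧ Ideal.ofList rs = maximalIdeal Q := by
  induction n with
  | zero =>
    intro Q _ _ h
    rw [Submodule.spanFinrank_eq_zero_iff_eq_bot (maximalIdeal Q).fg_of_isNoetherianRing] at h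
    have hF : IsField Q := IsLocalRing.isField_iff_maximalIdeal_eq.2 h
    exact ⟨hF.isDomain, [], IsWeaklyRegular.nil _ _, by rw [h, Ideal.ofList_nil]⟩
  | succ n ih =>
    intro Q _ _ h
    have hdim : ringKrullDim Q = (n + 1 : ℕ) := by
      rw [← h, IsRegularLocalRing.spanFinrank_maximalIdeal]
    obtain ⟨x, hx, hx2, hxp⟩ :=
      IsLocalRing.exists_mem_maximalIdeal_notMem_sq_notMem_minimalPrimes Q (by
        rw [hdim]; exact_mod_cast Nat.le_add_left 1 n)
    have : Nontrivial (Q ⧸ Ideal.span {x}) := Ideal.Quotient.nontrivial_iff.2 (fun h =>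
      (IsLocalRing.mem_maximalIdeal _).1 hx (Ideal.span_singleton_eq_top.1 h))
    have : IsLocalRing (Q ⧸ Ideal.span {x}) :=
      IsLocalRing.of_surjective' (Ideal.Quotient.mk _) Ideal.Quotient.mk_surjective
    have hle := IsLocalRing.spanFinrank_maximalIdeal_quotient_le hx hx2
    -- The dimension drops by at most one and the number of generators by at least one, so the
    -- quotient is again regular, with both numbers equal to `n`.
    have hdim' : ringKrullDim Q ≤ ringKrullDim (Q ⧸ Ideal.span {x}) + 1 := by
      have := ringKrullDim_le_ringKrullDim_quotSMulTop_succ hx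
      rwa [← Submodule.ideal_span_singleton_smul, smul_eq_mul, Ideal.mul_top] at this
    have hn : (n : WithBot ℕ∞) ≤ ringKrullDim (Q ⧸ Ideal.span {x}) := by
      rw [hdim] at hdim'
      push_cast at hdim'
      exact (ENat.WithBot.add_le_add_one_right_iff).1 hdim'
    have hreg : IsRegularLocalRing (Q ⧸ Ideal.span {x}) :=
      IsRegularLocalRing.of_spanFinrank_maximalIdeal_le _
        (le_trans (by exact_mod_cast (by omega)) hn)
    have hn' : (maximalIdeal (Q ⧸ Ideal.span {x})).spanFinrank = n := by
      refine le_antisymm (by omega) ?_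
      rw [← IsRegularLocalRing.spanFinrank_maximalIdeal] at hn
      exact_mod_cast hn
    obtain ⟨hD, rs, hrs, hrsm⟩ := ih _ hn'
    have hprime : (Ideal.span {x}).IsPrime := (Ideal.Quotient.isDomain_iff_prime _).1 hD
    obtain ⟨p, hp, hpx⟩ := Ideal.exists_minimalPrimes_le (bot_le : (⊥ : Ideal Q) ≤ Ideal.span {x})
    have hpp : p.IsPrime := hp.1.1
    -- Since `p ⊆ (x)` and `x ∉ p`, each element of `p` is `x` times an element of `p`. So `p = (x)
    -- p`, and Nakayama gives `p = 0`.
    have hbot : p = ⊥ := by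
      refine Submodule.eq_bot_of_le_smul_of_le_jacobson_bot (Ideal.span {x}) _
        p.fg_of_isNoetherianRing (fun y hy => ?_)
        ((Ideal.span_singleton_le_iff_mem _).2 (maximalIdeal_le_jacobson _ hx))
      obtain ⟨a, rfl⟩ := Ideal.mem_span_singleton.1 (hpx hy)
      exact Submodule.smul_mem_smul (Ideal.mem_span_singleton_self x)
        ((hpp.mem_or_mem hy).resolve_left (hxp p hp))
    have hQ : IsDomain Q := (IsDomain.of_bot_isPrime Q (hbp := hbot ▸ hpp))
    refine ⟨hQ, ?_⟩
    obtain ⟨rs, rfl⟩ : ∃ rs' : List Q, rs'.map (algebraMap Q (Q ⧸ Ideal.span {x})) = rs :=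
      List.map_surjective_iff.2 Ideal.Quotient.mk_surjective rs
    refine ⟨x :: rs, ?_, ?_⟩
    · rw [isWeaklyRegular_cons_iff]
      have hx0 : x ≠ 0 := fun h => hxp p hp (h ▸ p.zero_mem)
      refine ⟨IsSMulRegular.of_ne_zero hx0, ?_⟩
      rw [isWeaklyRegular_map_algebraMap_iff] at hrs
      refine (LinearEquiv.isWeaklyRegular_congr (Submodule.quotEquivOfEq _ _ ?_) rs).1 hrs
      rw [← Submodule.ideal_span_singleton_smul, smul_eq_mul, Ideal.mul_top]
    · rw [← Ideal.map_ofList, ← map_maximalIdeal_of_surjective (algebraMap Q _)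
        Ideal.Quotient.mk_surjective] at hrsm
      rw [Ideal.ofList_cons, sup_comm]
      have hxm : Ideal.span {x} ≤ maximalIdeal Q := (Ideal.span_singleton_le_iff_mem _).2 hx
      have hker : Ideal.comap (Ideal.Quotient.mk (Ideal.span {x})) ⊥ = Ideal.span {x} :=
        Ideal.mk_ker
      have := congrArg (Ideal.comap (Ideal.Quotient.mk (Ideal.span {x}))) hrsm
      rw [Ideal.Quotient.algebraMap_eq,
        Ideal.comap_map_of_surjective _ Ideal.Quotient.mk_surjective,
        Ideal.comap_map_of_surjective _ Ideal.Quotient.mk_surjective, hker] at this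
      rw [this, sup_eq_left.2 hxm]

theorem IsRegularLocalRing.isDomain (Q : Type u) [CommRing Q] [IsRegularLocalRing Q] :
    IsDomain Q :=
  (isDomain_and_exists_isWeaklyRegular _ Q rfl).1

theorem IsRegularLocalRing.exists_isWeaklyRegular (Q : Type u) [CommRing Q]
    [IsRegularLocalRing Q] :
    ∃ rs : List Q, IsWeaklyRegular Q rs ∧ Ideal.ofList rs = maximalIdeal Q :=
  (isDomain_and_exists_isWeaklyRegular _ Q rfl).2

/-- A finitely generated module on which a sequence generating the maximal ideal is regular is
free. -/
theorem Module.free_of_isWeaklyRegular_ofList_eq_maximalIdeal (n : ℕ) : ∀ (Q M : Type u)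
    [CommRing Q] [IsLocalRing Q] [IsNoetherianRing Q] [AddCommGroup M] [Module Q M]
    [Module.Finite Q M] (rs : List Q), rs.length = n → IsWeaklyRegular M rs →
    Ideal.ofList rs = maximalIdeal Q → Module.Free Q M := by
  induction n with
  | zero =>
    intro Q M _ _ _ _ _ _ rs hl _ hm
    rw [List.length_eq_zero_iff.1 hl, Ideal.ofList_nil] at hm
    let := (IsLocalRing.isField_iff_maximalIdeal_eq.2 hm.symm).toField
    exact Module.Free.of_divisionRing Q M
  | succ n ih =>
    intro Q M _ _ _ _ _ _ rs hl hrs hm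
    obtain ⟨x, rs, rfl⟩ := List.exists_cons_of_length_eq_add_one hl
    rw [isWeaklyRegular_cons_iff'] at hrs
    have hx : x ∈ maximalIdeal Q := by
      rw [← hm]; exact Ideal.subset_span (by simp)
    have : Nontrivial (Q ⧸ Ideal.span {x}) := Ideal.Quotient.nontrivial_iff.2 (fun h =>
      (IsLocalRing.mem_maximalIdeal _).1 hx (Ideal.span_singleton_eq_top.1 h))
    have : IsLocalRing (Q ⧸ Ideal.span {x}) :=
      IsLocalRing.of_surjective' (Ideal.Quotient.mk _) Ideal.Quotient.mk_surjective
    have : Module.FinitePresentation Q M := Module.finitePresentation_of_finite Q M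
    have : Module.Finite (Q ⧸ Ideal.span {x}) (QuotSMulTop x M) :=
      Module.Finite.of_restrictScalars_finite Q _ _
    -- For a finitely presented module and a regular element of the Jacobson radical, freeness can
    -- be tested modulo that element, which shortens the sequence by one.
    rw [← Module.free_quotSMulTop_iff_free Q M (maximalIdeal_le_jacobson _ hx) hrs.1]
    refine ih _ _ _ (by simpa using hl) hrs.2 ?_
    rw [← Ideal.map_ofList]
    rw [← map_maximalIdeal_of_surjective (Ideal.Quotient.mk (Ideal.span {x}))
        Ideal.Quotient.mk_surjective, ← hm, Ideal.ofList_cons, Ideal.map_sup, Ideal.map_quotient_self,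
        bot_sup_eq]

/-- Regular sequences on syzygies: the length of a regular sequence increases by one. -/
theorem RingTheory.Sequence.IsWeaklyRegular.concat_of_exact {Q : Type u} [CommRing Q] (x : Q)
    (rs : List Q) : ∀ {K F M : Type u} [AddCommGroup K] [Module Q K] [AddCommGroup F] [Module Q F]
    [AddCommGroup M] [Module Q M] {i : K →ₗ[Q] F} {p : F →ₗ[Q] M} (_ : Function.Injective i)
    (_ : Function.Exact i p) (_ : Function.Surjective p) (_ : IsWeaklyRegular M rs)
    (_ : IsWeaklyRegular F (rs ++ [x])), IsWeaklyRegular K (rs ++ [x]) := by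
  induction rs with
  | nil =>
    intro K F M _ _ _ _ _ _ i p hi _ _ _ hF
    rw [List.nil_append, isWeaklyRegular_singleton_iff] at hF ⊢
    exact hF.of_injective i hi
  | cons r rs ih =>
    intro K F M _ _ _ _ _ _ i p hi hip hp hM hF
    rw [List.cons_append, isWeaklyRegular_cons_iff] at hF ⊢
    rw [isWeaklyRegular_cons_iff] at hM
    refine ⟨hF.1.of_injective i hi, ih (i := QuotSMulTop.map r i) (p := QuotSMulTop.map r p) ?_
      (QuotSMulTop.map_exact r hip hp) (QuotSMulTop.map_surjective r hp) hM.2 hF.2⟩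
    rw [injective_iff_map_eq_zero]
    intro k hk
    obtain ⟨k, rfl⟩ := Submodule.Quotient.mk_surjective _ k
    rw [QuotSMulTop.map_apply_mk, Submodule.Quotient.mk_eq_zero,
      Submodule.mem_smul_pointwise_iff_exists] at hk
    obtain ⟨y, -, hy⟩ := hk
    -- Regularity of `r` on the quotient `M` is what keeps `K / r K → F / r F` injective.
    have hpy : p y = 0 := by
      apply hM.1
      simp only [smul_zero]
      rw [← map_smul, hy, hip.apply_apply_eq_zero]
    obtain ⟨k', rfl⟩ := (hip y).1 hpy
    rw [Submodule.Quotient.mk_eq_zero, Submodule.mem_smul_pointwise_iff_exists]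
    exact ⟨k', trivial, hi (by rw [map_smul, hy])⟩

end RegularLocalRing

/-! ### Bounded projective dimension over regular local rings. -/

section ProjectiveDimension

open CategoryTheory

/-- The projective dimension of the module `M` over `R` is less than `n`. -/
abbrev Module.PdLT (R : Type u) [CommRing R] (M : Type u) [AddCommGroup M] [Module R M] (n : ℕ) :
    Prop :=
  HasProjectiveDimensionLT (ModuleCat.of R M) n

namespace Module.PdLT

variable {R : Type u} [CommRing R] {A B C : Type u} [AddCommGroup A] [Module R A] [AddCommGroup B]
  [Module R B] [AddCommGroup C] [Module R C] {i : A →ₗ[R] B} {p : B →ₗ[R] C} {n : ℕ}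

theorem one_iff : PdLT R A 1 ↔ Module.Projective R A := by
  rw [PdLT, ← projective_iff_hasProjectiveDimensionLT_one, ← IsProjective.iff_projective]

theorem mono {m : ℕ} (h : PdLT R A n) (hnm : n ≤ m) : PdLT R A m :=
  hasProjectiveDimensionLT_of_ge _ n m hnm

theorem of_linearEquiv (e : A ≃ₗ[R] B) (h : PdLT R A n) : PdLT R B n :=
  hasProjectiveDimensionLT_of_iso e.toModuleIso n

theorem shortExact (hi : Function.Injective i) (h : Function.Exact i p)
    (hp : Function.Surjective p) :
    (ShortComplex.mk (ModuleCat.ofHom i) (ModuleCat.ofHom p) (by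
      ext x; exact h.apply_apply_eq_zero x)).ShortExact :=
  ModuleCat.shortComplex_shortExact _ h hi hp

theorem middle (hi : Function.Injective i) (h : Function.Exact i p)
    (hp : Function.Surjective p) (hA : PdLT R A n) (hC : PdLT R C n) : PdLT R B n :=
  (shortExact hi h hp).hasProjectiveDimensionLT_X₂ n hA hC

theorem right (hi : Function.Injective i) (h : Function.Exact i p)
    (hp : Function.Surjective p) (hA : PdLT R A n) (hB : PdLT R B (n + 1)) : PdLT R C (n + 1) :=
  (shortExact hi h hp).hasProjectiveDimensionLT_X₃ n hA hB

theorem left (hi : Function.Injective i) (h : Function.Exact i p)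
    (hp : Function.Surjective p) (hB : PdLT R B n) (hC : PdLT R C (n + 1)) : PdLT R A n :=
  (shortExact hi h hp).hasProjectiveDimensionLT_X₁ n hB hC

end Module.PdLT

open IsLocalRing RingTheory.Sequence

/-- If the maximal ideal is generated by a regular sequence of length `n`, then a finitely
generated module on which the first `n - j` terms are regular has projective dimension at most
`j`. -/
theorem Module.PdLT.of_isWeaklyRegular_take {Q : Type u} [CommRing Q] [IsLocalRing Q]
    [IsNoetherianRing Q] {rs : List Q} (hrs : IsWeaklyRegular Q rs)
    (hm : Ideal.ofList rs = maximalIdeal Q) (j : ℕ) (hj : j ≤ rs.length) :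
    ∀ (M : Type u) [AddCommGroup M] [Module Q M] [Module.Finite Q M],
      IsWeaklyRegular M (rs.take (rs.length - j)) → Module.PdLT Q M (j + 1) := by
  induction j with
  | zero =>
    intro M _ _ _ hM
    rw [Nat.sub_zero, List.take_length] at hM
    have := Module.free_of_isWeaklyRegular_ofList_eq_maximalIdeal _ Q M rs rfl hM hm
    exact Module.PdLT.one_iff.2 inferInstance
  | succ j ih =>
    intro M _ _ _ hM
    obtain ⟨k, p, hp⟩ := Module.Finite.exists_fin' Q M
    -- The whole sequence is regular on free modules, so the syzygy of `M` admits one more regular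
    -- term than `M`, and the induction hypothesis for `j` applies to it.
    refine Module.PdLT.right (LinearMap.ker p).subtype_injective (LinearMap.exact_subtype_ker_map p)
      hp (ih (by omega) _ ?_) ((Module.PdLT.one_iff.2 inferInstance).mono (by omega))
    have e : rs.take (rs.length - j) =
        rs.take (rs.length - (j + 1)) ++ [rs[rs.length - (j + 1)]] := by
      rw [List.take_concat_get', ← Nat.sub_sub, Nat.sub_add_cancel (by omega)]
    have hF : IsWeaklyRegular (Fin k → Q) rs :=
      (LinearEquiv.isWeaklyRegular_congr (TensorProduct.rid Q (Fin k → Q)) rs).1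
        hrs.isWeaklyRegular_lTensor
    have hF' : IsWeaklyRegular (Fin k → Q) (rs.take (rs.length - j)) := by
      rw [← List.take_append_drop (rs.length - j) rs, isWeaklyRegular_append_iff] at hF
      exact hF.1
    rw [e] at hF' ⊢
    exact hM.concat_of_exact _ _ (LinearMap.ker p).subtype_injective
      (LinearMap.exact_subtype_ker_map p) hp hF'

/-- Finitely generated modules over a regular local ring have uniformly bounded projective
dimension. -/
theorem IsRegularLocalRing.exists_pdLT (Q : Type u) [CommRing Q] [IsRegularLocalRing Q] :
    ∃ n : ℕ, ∀ (M : Type u) [AddCommGroup M] [Module Q M] [Module.Finite Q M],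
      Module.PdLT Q M (n + 1) := by
  obtain ⟨rs, hrs, hm⟩ := IsRegularLocalRing.exists_isWeaklyRegular Q
  refine ⟨rs.length, fun M _ _ _ => Module.PdLT.of_isWeaklyRegular_take hrs hm _ le_rfl M ?_⟩
  rw [Nat.sub_self, List.take_zero]
  exact IsWeaklyRegular.nil _ _

end ProjectiveDimension

namespace MatrixFactorization

variable {Q : Type u} [CommRing Q] {f : Q}

/-! ### Morphisms and maps of cokernels -/

theorem toCoker_α (X : MatrixFactorization Q f) (x : X.P1) : X.toCoker (X.α x) = 0 :=
  toCoker_eq_zero.2 ⟨x, rfl⟩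

/-- A linear map from a projective module into the image of an injective map lifts. -/
theorem exists_α_comp_eq (Y : MatrixFactorization Q f) {P : Type u}
    [AddCommGroup P] [Module Q P] [Module.Projective Q P] (g : P →ₗ[Q] Y.P0)
    (hg : ∀ x, Y.toCoker (g x) = 0) : ∃ h : P →ₗ[Q] Y.P1, ∀ x, Y.α (h x) = g x := by
  obtain ⟨h, hh⟩ := Module.projective_lifting_property Y.α.rangeRestrict
    (g.codRestrict (LinearMap.range Y.α) fun x => toCoker_eq_zero.1 (hg x))
    Y.α.surjective_rangeRestrict
  exact ⟨h, fun x => congrArg Subtype.val (LinearMap.congr_fun hh x)⟩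

/-- Linear maps of cokernels lift to morphisms of matrix factorizations. -/
theorem exists_hom_of_coker (hf : f ∈ nonZeroDivisors Q) {X Y : MatrixFactorization Q f}
    (u : X.coker →ₗ[Q] Y.coker) : ∃ φ : Hom X Y, ∀ x, Y.toCoker (φ.φ0 x) = u (X.toCoker x) := by
  obtain ⟨φ0, h0⟩ := Module.projective_lifting_property Y.toCoker (u ∘ₗ X.toCoker)
    Y.toCoker_surjective
  replace h0 : ∀ x, Y.toCoker (φ0 x) = u (X.toCoker x) := LinearMap.congr_fun h0
  obtain ⟨φ1, h1⟩ := Y.exists_α_comp_eq (φ0 ∘ₗ X.α) fun x => by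
    rw [LinearMap.comp_apply, h0, toCoker_α, map_zero]
  replace h1 : ∀ x, Y.α (φ1 x) = φ0 (X.α x) := h1
  -- Compatibility with `β` is automatic: after the injective `Y.α` both sides become `f • φ0 x`.
  refine ⟨⟨φ0, φ1, fun x => (h1 x).symm, fun x => Y.α_injective hf ?_⟩, h0⟩
  rw [h1, X.α_β, Y.α_β, map_smul]

/-- Morphisms inducing the same map on cokernels are homotopic. -/
theorem homotopic_of_toCoker_eq (hf : f ∈ nonZeroDivisors Q) {X Y : MatrixFactorization Q f}
    {φ ψ : Hom X Y} (h : ∀ x, Y.toCoker (φ.φ0 x) = Y.toCoker (ψ.φ0 x)) : Homotopic φ ψ := by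
  obtain ⟨k, hk⟩ := Y.exists_α_comp_eq (φ.φ0 - ψ.φ0) fun x => by
    rw [LinearMap.sub_apply, map_sub, h, sub_self]
  -- The difference `φ0 - ψ0` factors through `Y.α` by `k` alone, so the other half of the homotopy
  -- can be zero; the second equation is tested after the injective `Y.α`.
  refine ⟨k, 0, fun x => by simp [hk], fun x => Y.α_injective hf ?_⟩
  rw [map_add, hk, map_sub, ← φ.comm_α, ← ψ.comm_α]
  simp

/-- Matrix factorizations with isomorphic cokernels are homotopy equivalent. -/
theorem homotopyEquivalent_of_cokerEquiv (hf : f ∈ nonZeroDivisors Q)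
    {X Y : MatrixFactorization Q f} (e : X.coker ≃ₗ[Q] Y.coker) : HomotopyEquivalent X Y := by
  obtain ⟨φ, hφ⟩ := exists_hom_of_coker hf e.toLinearMap
  obtain ⟨ψ, hψ⟩ := exists_hom_of_coker hf e.symm.toLinearMap
  refine ⟨φ, ψ, homotopic_of_toCoker_eq hf fun x => ?_, homotopic_of_toCoker_eq hf fun x => ?_⟩
  · show X.toCoker (ψ.φ0 (φ.φ0 x)) = X.toCoker x
    rw [hψ, hφ]
    exact e.symm_apply_apply _
  · show Y.toCoker (φ.φ0 (ψ.φ0 x)) = Y.toCoker x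
    rw [hφ, hψ]
    exact e.apply_symm_apply _

/-- A pair of maps compatible with `α` is null-homotopic if the induced map on cokernels factors
through `Z = G / f G` with `G` projective. -/
theorem exists_homotopy_of_factor (hf : f ∈ nonZeroDivisors Q) {X Y : MatrixFactorization Q f}
    (φ0 : X.P0 →ₗ[Q] Y.P0) (φ1 : X.P1 →ₗ[Q] Y.P1) (hφ : ∀ x, φ0 (X.α x) = Y.α (φ1 x))
    {G Z : Type u} [AddCommGroup G] [Module Q G] [Module.Projective Q G] [AddCommGroup Z]
    [Module Q Z] (q : G →ₗ[Q] Z) (hq : Function.Surjective q)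
    (hq0 : ∀ z, q z = 0 → ∃ w, z = f • w) (σ : X.coker →ₗ[Q] Z) (π : Z →ₗ[Q] Y.coker)
    (h : ∀ x, Y.toCoker (φ0 x) = π (σ (X.toCoker x))) :
    ∃ (h0 : X.P0 →ₗ[Q] Y.P1) (h1 : X.P1 →ₗ[Q] Y.P0),
      (∀ x, Y.α (h0 x) + h1 (X.β x) = φ0 x) ∧ (∀ x, Y.β (h1 x) + h0 (X.α x) = φ1 x) := by
  have hreg : ∀ (P : Type u) [AddCommGroup P] [Module Q P] [Module.Projective Q P],
      Function.Injective (f • (LinearMap.id : P →ₗ[Q] P)) := fun P _ _ _ =>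
    Module.Flat.isSMulRegular_of_nonZeroDivisors hf
  -- Lifting `π` and `σ` to the projective modules gives `p : G → Y.P0` and `s : X.P0 → G` such that
  -- `φ0` and `p ∘ s` agree modulo the image of `Y.α`.
  obtain ⟨p, hp⟩ := Module.projective_lifting_property Y.toCoker (π ∘ₗ q) Y.toCoker_surjective
  obtain ⟨s, hs⟩ := Module.projective_lifting_property q (σ ∘ₗ X.toCoker) hq
  replace hp : ∀ x, Y.toCoker (p x) = π (q x) := LinearMap.congr_fun hp
  replace hs : ∀ x, q (s x) = σ (X.toCoker x) := LinearMap.congr_fun hs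
  -- The composite `s ∘ X.α` lands in the kernel of `q`, hence in `f G`, and can be divided by `f`.
  -- The result `t` satisfies `t ∘ X.β = s` because `f` is regular on `G`, so `p ∘ t` serves as
  -- `h1`.
  obtain ⟨t, ht⟩ := Module.projective_lifting_property
    (f • (LinearMap.id : G →ₗ[Q] G)).rangeRestrict
    ((s ∘ₗ X.α).codRestrict (LinearMap.range (f • LinearMap.id)) fun x => by
      obtain ⟨w, hw⟩ := hq0 (s (X.α x)) (by rw [hs, toCoker_α, map_zero])
      exact ⟨w, hw.symm⟩)
    (LinearMap.surjective_rangeRestrict _)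
  replace ht : ∀ x, f • t x = s (X.α x) := fun x => congrArg Subtype.val (LinearMap.congr_fun ht x)
  obtain ⟨h0, hh0⟩ := Y.exists_α_comp_eq (φ0 - p ∘ₗ s) fun x => by
    rw [LinearMap.sub_apply, map_sub, h, LinearMap.comp_apply, hp, hs, sub_self]
  replace hh0 : ∀ x, Y.α (h0 x) = φ0 x - p (s x) := hh0
  have htβ : ∀ x, t (X.β x) = s x := fun x => hreg G (by
    show f • t (X.β x) = f • s x
    rw [ht, X.α_β, map_smul])
  refine ⟨h0, p ∘ₗ t, fun x => ?_, fun x => Y.α_injective hf ?_⟩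
  · rw [hh0, LinearMap.comp_apply, htβ, sub_add_cancel]
  · rw [map_add, Y.α_β, hh0, LinearMap.comp_apply, ← map_smul, ht, add_sub_cancel, hφ]

/-- The class of a matrix factorization in `K₀(mf(Q, f))`. -/
abbrev K0.cls (X : MatrixFactorization Q f) : K0 Q f :=
  K0On.mk ⟨X, trivial⟩

theorem K0.cls_eq_add {X Y Z : MatrixFactorization Q f} {φ : Hom X Y} {ψ : Hom Y Z}
    (h : IsShortExact φ ψ) : K0.cls Y = K0.cls X + K0.cls Z :=
  K0On.mk_eq_add (C := Set.univ) (X := ⟨X, trivial⟩) (Y := ⟨Y, trivial⟩) (Z := ⟨Z, trivial⟩) h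

theorem K0.cls_eq_of_cokerEquiv (hf : f ∈ nonZeroDivisors Q) {X Y : MatrixFactorization Q f}
    (e : X.coker ≃ₗ[Q] Y.coker) : K0.cls X = K0.cls Y :=
  K0On.mk_eq_of_homotopyEquivalent (homotopyEquivalent_of_cokerEquiv hf e)

/-- The zero matrix factorization. -/
def zero (Q : Type u) [CommRing Q] (f : Q) : MatrixFactorization Q f where
  P0 := PUnit
  P1 := PUnit
  α := 0
  β := 0
  α_β _ := rfl
  β_α _ := rfl

/-- The zero object is an extension of itself by itself. -/
theorem K0.cls_zero : K0.cls (zero Q f) = 0 := by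
  have : IsShortExact (Hom.id (zero Q f)) (Hom.id (zero Q f)) :=
    ⟨fun _ _ h => h, fun _ _ h => h, fun _ => ⟨fun _ => ⟨PUnit.unit, rfl⟩, fun _ => rfl⟩,
      fun _ => ⟨fun _ => ⟨PUnit.unit, rfl⟩, fun _ => rfl⟩, fun x => ⟨x, rfl⟩, fun x => ⟨x, rfl⟩⟩
  exact left_eq_add.1 (K0.cls_eq_add this)

/-- A contractible matrix factorization has trivial class. -/
theorem K0.cls_eq_zero_of_homotopy (X : MatrixFactorization Q f) (h0 : X.P0 →ₗ[Q] X.P1)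
    (h1 : X.P1 →ₗ[Q] X.P0) (H0 : ∀ x, X.α (h0 x) + h1 (X.β x) = x)
    (H1 : ∀ x, X.β (h1 x) + h0 (X.α x) = x) : K0.cls X = 0 := by
  rw [← K0.cls_zero]
  refine K0On.mk_eq_of_homotopyEquivalent ⟨⟨0, 0, fun _ => rfl, fun _ => rfl⟩,
    ⟨0, 0, fun x => (map_zero X.α).symm, fun x => (map_zero X.β).symm⟩, ⟨-h0, -h1, ?_, ?_⟩,
    0, 0, fun _ => rfl, fun _ => rfl⟩
  · intro x
    show X.α (-h0 x) + -h1 (X.β x) = 0 - x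
    rw [map_neg, ← neg_add, H0, zero_sub]
  · intro x
    show X.β (-h1 x) + -h0 (X.α x) = 0 - x
    rw [map_neg, ← neg_add, H1, zero_sub]

/-- Reduction modulo `f` on `Qⁿ`. -/
def reduceFin (f : Q) (n : ℕ) : (Fin n → Q) →ₗ[Q] (Fin n → Q ⧸ Ideal.span {f}) :=
  LinearMap.compLeft (Ideal.Quotient.mkₐ Q (Ideal.span {f})).toLinearMap (Fin n)

theorem reduceFin_surjective (f : Q) (n : ℕ) : Function.Surjective (reduceFin f n) := fun y => by
  choose x hx using fun i => Ideal.Quotient.mk_surjective (y i)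
  exact ⟨x, funext hx⟩

theorem exists_smul_of_reduceFin_eq_zero {n : ℕ} (z : Fin n → Q) (hz : reduceFin f n z = 0) :
    ∃ w, z = f • w := by
  have : ∀ i, ∃ w, z i = f * w := fun i =>
    Ideal.mem_span_singleton.1 (Ideal.Quotient.eq_zero_iff_mem.1 (congrFun hz i))
  choose w hw using this
  exact ⟨w, funext hw⟩

/-- A matrix factorization whose cokernel is projective over `Q / (f)` has trivial class. -/
theorem K0.cls_eq_zero_of_projective_coker (hf : f ∈ nonZeroDivisors Q)
    (X : MatrixFactorization Q f) [Module.Projective (Q ⧸ Ideal.span {f}) X.coker] :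
    K0.cls X = 0 := by
  obtain ⟨n, p, hp⟩ := Module.Finite.exists_fin' (Q ⧸ Ideal.span {f}) X.coker
  obtain ⟨s, hs⟩ := Module.projective_lifting_property p LinearMap.id hp
  -- The cokernel is a retract of `Qⁿ / f Qⁿ`, so the identity of `X` meets the factorization
  -- criterion and `X` is contractible.
  obtain ⟨h0, h1, H0, H1⟩ := exists_homotopy_of_factor hf (X := X) (Y := X) LinearMap.id
    LinearMap.id (fun _ => rfl) (reduceFin f n) (reduceFin_surjective f n)
    exists_smul_of_reduceFin_eq_zero (s.restrictScalars Q) (p.restrictScalars Q)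
    (fun x => (LinearMap.congr_fun hs (X.toCoker x)).symm)
  exact K0.cls_eq_zero_of_homotopy X h0 h1 H0 H1

/-- The matrix factorization given by a presentation of length one of a module killed by `f`. -/
def ofPresentation {P M : Type u} [AddCommGroup P] [Module Q P] [Module.Finite Q P]
    [Module.Projective Q P] [AddCommGroup M] [Module Q M] (p : P →ₗ[Q] M)
    [Module.Finite Q (LinearMap.ker p)] [Module.Projective Q (LinearMap.ker p)]
    (hM : ∀ m : M, f • m = 0) : MatrixFactorization Q f where
  P0 := P
  P1 := LinearMap.ker p
  α := (LinearMap.ker p).subtype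
  β := (f • LinearMap.id).codRestrict (LinearMap.ker p) fun x => by
    rw [LinearMap.mem_ker, LinearMap.smul_apply, map_smul, hM]
  α_β _ := rfl
  β_α _ := rfl

/-- The cokernel of the matrix factorization given by a presentation of `M` is `M`. -/
noncomputable def cokerOfPresentation {P M : Type u} [AddCommGroup P] [Module Q P]
    [Module.Finite Q P] [Module.Projective Q P] [AddCommGroup M] [Module Q M] (p : P →ₗ[Q] M)
    [Module.Finite Q (LinearMap.ker p)] [Module.Projective Q (LinearMap.ker p)]
    (hM : ∀ m : M, f • m = 0) (hp : Function.Surjective p) :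
    (ofPresentation p hM).coker ≃ₗ[Q] M :=
  (Submodule.quotEquivOfEq _ _ (Submodule.range_subtype _)).trans (p.quotKerEquivOfSurjective hp)

end MatrixFactorization

/-! ### Kernels in the horseshoe lemma -/

section Horseshoe

variable {R : Type u} [Ring R] {A B C P S : Type u} [AddCommGroup A] [Module R A] [AddCommGroup B]
  [Module R B] [AddCommGroup C] [Module R C] [AddCommGroup P] [Module R P] [AddCommGroup S]
  [Module R S]

/-- The inclusion of kernels in the horseshoe lemma. -/
def horseshoeInl (i : A →ₗ[R] B) (a : P →ₗ[R] A) (l : S →ₗ[R] B) :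
    LinearMap.ker a →ₗ[R] LinearMap.ker (LinearMap.coprod (i ∘ₗ a) l) :=
  (LinearMap.inl R P S).restrict fun x hx => by
    rw [LinearMap.mem_ker] at hx ⊢
    simp [hx]

/-- The projection of kernels in the horseshoe lemma. -/
def horseshoeSnd {i : A →ₗ[R] B} {p : B →ₗ[R] C} (h : Function.Exact i p) (a : P →ₗ[R] A)
    {l : S →ₗ[R] B} {c : S →ₗ[R] C} (hl : ∀ s, p (l s) = c s) :
    LinearMap.ker (LinearMap.coprod (i ∘ₗ a) l) →ₗ[R] LinearMap.ker c :=
  (LinearMap.snd R P S).restrict fun x hx => by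
    rw [LinearMap.mem_ker] at hx ⊢
    have := congrArg p hx
    rwa [LinearMap.coprod_apply, map_add, LinearMap.comp_apply, h.apply_apply_eq_zero, zero_add,
      hl, map_zero] at this

variable {i : A →ₗ[R] B} {p : B →ₗ[R] C} {a : P →ₗ[R] A} {l : S →ₗ[R] B} {c : S →ₗ[R] C}

theorem horseshoeInl_injective : Function.Injective (horseshoeInl i a l) := fun _ _ hxy =>
  Subtype.ext (congrArg (fun z => z.1.1) hxy)

theorem horseshoe_surjective (h : Function.Exact i p) (hl : ∀ s, p (l s) = c s) (ha : Function.Surjective a) (hc : Function.Surjective c) :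
    Function.Surjective (LinearMap.coprod (i ∘ₗ a) l) := by
  intro b
  obtain ⟨s, hs⟩ := hc (p b)
  obtain ⟨y, hy⟩ := (h (b - l s)).1 (by rw [map_sub, hl, hs, sub_self])
  obtain ⟨x, rfl⟩ := ha y
  exact ⟨(x, s), by rw [LinearMap.coprod_apply, LinearMap.comp_apply, hy, sub_add_cancel]⟩

theorem horseshoe_exact (h : Function.Exact i p) (hl : ∀ s, p (l s) = c s)
    (hi : Function.Injective i) :
    Function.Exact (horseshoeInl i a l) (horseshoeSnd h a hl) := by
  rintro ⟨⟨x, s⟩, hx⟩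
  constructor
  · intro hs
    obtain rfl : s = 0 := congrArg Subtype.val hs
    refine ⟨⟨x, LinearMap.mem_ker.2 (hi ?_)⟩, rfl⟩
    simpa using hx
  · rintro ⟨y, hy⟩
    exact Subtype.ext (congrArg (fun z => z.1.2) hy).symm

theorem horseshoeSnd_surjective (h : Function.Exact i p) (hl : ∀ s, p (l s) = c s)
    (ha : Function.Surjective a) :
    Function.Surjective (horseshoeSnd h a hl) := by
  rintro ⟨s, hs⟩
  obtain ⟨y, hy⟩ := (h (-l s)).1 (by rw [map_neg, hl, LinearMap.mem_ker.1 hs, neg_zero])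
  obtain ⟨x, rfl⟩ := ha y
  exact ⟨⟨(x, s), by simp [hy]⟩, rfl⟩

end Horseshoe

namespace MatrixFactorization

variable {Q : Type u} [CommRing Q] {f : Q}

/-- Additivity of the class of a presentation. -/
theorem K0.cls_ofPresentation_eq_add {A B C P S : Type u} [AddCommGroup A]
    [Module Q A] [AddCommGroup B] [Module Q B] [AddCommGroup C] [Module Q C] [AddCommGroup P]
    [Module Q P] [AddCommGroup S] [Module Q S] [Module.Finite Q P] [Module.Projective Q P]
    [Module.Finite Q S] [Module.Projective Q S] {i : A →ₗ[Q] B} {p : B →ₗ[Q] C}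
    (hi : Function.Injective i) (h : Function.Exact i p) {a : P →ₗ[Q] A}
    (ha : Function.Surjective a) {l : S →ₗ[Q] B} {c : S →ₗ[Q] C} (hl : ∀ s, p (l s) = c s)
    (hA : ∀ m : A, f • m = 0) (hB : ∀ m : B, f • m = 0) (hC : ∀ m : C, f • m = 0)
    [Module.Finite Q (LinearMap.ker a)] [Module.Projective Q (LinearMap.ker a)]
    [Module.Finite Q (LinearMap.ker c)] [Module.Projective Q (LinearMap.ker c)]
    [Module.Finite Q (LinearMap.ker (LinearMap.coprod (i ∘ₗ a) l))]
    [Module.Projective Q (LinearMap.ker (LinearMap.coprod (i ∘ₗ a) l))] :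
    K0.cls (ofPresentation (LinearMap.coprod (i ∘ₗ a) l) hB) =
      K0.cls (ofPresentation a hA) + K0.cls (ofPresentation c hC) := by
  let φ : Hom (ofPresentation a hA) (ofPresentation (LinearMap.coprod (i ∘ₗ a) l) hB) :=
    ⟨LinearMap.inl Q P S, horseshoeInl i a l, fun _ => rfl,
      fun x => Subtype.ext (map_smul (LinearMap.inl Q P S) f x)⟩
  let ψ : Hom (ofPresentation (LinearMap.coprod (i ∘ₗ a) l) hB) (ofPresentation c hC) :=
    ⟨LinearMap.snd Q P S, horseshoeSnd h a hl, fun _ => rfl, fun _ => rfl⟩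
  have : IsShortExact φ ψ :=
    { inj0 := LinearMap.inl_injective (R := Q) (M := P) (M₂ := S)
      inj1 := horseshoeInl_injective
      exact0 := Function.Exact.inl_snd (R := Q) (M := P) (N := S)
      exact1 := horseshoe_exact h hl hi
      surj0 := LinearMap.snd_surjective (R := Q) (M := P) (M₂ := S)
      surj1 := horseshoeSnd_surjective h hl ha }
  exact K0.cls_eq_add this

end MatrixFactorization

namespace MatrixFactorization

variable {Q : Type u} [CommRing Q] {f : Q}

/-! ### Projective dimension over `Q` of modules over `Q / (f)` -/

section OverPdLT

variable (f) in
/-- The `Q / (f)`-module `M` has projective dimension less than `n` over `Q`. -/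
def OverPdLT (M : Type u) [AddCommGroup M] [Module (Q ⧸ Ideal.span {f}) M] (n : ℕ) : Prop :=
  letI := Module.compHom M (Ideal.Quotient.mk (Ideal.span {f}))
  Module.PdLT Q M n

variable (f) in
/-- Restriction of scalars along `Q → Q / (f)`. -/
theorem exists_isScalarTower (M : Type u) [AddCommGroup M] [Module (Q ⧸ Ideal.span {f}) M] :
    ∃ _ : Module Q M, IsScalarTower Q (Q ⧸ Ideal.span {f}) M :=
  letI := Module.compHom M (Ideal.Quotient.mk (Ideal.span {f}))
  ⟨inferInstance, ⟨fun q r m => by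
    rw [Algebra.smul_def, mul_smul]; rfl⟩⟩

/-- The `Q`-structure obtained from `Module.compHom` and the given one agree on elements but are
different instances, so the identity is packaged by hand as a linear equivalence between them. -/
theorem overPdLT_iff {M : Type u} [AddCommGroup M] [Module (Q ⧸ Ideal.span {f}) M] [Module Q M]
    [IsScalarTower Q (Q ⧸ Ideal.span {f}) M] {n : ℕ} : OverPdLT f M n ↔ Module.PdLT Q M n := by
  let e := @LinearEquiv.mk Q Q _ _ (RingHom.id Q) (RingHom.id Q) _ _ M M _ _
    (Module.compHom M (Ideal.Quotient.mk (Ideal.span {f}))) ‹Module Q M›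
    (@LinearMap.mk Q Q _ _ (RingHom.id Q) M M _ _
      (Module.compHom M (Ideal.Quotient.mk (Ideal.span {f}))) ‹Module Q M› (AddHom.id M)
      (fun q m => (algebraMap_smul (Q ⧸ Ideal.span {f}) q m))) id (fun _ => rfl) (fun _ => rfl)
  constructor
  · intro h
    exact @Module.PdLT.of_linearEquiv Q _ M M _ (Module.compHom M (Ideal.Quotient.mk _)) _ _ n e h
  · intro h
    exact @Module.PdLT.of_linearEquiv Q _ M M _ _ _ (Module.compHom M (Ideal.Quotient.mk _)) n
      e.symm h

theorem smul_eq_zero_of_isScalarTower {M : Type u} [AddCommGroup M]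
    [Module (Q ⧸ Ideal.span {f}) M] [Module Q M] [IsScalarTower Q (Q ⧸ Ideal.span {f}) M] (m : M) :
    f • m = 0 := by
  rw [← algebraMap_smul (Q ⧸ Ideal.span {f}) f m, Ideal.Quotient.algebraMap_eq,
    Ideal.Quotient.eq_zero_iff_mem.2 (Ideal.mem_span_singleton_self f), zero_smul]

namespace OverPdLT

variable {A B C : Type u} [AddCommGroup A] [Module (Q ⧸ Ideal.span {f}) A] [AddCommGroup B]
  [Module (Q ⧸ Ideal.span {f}) B] [AddCommGroup C] [Module (Q ⧸ Ideal.span {f}) C]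
  {i : A →ₗ[Q ⧸ Ideal.span {f}] B} {p : B →ₗ[Q ⧸ Ideal.span {f}] C} {n : ℕ}

theorem mono {m : ℕ} (h : OverPdLT f A n) (hnm : n ≤ m) : OverPdLT f A m := by
  obtain ⟨_, _⟩ := exists_isScalarTower f A
  rw [overPdLT_iff] at h ⊢
  exact h.mono hnm

theorem middle (hi : Function.Injective i) (h : Function.Exact i p)
    (hp : Function.Surjective p) (hA : OverPdLT f A n) (hC : OverPdLT f C n) : OverPdLT f B n := by
  obtain ⟨_, _⟩ := exists_isScalarTower f A
  obtain ⟨_, _⟩ := exists_isScalarTower f B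
  obtain ⟨_, _⟩ := exists_isScalarTower f C
  rw [overPdLT_iff] at hA hC ⊢
  exact Module.PdLT.middle (i := i.restrictScalars Q) (p := p.restrictScalars Q) hi h hp hA hC

theorem left (hi : Function.Injective i) (h : Function.Exact i p)
    (hp : Function.Surjective p) (hB : OverPdLT f B n) (hC : OverPdLT f C (n + 1)) :
    OverPdLT f A n := by
  obtain ⟨_, _⟩ := exists_isScalarTower f A
  obtain ⟨_, _⟩ := exists_isScalarTower f B
  obtain ⟨_, _⟩ := exists_isScalarTower f C
  rw [overPdLT_iff] at hB hC ⊢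
  exact Module.PdLT.left (i := i.restrictScalars Q) (p := p.restrictScalars Q) hi h hp hB hC

/-- Multiplication by `f` on `Qⁿ` resolves `(Q / f)ⁿ` in one step, and a finitely generated
projective module is a retract of such a module. -/
theorem of_projective (hf : f ∈ nonZeroDivisors Q) [Module.Finite (Q ⧸ Ideal.span {f}) A]
    [Module.Projective (Q ⧸ Ideal.span {f}) A] : OverPdLT f A 2 := by
  obtain ⟨n, p, hp⟩ := Module.Finite.exists_fin' (Q ⧸ Ideal.span {f}) A
  obtain ⟨s, hs⟩ := Module.projective_lifting_property p LinearMap.id hp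
  obtain ⟨_, _⟩ := exists_isScalarTower f A
  rw [overPdLT_iff]
  have hfree : Module.PdLT Q (Fin n → Q ⧸ Ideal.span {f}) 2 := by
    refine Module.PdLT.right (i := f • (LinearMap.id : (Fin n → Q) →ₗ[Q] _))
      (Module.Flat.isSMulRegular_of_nonZeroDivisors hf) (fun z => ⟨fun hz => ?_, ?_⟩)
      (reduceFin_surjective f n) (Module.PdLT.one_iff.2 inferInstance)
      ((Module.PdLT.one_iff.2 inferInstance).mono one_le_two)
    · obtain ⟨w, hw⟩ := exists_smul_of_reduceFin_eq_zero z hz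
      exact ⟨w, hw.symm⟩
    · rintro ⟨w, rfl⟩
      rw [LinearMap.smul_apply, map_smul]
      exact smul_eq_zero_of_isScalarTower _
  refine CategoryTheory.Retract.hasProjectiveDimensionLT
    (Y := ModuleCat.of Q (Fin n → Q ⧸ Ideal.span {f}))
    ⟨ModuleCat.ofHom (s.restrictScalars Q), ModuleCat.ofHom (p.restrictScalars Q), ?_⟩ 2
  ext x
  exact LinearMap.congr_fun hs x

theorem coker (hf : f ∈ nonZeroDivisors Q) (X : MatrixFactorization Q f) :
    OverPdLT f X.coker 2 := by
  rw [overPdLT_iff]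
  exact Module.PdLT.right (i := X.α) (p := X.toCoker) (X.α_injective hf)
    (fun _ => toCoker_eq_zero) X.toCoker_surjective (Module.PdLT.one_iff.2 inferInstance)
    ((Module.PdLT.one_iff.2 inferInstance).mono one_le_two)

end OverPdLT

end OverPdLT

/-! ### Modules of projective dimension at most one as cokernels -/

variable (f) in
open Classical in
/-- The class of a matrix factorization with cokernel `M`. -/
noncomputable def classOfCoker (M : Type u) [AddCommGroup M] [Module (Q ⧸ Ideal.span {f}) M] :
    K0 Q f :=
  if h : ∃ X : MatrixFactorization Q f, Nonempty (X.coker ≃ₗ[Q ⧸ Ideal.span {f}] M) then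
    K0.cls h.choose else 0

/-- The choice made in `classOfCoker` is harmless, because factorizations with isomorphic cokernels
are homotopy equivalent. -/
theorem classOfCoker_eq (hf : f ∈ nonZeroDivisors Q) {M : Type u} [AddCommGroup M]
    [Module (Q ⧸ Ideal.span {f}) M] (X : MatrixFactorization Q f)
    (e : X.coker ≃ₗ[Q ⧸ Ideal.span {f}] M) : classOfCoker f M = K0.cls X := by
  have h : ∃ X : MatrixFactorization Q f, Nonempty (X.coker ≃ₗ[Q ⧸ Ideal.span {f}] M) := ⟨X, ⟨e⟩⟩
  rw [classOfCoker, dif_pos h]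
  exact K0.cls_eq_of_cokerEquiv hf ((h.choose_spec.some.trans e.symm).restrictScalars Q)

variable (f) in
/-- A finitely generated free module surjecting onto `M`. -/
noncomputable def coverMap (M : Type u) [AddCommGroup M] [Module (Q ⧸ Ideal.span {f}) M]
    [Module.Finite (Q ⧸ Ideal.span {f}) M] :
    (Fin (Module.Finite.exists_fin' (Q ⧸ Ideal.span {f}) M).choose → Q ⧸ Ideal.span {f})
      →ₗ[Q ⧸ Ideal.span {f}] M :=
  (Module.Finite.exists_fin' (Q ⧸ Ideal.span {f}) M).choose_spec.choose

theorem coverMap_surjective (M : Type u) [AddCommGroup M] [Module (Q ⧸ Ideal.span {f}) M]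
    [Module.Finite (Q ⧸ Ideal.span {f}) M] : Function.Surjective (coverMap f M) :=
  (Module.Finite.exists_fin' (Q ⧸ Ideal.span {f}) M).choose_spec.choose_spec

theorem cokerK0_cls (hf : f ∈ nonZeroDivisors Q) (X : MatrixFactorization Q f) :
    cokerK0 hf (K0.cls X) = G0.stableMk (Q ⧸ Ideal.span {f}) X.coker :=
  K0On.lift_mk ..

variable [IsNoetherianRing Q]

/-- A finitely generated `Q / (f)`-module of projective dimension at most one over `Q` is the
cokernel of a matrix factorization. -/
theorem exists_coker_equiv {M : Type u} [AddCommGroup M] [Module (Q ⧸ Ideal.span {f}) M]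
    [Module.Finite (Q ⧸ Ideal.span {f}) M] (h : OverPdLT f M 2) :
    ∃ X : MatrixFactorization Q f, Nonempty (X.coker ≃ₗ[Q ⧸ Ideal.span {f}] M) := by
  obtain ⟨_, _⟩ := exists_isScalarTower f M
  rw [overPdLT_iff] at h
  have : Module.Finite Q M := Module.Finite.trans (Q ⧸ Ideal.span {f}) M
  obtain ⟨n, p, hp⟩ := Module.Finite.exists_fin' Q M
  have : Module.Projective Q (LinearMap.ker p) := Module.PdLT.one_iff.1
    (Module.PdLT.left (LinearMap.ker p).subtype_injective (LinearMap.exact_subtype_ker_map p) hp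
      (Module.PdLT.one_iff.2 inferInstance) h)
  exact ⟨ofPresentation p smul_eq_zero_of_isScalarTower,
    ⟨(cokerOfPresentation p _ hp).extendScalarsOfSurjective Ideal.Quotient.mk_surjective⟩⟩

/-- The horseshoe lemma covers the exact sequence of cokernels by an exact sequence of
presentations. The factorizations obtained from these have the cokernels of `X`, `Y`, `Z`, hence the
same classes. -/
theorem K0.cls_eq_add_of_coker (hf : f ∈ nonZeroDivisors Q) {X Y Z : MatrixFactorization Q f}
    {i : X.coker →ₗ[Q] Y.coker} {p : Y.coker →ₗ[Q] Z.coker} (hi : Function.Injective i)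
    (h : Function.Exact i p) (hp : Function.Surjective p) :
    K0.cls Y = K0.cls X + K0.cls Z := by
  obtain ⟨l, hl⟩ := Module.projective_lifting_property p Z.toCoker hp
  replace hl : ∀ s, p (l s) = Z.toCoker s := LinearMap.congr_fun hl
  have hker : ∀ W : MatrixFactorization Q f, Module.Projective Q (LinearMap.ker W.toCoker) :=
    fun W => Module.PdLT.one_iff.1 (Module.PdLT.left (LinearMap.ker W.toCoker).subtype_injective
      (LinearMap.exact_subtype_ker_map _) W.toCoker_surjective
      (Module.PdLT.one_iff.2 inferInstance) (overPdLT_iff.1 (OverPdLT.coker hf W)))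
  have := hker X
  have := hker Z
  have : Module.Projective Q (LinearMap.ker (LinearMap.coprod (i ∘ₗ X.toCoker) l)) :=
    Module.PdLT.one_iff.1 (Module.PdLT.middle horseshoeInl_injective (horseshoe_exact h hl hi)
      (horseshoeSnd_surjective h hl X.toCoker_surjective)
      (Module.PdLT.one_iff.2 inferInstance) (Module.PdLT.one_iff.2 inferInstance))
  have e := K0.cls_ofPresentation_eq_add hi h X.toCoker_surjective hl
    (smul_eq_zero_of_isScalarTower (f := f)) (smul_eq_zero_of_isScalarTower (f := f))
    (smul_eq_zero_of_isScalarTower (f := f))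
  rwa [K0.cls_eq_of_cokerEquiv hf (cokerOfPresentation X.toCoker _ X.toCoker_surjective),
    K0.cls_eq_of_cokerEquiv hf (cokerOfPresentation Z.toCoker _ Z.toCoker_surjective),
    K0.cls_eq_of_cokerEquiv hf (cokerOfPresentation _ _
      (horseshoe_surjective h hl X.toCoker_surjective Z.toCoker_surjective))] at e

/-! ### The inverse of the cokernel map -/

/-- The function `φ` on finitely generated `Q / (f)`-modules is additive on short exact sequences
of modules of projective dimension less than `n` over `Q`, vanishes on projective modules and has
the prescribed values on cokernels of matrix factorizations. -/
structure IsStableClassFunction (n : ℕ) (φ : ∀ (M : Type u) [AddCommGroup M]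
    [Module (Q ⧸ Ideal.span {f}) M] [Module.Finite (Q ⧸ Ideal.span {f}) M], K0 Q f) : Prop where
  add : ∀ {A B C : Type u} [AddCommGroup A] [Module (Q ⧸ Ideal.span {f}) A]
    [Module.Finite (Q ⧸ Ideal.span {f}) A] [AddCommGroup B] [Module (Q ⧸ Ideal.span {f}) B]
    [Module.Finite (Q ⧸ Ideal.span {f}) B] [AddCommGroup C] [Module (Q ⧸ Ideal.span {f}) C]
    [Module.Finite (Q ⧸ Ideal.span {f}) C] (i : A →ₗ[Q ⧸ Ideal.span {f}] B)
    (p : B →ₗ[Q ⧸ Ideal.span {f}] C), Function.Injective i → Function.Exact i p →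
    Function.Surjective p → OverPdLT f A n → OverPdLT f B n → OverPdLT f C n → φ B = φ A + φ C
  projective : ∀ (P : Type u) [AddCommGroup P] [Module (Q ⧸ Ideal.span {f}) P]
    [Module.Finite (Q ⧸ Ideal.span {f}) P], Module.Projective (Q ⧸ Ideal.span {f}) P → φ P = 0
  coker : ∀ X : MatrixFactorization Q f, φ X.coker = K0.cls X

/-- Level `2` means projective dimension at most one over `Q`, where every module is itself a
cokernel. This is the base of the extension to larger dimensions. -/
theorem isStableClassFunction_classOfCoker (hf : f ∈ nonZeroDivisors Q) :
    IsStableClassFunction (f := f) 2 (fun M _ _ _ => classOfCoker f M) where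
  add i p hi h hp hA hB hC := by
    obtain ⟨X, ⟨eX⟩⟩ := exists_coker_equiv hA
    obtain ⟨Y, ⟨eY⟩⟩ := exists_coker_equiv hB
    obtain ⟨Z, ⟨eZ⟩⟩ := exists_coker_equiv hC
    rw [classOfCoker_eq hf X eX, classOfCoker_eq hf Y eY, classOfCoker_eq hf Z eZ]
    refine K0.cls_eq_add_of_coker hf
      (i := (eY.symm.toLinearMap ∘ₗ i ∘ₗ eX.toLinearMap).restrictScalars Q)
      (p := (eZ.symm.toLinearMap ∘ₗ p ∘ₗ eY.toLinearMap).restrictScalars Q) ?_ ?_ ?_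
    · exact eY.symm.injective.comp (hi.comp eX.injective)
    · intro y
      show eZ.symm (p (eY y)) = 0 ↔ ∃ x, eY.symm (i (eX x)) = y
      rw [LinearEquiv.map_eq_zero_iff, h (eY y)]
      constructor
      · rintro ⟨x, hx⟩
        exact ⟨eX.symm x, by rw [LinearEquiv.apply_symm_apply, hx, LinearEquiv.symm_apply_apply]⟩
      · rintro ⟨x, rfl⟩
        exact ⟨eX x, (LinearEquiv.apply_symm_apply _ _).symm⟩
    · exact eZ.symm.surjective.comp (hp.comp eY.surjective)
  projective P _ _ _ hP := by
    obtain ⟨X, ⟨e⟩⟩ := exists_coker_equiv (OverPdLT.of_projective (A := P) hf)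
    have : Module.Projective (Q ⧸ Ideal.span {f}) X.coker := Module.Projective.of_equiv e.symm
    rw [classOfCoker_eq hf X e, K0.cls_eq_zero_of_projective_coker hf]
  coker X := classOfCoker_eq hf X (LinearEquiv.refl _ _)

namespace IsStableClassFunction

variable {φ : ∀ (M : Type u) [AddCommGroup M] [Module (Q ⧸ Ideal.span {f}) M]
  [Module.Finite (Q ⧸ Ideal.span {f}) M], K0 Q f} {n : ℕ}

/-- The class of the kernel of a projective cover does not depend on the cover. -/
theorem ker_eq (hφ : IsStableClassFunction (n + 2) φ) (hf : f ∈ nonZeroDivisors Q)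
    {M P P' : Type u} [AddCommGroup M] [Module (Q ⧸ Ideal.span {f}) M] [AddCommGroup P]
    [Module (Q ⧸ Ideal.span {f}) P] [AddCommGroup P'] [Module (Q ⧸ Ideal.span {f}) P']
    [Module.Finite (Q ⧸ Ideal.span {f}) P] [Module.Finite (Q ⧸ Ideal.span {f}) P']
    [Module.Projective (Q ⧸ Ideal.span {f}) P] [Module.Projective (Q ⧸ Ideal.span {f}) P']
    (p : P →ₗ[Q ⧸ Ideal.span {f}] M) (p' : P' →ₗ[Q ⧸ Ideal.span {f}] M)
    (hp : Function.Surjective p) (hp' : Function.Surjective p') (hM : OverPdLT f M (n + 3)) :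
    φ (LinearMap.ker p) = φ (LinearMap.ker p') := by
  have hP : OverPdLT f P (n + 2) := (OverPdLT.of_projective hf).mono (by omega)
  have hP' : OverPdLT f P' (n + 2) := (OverPdLT.of_projective hf).mono (by omega)
  have hk : OverPdLT f (LinearMap.ker p) (n + 2) := OverPdLT.left
    (LinearMap.ker p).subtype_injective (LinearMap.exact_subtype_ker_map p) hp hP hM
  have hk' : OverPdLT f (LinearMap.ker p') (n + 2) := OverPdLT.left
    (LinearMap.ker p').subtype_injective (LinearMap.exact_subtype_ker_map p') hp' hP' hM
  -- As in Schanuel's lemma, the fibre product `E` of the two covers is an extension of `P'` by `ker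
  -- p` and of `P` by `ker p'`. Since `φ` vanishes on projectives, both kernels have the value `φ
  -- E`.
  let E := LinearMap.ker (LinearMap.coprod p (-p'))
  have hE : ∀ z : P × P', z ∈ E ↔ p z.1 = p' z.2 := fun z => by
    rw [LinearMap.mem_ker, LinearMap.coprod_apply, LinearMap.neg_apply, ← sub_eq_add_neg,
      sub_eq_zero]
  let i : LinearMap.ker p →ₗ[Q ⧸ Ideal.span {f}] E :=
    ((LinearMap.inl _ P P').restrict fun x hx => (hE _).2 (by
      simpa using hx))
  let i' : LinearMap.ker p' →ₗ[Q ⧸ Ideal.span {f}] E :=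
    ((LinearMap.inr _ P P').restrict fun x hx => (hE _).2 (by
      simpa using (LinearMap.mem_ker.1 hx).symm))
  let q : E →ₗ[Q ⧸ Ideal.span {f}] P' := LinearMap.snd _ P P' ∘ₗ E.subtype
  let q' : E →ₗ[Q ⧸ Ideal.span {f}] P := LinearMap.fst _ P P' ∘ₗ E.subtype
  have hi : Function.Injective i := fun x y hxy => Subtype.ext (congrArg (fun z => z.1.1) hxy)
  have hi' : Function.Injective i' := fun x y hxy => Subtype.ext (congrArg (fun z => z.1.2) hxy)
  have hq : Function.Surjective q := fun y => by
    obtain ⟨x, hx⟩ := hp (p' y)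
    exact ⟨⟨(x, y), (hE _).2 hx⟩, rfl⟩
  have hq' : Function.Surjective q' := fun x => by
    obtain ⟨y, hy⟩ := hp' (p x)
    exact ⟨⟨(x, y), (hE _).2 hy.symm⟩, rfl⟩
  have hiq : Function.Exact i q := by
    rintro ⟨⟨x, y⟩, hz⟩
    constructor
    · intro h
      obtain rfl : y = 0 := h
      exact ⟨⟨x, by simpa using (hE _).1 hz⟩, rfl⟩
    · rintro ⟨x, hx⟩
      exact (congrArg (fun z => z.1.2) hx).symm
  have hiq' : Function.Exact i' q' := by
    rintro ⟨⟨x, y⟩, hz⟩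
    constructor
    · intro h
      obtain rfl : x = 0 := h
      exact ⟨⟨y, by simpa using ((hE _).1 hz).symm⟩, rfl⟩
    · rintro ⟨x, hx⟩
      exact (congrArg (fun z => z.1.1) hx).symm
  have hEpd : OverPdLT f E (n + 2) := OverPdLT.middle hi hiq hq hk hP'
  have e := hφ.add i q hi hiq hq hk hEpd hP'
  have e' := hφ.add i' q' hi' hiq' hq' hk' hEpd hP
  rw [hφ.projective P' ‹_›, add_zero] at e
  rw [hφ.projective P ‹_›, add_zero] at e'
  exact e.symm.trans e'

/-- Extending a stable class function to modules of larger projective dimension. -/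
theorem succ (hφ : IsStableClassFunction (n + 2) φ) (hf : f ∈ nonZeroDivisors Q) :
    IsStableClassFunction (f := f) (n + 3) (fun M _ _ _ => -φ (LinearMap.ker (coverMap f M))) where
  add {A B C} _ _ _ _ _ _ _ _ _ i p hi h hp hA hB hC := by
    obtain ⟨l, hl⟩ := Module.projective_lifting_property p (coverMap f C) hp
    replace hl : ∀ s, p (l s) = coverMap f C s := LinearMap.congr_fun hl
    have hs := horseshoe_surjective h hl (coverMap_surjective A) (coverMap_surjective C)
    -- The chosen cover of `B` is traded for the horseshoe cover, whose kernel is an extension of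
    -- the kernels for `C` and `A`.
    rw [hφ.ker_eq hf (coverMap f B) _ (coverMap_surjective B) hs hB, ← neg_add]
    congr 1
    have hP : ∀ k : ℕ, OverPdLT f (Fin k → Q ⧸ Ideal.span {f}) (n + 2) := fun k =>
      (OverPdLT.of_projective hf).mono (by omega)
    have hkA : OverPdLT f (LinearMap.ker (coverMap f A)) (n + 2) := OverPdLT.left
      (LinearMap.ker _).subtype_injective (LinearMap.exact_subtype_ker_map _)
      (coverMap_surjective A) (hP _) hA
    have hkC : OverPdLT f (LinearMap.ker (coverMap f C)) (n + 2) := OverPdLT.left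
      (LinearMap.ker _).subtype_injective (LinearMap.exact_subtype_ker_map _)
      (coverMap_surjective C) (hP _) hC
    exact hφ.add _ _ horseshoeInl_injective (horseshoe_exact h hl hi)
      (horseshoeSnd_surjective h hl (coverMap_surjective A)) hkA
      (OverPdLT.middle horseshoeInl_injective (horseshoe_exact h hl hi)
      (horseshoeSnd_surjective h hl (coverMap_surjective A)) hkA hkC) hkC
  projective P _ _ _ hP := by
    -- A projective module covers itself, with kernel zero.
    have hbot : LinearMap.ker (LinearMap.id : P →ₗ[Q ⧸ Ideal.span {f}] P) = ⊥ := LinearMap.ker_id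
    have : Subsingleton (LinearMap.ker (LinearMap.id : P →ₗ[Q ⧸ Ideal.span {f}] P)) := by
      rw [hbot]; infer_instance
    rw [hφ.ker_eq hf (coverMap f P) LinearMap.id (coverMap_surjective P) Function.surjective_id
      ((OverPdLT.of_projective hf).mono (by omega)), hφ.projective _ inferInstance, neg_zero]
  coker X := by
    have hX : OverPdLT f X.coker (n + 2) := (OverPdLT.coker hf X).mono (by omega)
    have hP : OverPdLT f (Fin (Module.Finite.exists_fin' (Q ⧸ Ideal.span {f}) X.coker).choose →
      Q ⧸ Ideal.span {f}) (n + 2) := (OverPdLT.of_projective hf).mono (by omega)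
    have hk : OverPdLT f (LinearMap.ker (coverMap f X.coker)) (n + 2) := OverPdLT.left
      (LinearMap.ker _).subtype_injective (LinearMap.exact_subtype_ker_map _)
      (coverMap_surjective _) hP (hX.mono (by omega))
    -- The cokernel already lies at the lower level, so the old function is additive on its cover
    -- sequence; as it vanishes on the free middle term, its value on the kernel is minus the class
    -- of `X`.
    have e := hφ.add _ _ (LinearMap.ker (coverMap f X.coker)).subtype_injective
      (LinearMap.exact_subtype_ker_map _) (coverMap_surjective _) hk hP hX
    rw [hφ.projective _ inferInstance, hφ.coker] at e
    exact neg_eq_of_add_eq_zero_right e.symm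

end IsStableClassFunction

theorem exists_isStableClassFunction (hf : f ∈ nonZeroDivisors Q) (n : ℕ) :
    ∃ φ : ∀ (M : Type u) [AddCommGroup M] [Module (Q ⧸ Ideal.span {f}) M]
      [Module.Finite (Q ⧸ Ideal.span {f}) M], K0 Q f, IsStableClassFunction (n + 2) φ := by
  induction n with
  | zero => exact ⟨_, isStableClassFunction_classOfCoker hf⟩
  | succ n ih =>
    obtain ⟨φ, hφ⟩ := ih
    exact ⟨_, hφ.succ hf⟩

/-- When `n` bounds all the projective dimensions, a stable class function is additive without
restriction. It therefore descends to `G₀` modulo projectives and is a left inverse. -/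
theorem cokerK0_injective (hf : f ∈ nonZeroDivisors Q) {n : ℕ}
    (hn : ∀ (M : Type u) [AddCommGroup M] [Module (Q ⧸ Ideal.span {f}) M]
      [Module.Finite (Q ⧸ Ideal.span {f}) M], OverPdLT f M (n + 2)) :
    Function.Injective (cokerK0 hf) := by
  obtain ⟨φ, hφ⟩ := exists_isStableClassFunction hf n
  let Ψ : G0 (Q ⧸ Ideal.span {f}) →+ K0 Q f :=
    QuotientAddGroup.lift _ (FreeAbelianGroup.lift fun M : FGModuleCat.{u} _ => φ M) <| by
      rw [AddSubgroup.closure_le]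
      rintro _ ⟨A, B, C, i, p, hi, h, hp, rfl⟩
      simp [AddMonoidHom.mem_ker, hφ.add i p hi h hp (hn A) (hn B) (hn C)]
  let Ψ' : G0 (Q ⧸ Ideal.span {f}) ⧸ projectiveClasses (Q ⧸ Ideal.span {f}) →+ K0 Q f :=
    QuotientAddGroup.lift _ Ψ <| by
      rw [projectiveClasses, AddSubgroup.closure_le]
      rintro _ ⟨P, hP, rfl⟩
      exact (FreeAbelianGroup.lift_apply_of _ _).trans (hφ.projective P hP)
  have : Ψ'.comp (cokerK0 hf) = AddMonoidHom.id _ := K0On.hom_ext fun X => by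
    rw [AddMonoidHom.comp_apply]
    refine (congrArg Ψ' (cokerK0_cls hf X.1)).trans ?_
    exact (FreeAbelianGroup.lift_apply_of (fun M : FGModuleCat.{u} _ => φ M)
      (FGModuleCat.of _ X.1.coker)).trans (hφ.coker X.1)
  exact Function.LeftInverse.injective (g := Ψ') (DFunLike.congr_fun this)

/-- A syzygy over `Q / (f)` has smaller projective dimension over `Q`, and its stable class differs
only by a sign. -/
theorem stableMk_mem_range_cokerK0 (hf : f ∈ nonZeroDivisors Q) (n : ℕ) :
    ∀ (M : Type u) [AddCommGroup M] [Module (Q ⧸ Ideal.span {f}) M]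
      [Module.Finite (Q ⧸ Ideal.span {f}) M], OverPdLT f M (n + 2) →
      G0.stableMk (Q ⧸ Ideal.span {f}) M ∈ (cokerK0 hf).range := by
  induction n with
  | zero =>
    intro M _ _ _ hM
    obtain ⟨X, ⟨e⟩⟩ := exists_coker_equiv hM
    refine ⟨K0.cls X, (cokerK0_cls hf X).trans ?_⟩
    -- An isomorphism is a stable equivalence whose error terms factor through the zero module.
    exact G0.stableMk_eq_of_stableEquiv e.toLinearMap e.symm.toLinearMap
      (0 : _ →ₗ[_] PUnit.{u + 1}) 0 (0 : _ →ₗ[_] PUnit.{u + 1}) 0 (by simp) (by simp)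
  | succ n ih =>
    intro M _ _ _ hM
    have hk : OverPdLT f (LinearMap.ker (coverMap f M)) (n + 2) := OverPdLT.left
      (LinearMap.ker _).subtype_injective (LinearMap.exact_subtype_ker_map _)
      (coverMap_surjective _) ((OverPdLT.of_projective hf).mono (by omega)) hM
    have e := G0.stableMk_eq_add _ _ (LinearMap.ker (coverMap f M)).subtype_injective
      (LinearMap.exact_subtype_ker_map _) (coverMap_surjective _)
    rw [G0.stableMk_eq_zero] at e
    rw [← neg_eq_of_add_eq_zero_right e.symm]
    exact neg_mem (ih _ hk)

theorem cokerK0_bijective (hf : f ∈ nonZeroDivisors Q) {n : ℕ}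
    (hn : ∀ (M : Type u) [AddCommGroup M] [Module (Q ⧸ Ideal.span {f}) M]
      [Module.Finite (Q ⧸ Ideal.span {f}) M], OverPdLT f M (n + 2)) :
    Function.Bijective (cokerK0 hf) := by
  refine ⟨cokerK0_injective hf hn, fun z => ?_⟩
  obtain ⟨z, rfl⟩ := QuotientAddGroup.mk_surjective z
  obtain ⟨z, rfl⟩ := QuotientAddGroup.mk_surjective z
  induction z using FreeAbelianGroup.induction_on with
  | zero => exact ⟨0, map_zero _⟩
  | of M => exact stableMk_mem_range_cokerK0 hf n M (hn M)
  | neg M h =>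
    obtain ⟨w, hw⟩ := h
    exact ⟨-w, by rw [map_neg, hw]; rfl⟩
  | add x y hx hy =>
    obtain ⟨w, hw⟩ := hx
    obtain ⟨w', hw'⟩ := hy
    exact ⟨w + w', by rw [map_add, hw, hw']; rfl⟩

end MatrixFactorization

/-! ### Clearing denominators and a criterion for finite length. -/

/-- If the localization of a finitely generated module is projective, then multiplication by some
denominator factors through a finitely generated free module. -/
theorem Module.exists_smul_factor_of_projective_localizedModule {R M : Type u} [CommRing R]
    [IsNoetherianRing R] [AddCommGroup M] [Module R M] [Module.Finite R M] (S : Submonoid R)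
    [Module.Projective (Localization S) (LocalizedModule S M)] :
    ∃ s ∈ S, ∃ (n : ℕ) (σ : M →ₗ[R] (Fin n → R)) (π : (Fin n → R) →ₗ[R] M),
      ∀ m, π (σ m) = s • m := by
  obtain ⟨n, π, hπ⟩ := Module.Finite.exists_fin' R M
  have : Module.FinitePresentation R M := Module.finitePresentation_of_finite R M
  let πS : LocalizedModule S (Fin n → R) →ₗ[Localization S] LocalizedModule S M :=
    LocalizedModule.map S π
  have hπS : Function.Surjective πS := LocalizedModule.map_surjective S π hπ
  obtain ⟨τ, hτ⟩ := Module.projective_lifting_property πS LinearMap.id hπS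
  -- The section `τ` exists only over the localization; finite presentation of `M` gives `h` over
  -- `R` that localizes to `s • τ`.
  obtain ⟨h, s, hs⟩ := Module.FinitePresentation.exists_lift_of_isLocalizedModule S
    (LocalizedModule.mkLinearMap S (Fin n → R))
    (τ.restrictScalars R ∘ₗ LocalizedModule.mkLinearMap S M)
  have hcomp : LocalizedModule.mkLinearMap S M ∘ₗ (π ∘ₗ h) =
      LocalizedModule.mkLinearMap S M ∘ₗ (s.1 • LinearMap.id) := by
    ext m
    have h1 : LocalizedModule.mkLinearMap S (Fin n → R) (h m) =
        s.1 • τ (LocalizedModule.mkLinearMap S M m) := LinearMap.congr_fun hs m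
    have h2 : πS (LocalizedModule.mkLinearMap S (Fin n → R) (h m)) =
        LocalizedModule.mkLinearMap S M (π (h m)) := LocalizedModule.map_mk S π (h m) 1
    have h3 : πS (τ (LocalizedModule.mkLinearMap S M m)) = LocalizedModule.mkLinearMap S M m :=
      LinearMap.congr_fun hτ _
    rw [LinearMap.comp_apply, LinearMap.comp_apply, LinearMap.comp_apply, LinearMap.smul_apply,
      map_smul, LinearMap.id_apply, ← h2, h1, LinearMap.map_smul_of_tower, h3]
  -- The maps `π ∘ h` and multiplication by `s` are known to agree only after localization, whence a
  -- second denominator `t`.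
  obtain ⟨t, ht⟩ := Module.Finite.exists_smul_of_comp_eq_of_isLocalizedModule S
    (LocalizedModule.mkLinearMap S M) _ _ hcomp
  refine ⟨t.1 * s.1, S.mul_mem t.2 s.2, n, t.1 • h, π, fun m => ?_⟩
  rw [LinearMap.smul_apply, map_smul, mul_smul]
  exact LinearMap.congr_fun ht m

/-- A finitely generated module over a Noetherian local ring which is killed by an ideal contained
in no non-maximal prime has finite length. -/
theorem Module.length_ne_top_of_forall_prime {R M : Type*} [CommRing R] [IsNoetherianRing R]
    [AddCommGroup M] [Module R M] [Module.Finite R M] (I : Ideal R)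
    (hI : ∀ p : Ideal R, p.IsPrime → I ≤ p → p.IsMaximal) (hM : ∀ x ∈ I, ∀ m : M, x • m = 0) :
    Module.length R M ≠ ⊤ := by
  -- Primes of `R / I` pull back to primes containing `I`, which are maximal. So `R / I` is
  -- Artinian, and `M` is a finite module over it.
  have : Ring.KrullDimLE 0 (R ⧸ I) := Ring.krullDimLE_zero_iff.2 fun J hJ => by
    have hJ' := hJ.comap (Ideal.Quotient.mk I)
    have := hI _ hJ' (fun x hx => by
      rw [Ideal.mem_comap, Ideal.Quotient.eq_zero_iff_mem.2 hx]
      exact J.zero_mem)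
    exact Ideal.isMaximal_of_isIntegral_of_isMaximal_comap _ this
  have := IsNoetherianRing.isArtinianRing_of_krullDimLE_zero (R := R ⧸ I)
  have htor : Module.IsTorsionBySet R M I := fun m x => hM x.1 x.2 m
  let := htor.module
  have := htor.isScalarTower (S := R)
  have : Module.Finite (R ⧸ I) M := Module.Finite.of_restrictScalars_finite R _ _
  rw [Module.length_eq_of_surjective (R := R ⧸ I) Ideal.Quotient.mk_surjective]
  exact Module.length_ne_top

namespace MatrixFactorization

variable {Q : Type u} [CommRing Q] {f g e : Q}

/-! ### Elements acting null-homotopically -/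

/-- Multiplication by `q`. -/
def Hom.smulId (X : MatrixFactorization Q f) (q : Q) : Hom X X where
  φ0 := q • LinearMap.id
  φ1 := q • LinearMap.id
  comm_α x := by simp
  comm_β x := by simp

/-- The ideal of the elements which act null-homotopically on `X`. -/
def nullIdeal (X : MatrixFactorization Q f) : Ideal Q where
  carrier := {q | Homotopic (Hom.smulId X q) (Hom.smulId X 0)}
  add_mem' := by
    rintro a b ⟨h0, h1, H0, H1⟩ ⟨k0, k1, K0, K1⟩
    refine ⟨h0 + k0, h1 + k1, fun x => ?_, fun x => ?_⟩
    · have := congrArg₂ (· + ·) (H0 x) (K0 x)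
      simp only [Hom.smulId, LinearMap.smul_apply, LinearMap.id_apply, zero_smul, LinearMap.zero_apply, sub_zero,
        LinearMap.add_apply, map_add, add_smul] at this ⊢
      rw [← this]; abel
    · have := congrArg₂ (· + ·) (H1 x) (K1 x)
      simp only [Hom.smulId, LinearMap.smul_apply, LinearMap.id_apply, zero_smul, LinearMap.zero_apply, sub_zero,
        LinearMap.add_apply, map_add, add_smul] at this ⊢
      rw [← this]; abel
  zero_mem' := ⟨0, 0, fun x => by simp, fun x => by simp⟩
  smul_mem' := by
    rintro c a ⟨h0, h1, H0, H1⟩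
    refine ⟨c • h0, c • h1, fun x => ?_, fun x => ?_⟩
    · have := congrArg (c • ·) (H0 x)
      simpa only [Hom.smulId, LinearMap.smul_apply, LinearMap.id_apply, zero_smul, LinearMap.zero_apply, sub_zero,
        map_smul, smul_add, smul_eq_mul, mul_smul] using this
    · have := congrArg (c • ·) (H1 x)
      simpa only [Hom.smulId, LinearMap.smul_apply, LinearMap.id_apply, zero_smul, LinearMap.zero_apply, sub_zero,
        map_smul, smul_add, smul_eq_mul, mul_smul] using this

theorem mem_nullIdeal {X : MatrixFactorization Q f} {q : Q} (h0 : X.P0 →ₗ[Q] X.P1)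
    (h1 : X.P1 →ₗ[Q] X.P0) (H0 : ∀ x, X.α (h0 x) + h1 (X.β x) = q • x)
    (H1 : ∀ x, X.β (h1 x) + h0 (X.α x) = q • x) : q ∈ X.nullIdeal :=
  ⟨h0, h1, fun x => by simp [Hom.smulId, H0], fun x => by simp [Hom.smulId, H1]⟩

/-- This ensures that primes containing the ideal correspond to primes of `Q / (f)`. -/
theorem self_mem_nullIdeal (X : MatrixFactorization Q f) : f ∈ X.nullIdeal :=
  mem_nullIdeal X.β 0 (fun x => by simp [X.α_β]) (fun x => by simp [X.β_α])

theorem nullIdeal_le_tensor (h : f + g = e) (X : MatrixFactorization Q f)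
    (Y : MatrixFactorization Q g) : X.nullIdeal ≤ (tensor h X Y).nullIdeal := by
  intro q hq
  have key : ∀ (c : Q) (A B C D : Type u) [AddCommGroup A] [AddCommGroup B] [AddCommGroup C]
      [AddCommGroup D] [Module Q A] [Module Q B] [Module Q C] [Module Q D]
      (x : (A ⊗[Q] B) × (C ⊗[Q] D)), LinearMap.prodMap ((c • LinearMap.id).rTensor B)
        ((c • LinearMap.id).rTensor D) x = c • x := fun c A B C D _ _ _ _ _ _ _ _ x => by
    refine prodTensor_ext _ (c • LinearMap.id) (fun a b => ?_) (fun a b => ?_) x <;>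
      simp [TensorProduct.smul_tmul']
  exact (Homotopic.tensorRight h hq Y).congr (fun x => key _ _ _ _ _ x) (fun x => key _ _ _ _ _ x)
    (fun x => key _ _ _ _ _ x) (fun x => key _ _ _ _ _ x)

theorem nullIdeal_le_swap (X : MatrixFactorization Q f) : X.nullIdeal ≤ X.swap.nullIdeal := by
  rintro q ⟨h0, h1, H0, H1⟩
  exact ⟨h1, h0, H1, H0⟩

theorem smul_H0_eq_zero {X : MatrixFactorization Q (0 : Q)} {q : Q} (hq : q ∈ X.nullIdeal)
    (z : X.H0) : q • z = 0 := by
  obtain ⟨h0, h1, H, -⟩ := hq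
  refine H0.ind (p := fun z => q • z = 0) (fun x hx => ?_) z
  have e : q • H0.mk x hx = H0.mk (q • x) (by rw [map_smul, hx, smul_zero]) := rfl
  rw [e, H0.mk_eq_zero]
  refine ⟨h0 x, ?_⟩
  have := H x
  rw [hx, map_zero, add_zero] at this
  simpa [Hom.smulId] using this

/-! ### The periodic sequence of cokernels -/

theorem one_tmul_eq_zero_iff {P : Type*} [AddCommGroup P] [Module Q P] (x : P) :
    (1 : Q ⧸ Ideal.span {f}) ⊗ₜ[Q] x = 0 ↔ ∃ y, f • y = x := by
  rw [← (TensorProduct.quotTensorEquivQuotSMul P (Ideal.span {f})).map_eq_zero_iff,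
    TensorProduct.quotTensorEquivQuotSMul_mk_one_tmul, Submodule.Quotient.mk_eq_zero,
    Submodule.ideal_span_singleton_smul, Submodule.mem_smul_pointwise_iff_exists]
  simp

theorem one_tmul_surjective (P : Type*) [AddCommGroup P] [Module Q P] :
    Function.Surjective (TensorProduct.mk Q (Q ⧸ Ideal.span {f}) P 1) := fun z => by
  obtain ⟨x, hx⟩ := Submodule.Quotient.mk_surjective _
    (TensorProduct.quotTensorEquivQuotSMul P (Ideal.span {f}) z)
  refine ⟨x, (TensorProduct.quotTensorEquivQuotSMul P (Ideal.span {f})).injective ?_⟩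
  rw [← hx, TensorProduct.mk_apply, TensorProduct.quotTensorEquivQuotSMul_mk_one_tmul]

/-- The projection `P₀ / f P₀ → coker α`. -/
def reducedToCoker (X : MatrixFactorization Q f) :
    (Q ⧸ Ideal.span {f}) ⊗[Q] X.P0 →ₗ[Q ⧸ Ideal.span {f}] X.coker :=
  LinearMap.liftBaseChange _ X.toCoker

theorem reducedToCoker_tmul (X : MatrixFactorization Q f) (x : X.P0) :
    X.reducedToCoker (1 ⊗ₜ x) = X.toCoker x := by
  rw [reducedToCoker, LinearMap.liftBaseChange_tmul, one_smul]

theorem reducedToCoker_surjective (X : MatrixFactorization Q f) :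
    Function.Surjective X.reducedToCoker := fun y => by
  obtain ⟨x, rfl⟩ := X.toCoker_surjective y
  exact ⟨_, X.reducedToCoker_tmul x⟩

/-- If `β x = f y = β (α y)`, then `x = α y`, since `β` is injective as well. -/
theorem cokerβ_injective (hf : f ∈ nonZeroDivisors Q) (X : MatrixFactorization Q f) :
    Function.Injective X.cokerβ := by
  rw [injective_iff_map_eq_zero]
  intro z hz
  obtain ⟨x, rfl⟩ := X.toCoker_surjective z
  rw [cokerβ_toCoker, one_tmul_eq_zero_iff] at hz
  obtain ⟨y, hy⟩ := hz
  rw [toCoker_eq_zero]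
  refine ⟨y, X.swap.α_injective hf ?_⟩
  show X.β (X.α y) = X.β x
  rw [X.β_α, hy]

theorem cokerβ_exact (X : MatrixFactorization Q f) :
    Function.Exact X.cokerβ X.swap.reducedToCoker := by
  intro z
  obtain ⟨y, rfl⟩ := one_tmul_surjective (f := f) X.P1 z
  rw [TensorProduct.mk_apply]
  constructor
  · intro h
    obtain ⟨x, hx⟩ := toCoker_eq_zero.1 ((X.swap.reducedToCoker_tmul y).symm.trans h)
    exact ⟨X.toCoker x, (X.cokerβ_toCoker x).trans (congrArg _ hx)⟩
  · rintro ⟨w, hw⟩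
    obtain ⟨x, rfl⟩ := X.toCoker_surjective w
    rw [← hw, cokerβ_toCoker]
    exact (X.swap.reducedToCoker_tmul (X.β x)).trans (toCoker_eq_zero.2 ⟨x, rfl⟩)

/-- If modules over the localization of `Q / (f)` have bounded projective dimension, then the
localized cokernel is projective. -/
theorem projective_localizedModule_coker (hf : f ∈ nonZeroDivisors Q)
    (S : Submonoid (Q ⧸ Ideal.span {f})) {n : ℕ}
    (hn : ∀ (M : Type u) [AddCommGroup M] [Module (Localization S) M]
      [Module.Finite (Localization S) M], Module.PdLT (Localization S) M (n + 1))
    (X : MatrixFactorization Q f) :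
    Module.Projective (Localization S) (LocalizedModule S X.coker) := by
  -- Localizing `0 → coker α → P₁ / f P₁ → coker β → 0`, whose middle term is projective, gains one
  -- dimension on passing from `coker β` to `coker α`.
  have step : ∀ (k : ℕ) (X : MatrixFactorization Q f),
      Module.PdLT (Localization S) (LocalizedModule S X.swap.coker) (k + 2) →
      Module.PdLT (Localization S) (LocalizedModule S X.coker) (k + 1) := fun k X h => by
    let i : LocalizedModule S X.coker →ₗ[Localization S]
        LocalizedModule S ((Q ⧸ Ideal.span {f}) ⊗[Q] X.P1) := LocalizedModule.map S X.cokerβ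
    let p : LocalizedModule S ((Q ⧸ Ideal.span {f}) ⊗[Q] X.P1) →ₗ[Localization S]
        LocalizedModule S X.swap.coker := LocalizedModule.map S X.swap.reducedToCoker
    have hF : Module.PdLT (Localization S)
        (LocalizedModule S ((Q ⧸ Ideal.span {f}) ⊗[Q] X.P1)) 1 :=
      Module.PdLT.one_iff.2 inferInstance
    exact Module.PdLT.left (i := i) (p := p)
      (LocalizedModule.map_injective S _ (X.cokerβ_injective hf))
      (LocalizedModule.map_exact S _ _ X.cokerβ_exact)
      (LocalizedModule.map_surjective S _ X.swap.reducedToCoker_surjective)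
      (hF.mono (by omega)) h
  -- Each gain exchanges the two cokernels, so the bound is carried for all factorizations at once.
  -- For `k ≥ n` the truncated difference stays `0` and nothing changes.
  have main : ∀ (k : ℕ), ∀ X : MatrixFactorization Q f,
      Module.PdLT (Localization S) (LocalizedModule S X.coker) (n - k + 1) := by
    intro k
    induction k with
    | zero => exact fun X => hn _
    | succ k ih =>
      intro X
      by_cases hk : k < n
      · have := ih X.swap
        rw [show n - k + 1 = (n - (k + 1)) + 2 by omega] at this
        exact step _ _ this
      · have := ih X
        rwa [show n - k = n - (k + 1) by omega] at this
  have := main n X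
  rw [Nat.sub_self] at this
  exact Module.PdLT.one_iff.1 this

/-- If `Q / (f)` is an isolated singularity, then only the maximal ideal contains the ideal of
elements acting null-homotopically. -/
theorem isMaximal_of_nullIdeal_le [IsNoetherianRing Q] (hf : f ∈ nonZeroDivisors Q)
    (hiso : ∀ (p : Ideal (Q ⧸ Ideal.span {f})) [p.IsPrime], ¬ p.IsMaximal →
      IsRegularLocalRing (Localization.AtPrime p)) (X : MatrixFactorization Q f) (p : Ideal Q)
    (hp : p.IsPrime) (hle : X.nullIdeal ≤ p) : p.IsMaximal := by
  by_contra hmax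
  have hfp : Ideal.span {f} ≤ p :=
    (Ideal.span_singleton_le_iff_mem _).2 (hle X.self_mem_nullIdeal)
  let π := Ideal.Quotient.mk (Ideal.span {f})
  have hker : RingHom.ker π ≤ p := by rwa [Ideal.mk_ker]
  have hp' : (p.map π).IsPrime := Ideal.map_isPrime_of_surjective Ideal.Quotient.mk_surjective hker
  have hcomap : (p.map π).comap π = p := by
    rw [Ideal.comap_map_of_surjective π Ideal.Quotient.mk_surjective]
    exact sup_eq_left.2 hker
  have hmax' : ¬ (p.map π).IsMaximal := fun h => hmax (by
    rw [← hcomap]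
    exact Ideal.comap_isMaximal_of_surjective π Ideal.Quotient.mk_surjective)
  have := hiso _ hmax'
  obtain ⟨n, hn⟩ := IsRegularLocalRing.exists_pdLT (Localization.AtPrime (p.map π))
  have := projective_localizedModule_coker hf (p.map π).primeCompl hn X
  obtain ⟨s, hs, n, σ, τ, hστ⟩ :=
    Module.exists_smul_factor_of_projective_localizedModule (M := X.coker) (p.map π).primeCompl
  obtain ⟨s, rfl⟩ := Ideal.Quotient.mk_surjective s
  -- It is enough that `s` acts null-homotopically on `X`, for then `s ∈ p`, against the choice of
  -- `s` as a denominator. The factorization through a free module provides the homotopy.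
  refine hs (Ideal.mem_map_of_mem π (hle ?_))
  obtain ⟨h0, h1, H0, H1⟩ := exists_homotopy_of_factor hf (X := X) (Y := X) (s • LinearMap.id)
    (s • LinearMap.id) (fun x => by simp) (reduceFin f n) (reduceFin_surjective f n)
    exists_smul_of_reduceFin_eq_zero (σ.restrictScalars Q) (τ.restrictScalars Q)
    (fun x => by
      rw [LinearMap.restrictScalars_apply, LinearMap.restrictScalars_apply, hστ,
        LinearMap.smul_apply, map_smul]
      exact (algebraMap_smul (Q ⧸ Ideal.span {f}) s (X.toCoker x)).symm)
  exact mem_nullIdeal h0 h1 H0 H1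

/-- Control of one factor suffices: an element null-homotopic on `X` is null-homotopic on `X ⊗ Y`,
hence kills both homology modules. -/
theorem tensor_mem_finiteLengthHomology [IsNoetherianRing Q] (hf : f ∈ nonZeroDivisors Q)
    (hiso : ∀ (p : Ideal (Q ⧸ Ideal.span {f})) [p.IsPrime], ¬ p.IsMaximal →
      IsRegularLocalRing (Localization.AtPrime p)) (h : f + g = 0) (X : MatrixFactorization Q f)
    (Y : MatrixFactorization Q g) : tensor h X Y ∈ finiteLengthHomology Q :=
  ⟨Module.length_ne_top_of_forall_prime X.nullIdeal (isMaximal_of_nullIdeal_le hf hiso X)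
    fun _ hq => smul_H0_eq_zero (nullIdeal_le_tensor h X Y hq),
   Module.length_ne_top_of_forall_prime X.nullIdeal (isMaximal_of_nullIdeal_le hf hiso X)
    fun _ hq => smul_H0_eq_zero (nullIdeal_le_swap _ (nullIdeal_le_tensor h X Y hq))⟩

end MatrixFactorization

/-! ### Diagram chases for balancing Tor. -/

/-- A diagram chase: in a commutative grid whose rows `A' → B' → C'`, `A → B → C` and columns
`A' → A → A''`, `B' → B → B''` are right exact, with `A → B` and `B' → B` injective, the kernels of
`C' → C` and `A'' → B''` are isomorphic. -/
theorem LinearMap.length_ker_eq_of_grid {R A' B' C' A B C A'' B'' : Type*} [CommRing R]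
    [AddCommGroup A'] [AddCommGroup B'] [AddCommGroup C'] [AddCommGroup A] [AddCommGroup B]
    [AddCommGroup C] [AddCommGroup A''] [AddCommGroup B''] [Module R A'] [Module R B']
    [Module R C'] [Module R A] [Module R B] [Module R C] [Module R A''] [Module R B'']
    {j' : A' →ₗ[R] B'} {p' : B' →ₗ[R] C'} {j : A →ₗ[R] B} {p : B →ₗ[R] C} {j'' : A'' →ₗ[R] B''}
    {a : A' →ₗ[R] A} {b : B' →ₗ[R] B} {c : C' →ₗ[R] C} {a' : A →ₗ[R] A''} {b' : B →ₗ[R] B''}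
    (hj : Function.Injective j) (hb : Function.Injective b) (h' : Function.Exact j' p')
    (hp' : Function.Surjective p') (h : Function.Exact j p) (ha : Function.Exact a a')
    (ha' : Function.Surjective a') (hbb : Function.Exact b b')
    (e1 : ∀ x, b (j' x) = j (a x)) (e2 : ∀ x, c (p' x) = p (b x))
    (e3 : ∀ x, b' (j x) = j'' (a' x)) :
    Module.length R (LinearMap.ker c) = Module.length R (LinearMap.ker j'') := by
  -- The elements of `B'` whose image in `B` comes from `A`. They map onto `ker c` by `p'`, and onto
  -- `ker j''` by lifting to `A` and applying `a'`. Both maps have kernel `j'(A')`.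
  let W : Submodule R B' := (LinearMap.range j).comap b
  let l : A ≃ₗ[R] LinearMap.range j := LinearEquiv.ofInjective j hj
  let ρ : W →ₗ[R] A := l.symm.toLinearMap ∘ₗ (b.restrict (fun x hx => hx))
  have hρ : ∀ w : W, j (ρ w) = b w := fun w =>
    congrArg Subtype.val (l.apply_symm_apply ((b.restrict (fun x hx => hx)) w))
  let s : W →ₗ[R] LinearMap.ker c := (p' ∘ₗ W.subtype).codRestrict _ (fun w => by
    rw [LinearMap.mem_ker, LinearMap.comp_apply, Submodule.subtype_apply, e2, ← hρ,
      h.apply_apply_eq_zero])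
  let t : W →ₗ[R] LinearMap.ker j'' := (a' ∘ₗ ρ).codRestrict _ (fun w => by
    rw [LinearMap.mem_ker, LinearMap.comp_apply, ← e3, hρ, hbb.apply_apply_eq_zero])
  have hs : Function.Surjective s := by
    rintro ⟨z, hz⟩
    obtain ⟨x, rfl⟩ := hp' z
    exact ⟨⟨x, (h _).1 ((e2 x).symm.trans hz)⟩, rfl⟩
  have ht : Function.Surjective t := by
    rintro ⟨z, hz⟩
    obtain ⟨y, rfl⟩ := ha' z
    obtain ⟨x, hx⟩ := (hbb (j y)).1 ((e3 y).trans hz)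
    exact ⟨⟨x, y, hx.symm⟩, Subtype.ext (congrArg a' (hj ((hρ _).trans hx)))⟩
  have hker : LinearMap.ker s = LinearMap.ker t := by
    ext w
    have hs0 : w ∈ LinearMap.ker s ↔ p' w = 0 := by
      rw [LinearMap.mem_ker, ← Subtype.coe_inj]; rfl
    have ht0 : w ∈ LinearMap.ker t ↔ a' (ρ w) = 0 := by
      rw [LinearMap.mem_ker, ← Subtype.coe_inj]; rfl
    rw [hs0, ht0, h', ha]
    constructor
    · rintro ⟨x, hx⟩
      exact ⟨x, hj (by rw [← e1, hx, hρ])⟩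
    · rintro ⟨x, hx⟩
      exact ⟨x, hb (by rw [e1, hx, hρ])⟩
  rw [← (s.quotKerEquivOfSurjective hs).length_eq, ← (t.quotKerEquivOfSurjective ht).length_eq,
    hker]

section Balance

variable {R M' F M K P L : Type*} [CommRing R] [AddCommGroup M'] [AddCommGroup F]
  [AddCommGroup M] [AddCommGroup K] [AddCommGroup P] [AddCommGroup L] [Module R M'] [Module R F]
  [Module R M] [Module R K] [Module R P] [Module R L] {j : M' →ₗ[R] F} {p : F →ₗ[R] M}
  {i : K →ₗ[R] P} {q : P →ₗ[R] L}

/-- The two ways of computing the first torsion module have the same length. -/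
theorem length_ker_lTensor_eq_rTensor [Module.Flat R F] [Module.Flat R P]
    (hj : Function.Injective j) (hjp : Function.Exact j p) (hp : Function.Surjective p)
    (hi : Function.Injective i) (hiq : Function.Exact i q) (hq : Function.Surjective q) :
    Module.length R (LinearMap.ker (i.lTensor M)) = Module.length R (LinearMap.ker (j.rTensor L)) :=
  LinearMap.length_ker_eq_of_grid (j' := j.rTensor K) (p' := p.rTensor K) (j := j.rTensor P)
    (p := p.rTensor P) (a := i.lTensor M') (a' := q.lTensor M') (b := i.lTensor F)
    (b' := q.lTensor F) (Module.Flat.rTensor_preserves_injective_linearMap _ hj)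
    (Module.Flat.lTensor_preserves_injective_linearMap _ hi) (rTensor_exact _ hjp hp)
    (LinearMap.rTensor_surjective _ hp) (rTensor_exact _ hjp hp) (lTensor_exact _ hiq hq)
    (LinearMap.lTensor_surjective _ hq) (lTensor_exact _ hiq hq)
    (fun x => by rw [← LinearMap.comp_apply, ← LinearMap.comp_apply,
      LinearMap.lTensor_comp_rTensor, LinearMap.rTensor_comp_lTensor])
    (fun x => by rw [← LinearMap.comp_apply, ← LinearMap.comp_apply,
      LinearMap.lTensor_comp_rTensor, LinearMap.rTensor_comp_lTensor])
    (fun x => by rw [← LinearMap.comp_apply, ← LinearMap.comp_apply,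
      LinearMap.lTensor_comp_rTensor, LinearMap.rTensor_comp_lTensor])

/-- For injective `j : M' → F` into a flat module and injective `i : K → P` into a flat module, the
kernels of `M' ⊗ K → F ⊗ K` and `M' ⊗ K → M' ⊗ P` agree. -/
theorem ker_lTensor_eq_ker_rTensor [Module.Flat R F] [Module.Flat R P]
    (hj : Function.Injective j) (hi : Function.Injective i) :
    LinearMap.ker (i.lTensor M') = LinearMap.ker (j.rTensor K) := by
  -- Both kernels are the kernel of the diagonal map `M' ⊗ K → F ⊗ P`, since flatness makes the
  -- remaining side of each triangle injective.
  have h1 := LinearMap.ker_comp_of_ker_eq_bot (i.lTensor M') (LinearMap.ker_eq_bot.2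
    (Module.Flat.rTensor_preserves_injective_linearMap (M := P) j hj))
  have h2 := LinearMap.ker_comp_of_ker_eq_bot (j.rTensor K) (LinearMap.ker_eq_bot.2
    (Module.Flat.lTensor_preserves_injective_linearMap (M := F) i hi))
  rw [← h1, ← h2, LinearMap.lTensor_comp_rTensor, LinearMap.rTensor_comp_lTensor]

end Balance

/-! ### Lengths of Tor and dimension shifting. -/

section Tor

open CategoryTheory

variable {R : Type u} [CommRing R]

/-- The homology of `A → B → D` if the second map factors as `B → C → D` through the cokernel `C` of
the first map. -/
theorem CategoryTheory.ShortComplex.length_homology_eq_ker (S : ShortComplex (ModuleCat.{u} R))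
    {C : Type u} [AddCommGroup C] [Module R C] (v : S.X₂ →ₗ[R] C) (i : C →ₗ[R] S.X₃)
    (h : Function.Exact S.f.hom v) (hv : Function.Surjective v) (hi : ∀ x, i (v x) = S.g.hom x) :
    Module.length R S.homology = Module.length R (LinearMap.ker i) := by
  let s : LinearMap.ker S.g.hom →ₗ[R] LinearMap.ker i :=
    (v ∘ₗ (LinearMap.ker S.g.hom).subtype).codRestrict _ (fun w => by
      rw [LinearMap.mem_ker, LinearMap.comp_apply, hi]
      exact w.2)
  have hs : Function.Surjective s := by
    rintro ⟨z, hz⟩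
    obtain ⟨x, rfl⟩ := hv z
    exact ⟨⟨x, (hi x).symm.trans hz⟩, rfl⟩
  have hker : LinearMap.ker s = LinearMap.range S.moduleCatToCycles := by
    ext w
    have h1 : w ∈ LinearMap.ker s ↔ v w = 0 := by
      rw [LinearMap.mem_ker, ← Subtype.coe_inj]; rfl
    rw [h1, h]
    exact ⟨fun ⟨x, hx⟩ => ⟨x, Subtype.ext hx⟩, fun ⟨x, hx⟩ => ⟨x, congrArg Subtype.val hx⟩⟩
  rw [← (s.quotKerEquivOfSurjective hs).length_eq, hker]
  exact S.moduleCatHomologyIso.toLinearEquiv.length_eq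

variable {M N : Type u} [AddCommGroup M] [Module R M] [AddCommGroup N] [Module R N]

/-- The differentials of a resolution as linear maps. -/
abbrev CategoryTheory.ProjectiveResolution.dHom {N : ModuleCat.{u} R} (P : ProjectiveResolution N)
    (n : ℕ) : P.complex.X (n + 1) →ₗ[R] P.complex.X n :=
  (P.complex.d (n + 1) n).hom

theorem CategoryTheory.ProjectiveResolution.exact_dHom {N : ModuleCat.{u} R}
    (P : ProjectiveResolution N) (n : ℕ) :
    Function.Exact (P.dHom (n + 1)) (P.dHom n).rangeRestrict := by
  have := LinearMap.exact_iff.2 ((ShortComplex.moduleCat_exact_iff_range_eq_ker _).1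
    (P.exact_succ n)).symm
  intro x
  rw [← this x, ← Subtype.coe_inj]
  rfl

instance {N : ModuleCat.{u} R} (P : ProjectiveResolution N) (n : ℕ) :
    Module.Flat R (P.complex.X n) :=
  have : Module.Projective R (P.complex.X n) :=
    (IsProjective.iff_projective (R := R) (P := P.complex.X n)).2 (P.projective n)
  inferInstance

/-- By right exactness, `M` tensored with the image of a differential is the cokernel of the
preceding tensored differential. Homology is thus the kernel of the tensored inclusion of that
image. -/
theorem lengthTor_eq_of_resolution (M : Type u) [AddCommGroup M] [Module R M]
    (P : ProjectiveResolution (ModuleCat.of R N)) (n : ℕ) :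
    lengthTor R (n + 1) M N = Module.length R
      (LinearMap.ker ((LinearMap.range (P.dHom n)).subtype.lTensor M)) := by
  let F := (MonoidalCategory.tensoringLeft (ModuleCat.{u} R)).obj (ModuleCat.of R M)
  let C := (F.mapHomologicalComplex (ComplexShape.down ℕ)).obj P.complex
  have e1 : lengthTor R (n + 1) M N = Module.length R (C.homology (n + 1)) :=
    (P.isoLeftDerivedObj F (n + 1)).toLinearEquiv.length_eq
  have e2 : Module.length R (C.homology (n + 1)) =
      Module.length R (C.sc' (n + 2) (n + 1) n).homology :=
    (C.homologyIsoSc' (n + 2) (n + 1) n (by simp) (by simp)).toLinearEquiv.length_eq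
  rw [e1, e2]
  exact ShortComplex.length_homology_eq_ker (C.sc' (n + 2) (n + 1) n)
    ((P.dHom n).rangeRestrict.lTensor M) ((LinearMap.range (P.dHom n)).subtype.lTensor M)
    (lTensor_exact M (P.exact_dHom n) (LinearMap.surjective_rangeRestrict _))
    (LinearMap.lTensor_surjective M (LinearMap.surjective_rangeRestrict _))
    (fun x => (LinearMap.lTensor_comp_apply M _ (P.dHom n).rangeRestrict x).symm)

theorem exists_augmentation (P : ProjectiveResolution (ModuleCat.of R N)) :
    ∃ q : P.complex.X 0 →ₗ[R] N, Function.Surjective q ∧ Function.Exact (P.dHom 0) q := by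
  let e := (HomologicalComplex.singleObjXSelf (ComplexShape.down ℕ) 0
    (ModuleCat.of R N)).toLinearEquiv
  have h1 : Function.Surjective (P.π.f 0).hom := (ModuleCat.epi_iff_surjective _).1 inferInstance
  have h2 := LinearMap.exact_iff.2 ((ShortComplex.moduleCat_exact_iff_range_eq_ker _).1
    P.exact₀).symm
  refine ⟨e.toLinearMap ∘ₗ (P.π.f 0).hom, e.surjective.comp h1, fun x => ?_⟩
  rw [← h2 x]
  exact e.map_eq_zero_iff

variable {M' F : Type u} [AddCommGroup M'] [AddCommGroup F] [Module R M'] [Module R F]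
  {j : M' →ₗ[R] F} {p : F →ₗ[R] M}

/-- The resolution lies on the side of `N`; balancing moves the computation to the flat presentation
of `M`. -/
theorem lengthTor_one_eq (N : Type u) [AddCommGroup N] [Module R N] [Module.Flat R F]
    (hj : Function.Injective j) (h : Function.Exact j p) (hp : Function.Surjective p) :
    lengthTor R 1 M N = Module.length R (LinearMap.ker (j.rTensor N)) := by
  let P := ProjectiveResolution.of (ModuleCat.of R N)
  obtain ⟨q, hq, hdq⟩ := exists_augmentation P
  rw [lengthTor_eq_of_resolution M P 0]
  exact length_ker_lTensor_eq_rTensor hj h hp (Submodule.subtype_injective _)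
    (fun x => by rw [hdq x]; simp) hq

/-- Dimension shifting in the first variable. -/
theorem lengthTor_succ_left (N : Type u) [AddCommGroup N] [Module R N] [Module.Flat R F]
    (hj : Function.Injective j) (h : Function.Exact j p) (hp : Function.Surjective p) (n : ℕ) :
    lengthTor R (n + 2) M N = lengthTor R (n + 1) M' N := by
  let P := ProjectiveResolution.of (ModuleCat.of R N)
  rw [lengthTor_eq_of_resolution M P (n + 1), lengthTor_eq_of_resolution M' P n,
    ker_lTensor_eq_ker_rTensor hj (Submodule.subtype_injective _)]
  refine length_ker_lTensor_eq_rTensor hj h hp (Submodule.subtype_injective _)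
    (fun x => ?_) (LinearMap.surjective_rangeRestrict (P.dHom n))
  rw [P.exact_dHom n x]
  simp

theorem exists_flat_presentation (R : Type u) [CommRing R] (M : Type u) [AddCommGroup M]
    [Module R M] : ∃ (F M' : Type u) (_ : AddCommGroup F) (_ : AddCommGroup M') (_ : Module R F)
      (_ : Module R M') (_ : Module.Flat R F) (j : M' →ₗ[R] F) (p : F →ₗ[R] M),
      Function.Injective j ∧ Function.Exact j p ∧ Function.Surjective p :=
  ⟨M →₀ R, LinearMap.ker (Finsupp.linearCombination R (id : M → M)), inferInstance, inferInstance,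
    inferInstance, inferInstance, inferInstance, Submodule.subtype _,
    Finsupp.linearCombination R (id : M → M), Submodule.subtype_injective _,
    LinearMap.exact_subtype_ker_map _, Finsupp.linearCombination_id_surjective R M⟩

/-- Dimension shifting in the second variable. -/
theorem lengthTor_succ_right {N' G N : Type u} [AddCommGroup N'] [AddCommGroup G] [AddCommGroup N]
    [Module R N'] [Module R G] [Module R N] [Module.Flat R G] {i : N' →ₗ[R] G} {q : G →ₗ[R] N}
    (hi : Function.Injective i) (h : Function.Exact i q) (hq : Function.Surjective q) (n : ℕ) :
    ∀ (M : Type u) [AddCommGroup M] [Module R M],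
      lengthTor R (n + 2) M N = lengthTor R (n + 1) M N' := by
  induction n with
  | zero =>
    intro M _ _
    obtain ⟨F, M', _, _, _, _, _, j, p, hj, hjp, hp⟩ := exists_flat_presentation R M
    obtain ⟨F', M'', _, _, _, _, _, j', p', hj', hjp', hp'⟩ := exists_flat_presentation R M'
    -- Both lengths reduce to that of `Tor₁(M', N)`: the left side by shifting in `M`, the right
    -- side because the kernels of `M' ⊗ N' → F ⊗ N'` and `M' ⊗ N' → M' ⊗ G` coincide.
    rw [lengthTor_succ_left N hj hjp hp, lengthTor_one_eq N' hj hjp hp,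
      ← ker_lTensor_eq_ker_rTensor hj hi, lengthTor_one_eq N hj' hjp' hp']
    exact (length_ker_lTensor_eq_rTensor hj' hjp' hp' hi h hq).symm
  | succ n ih =>
    intro M _ _
    obtain ⟨F, M', _, _, _, _, _, j, p, hj, hjp, hp⟩ := exists_flat_presentation R M
    rw [lengthTor_succ_left N hj hjp hp, lengthTor_succ_left N' hj hjp hp, ih]

end Tor

theorem TensorProduct.compatibleSMul_of_surjective {Q R M N : Type*} [CommRing Q] [CommRing R]
    [Algebra Q R] (h : Function.Surjective (algebraMap Q R)) [AddCommGroup M] [AddCommGroup N]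
    [Module Q M] [Module R M] [IsScalarTower Q R M] [Module Q N] [Module R N]
    [IsScalarTower Q R N] : TensorProduct.CompatibleSMul Q R M N where
  smul_tmul r m n := by
    obtain ⟨q, rfl⟩ := h r
    rw [algebraMap_smul, algebraMap_smul, TensorProduct.smul_tmul]

namespace MatrixFactorization

variable {Q : Type u} [CommRing Q] {f g e : Q}

/-! ### The homology of a tensor product in terms of cokernels -/

/-- The projection `X₀ ⊗ Y₀ → coker X ⊗ coker Y`. -/
noncomputable def tensorToCoker (X Y : MatrixFactorization Q f) :
    X.P0 ⊗[Q] Y.P0 →ₗ[Q] X.coker ⊗[Q ⧸ Ideal.span {f}] Y.coker :=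
  haveI : TensorProduct.CompatibleSMul Q (Q ⧸ Ideal.span {f}) X.coker Y.coker :=
    TensorProduct.compatibleSMul_of_surjective Ideal.Quotient.mk_surjective
  (TensorProduct.equivOfCompatibleSMul (Q ⧸ Ideal.span {f}) Q Q X.coker Y.coker).toLinearMap ∘ₗ
    TensorProduct.map X.toCoker Y.toCoker

theorem tensorToCoker_tmul (X Y : MatrixFactorization Q f) (x : X.P0) (y : Y.P0) :
    tensorToCoker X Y (x ⊗ₜ y) = X.toCoker x ⊗ₜ Y.toCoker y := rfl

theorem tensorToCoker_surjective (X Y : MatrixFactorization Q f) :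
    Function.Surjective (tensorToCoker X Y) := by
  rw [tensorToCoker, LinearMap.coe_comp]
  exact (LinearEquiv.surjective _).comp
    (TensorProduct.map_surjective X.toCoker_surjective Y.toCoker_surjective)

theorem exact_toCoker (X : MatrixFactorization Q f) : Function.Exact X.α X.toCoker :=
  fun _ => toCoker_eq_zero

theorem tensorToCoker_eq_zero {X Y : MatrixFactorization Q f} {z : X.P0 ⊗[Q] Y.P0} :
    tensorToCoker X Y z = 0 ↔
      ∃ c d, X.α.rTensor Y.P0 c + Y.α.lTensor X.P0 d = z := by
  rw [tensorToCoker, LinearMap.comp_apply, LinearEquiv.coe_coe, LinearEquiv.map_eq_zero_iff,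
    ← LinearMap.mem_ker, TensorProduct.map_ker X.exact_toCoker X.toCoker_surjective Y.exact_toCoker
    Y.toCoker_surjective, sup_comm, Submodule.mem_sup]
  simp

/-- The reduction `(P / f P) ⊗ coker Y = P ⊗ coker Y`. -/
noncomputable def reducedTensorEquiv (P : Type*) [AddCommGroup P] [Module Q P]
    (Y : MatrixFactorization Q f) :
    ((Q ⧸ Ideal.span {f}) ⊗[Q] P) ⊗[Q ⧸ Ideal.span {f}] Y.coker ≃ₗ[Q] P ⊗[Q] Y.coker :=
  (TensorProduct.comm (Q ⧸ Ideal.span {f}) _ _ ≪≫ₗ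
    TensorProduct.AlgebraTensorModule.cancelBaseChange Q (Q ⧸ Ideal.span {f})
      (Q ⧸ Ideal.span {f}) Y.coker P).restrictScalars Q ≪≫ₗ TensorProduct.comm Q _ _

theorem cokerβ_tensorToCoker (X Y : MatrixFactorization Q f) (z : X.P0 ⊗[Q] Y.P0) :
    reducedTensorEquiv X.P1 Y (X.cokerβ.rTensor Y.coker (tensorToCoker X Y z)) =
      Y.toCoker.lTensor X.P1 (X.β.rTensor Y.P0 z) := by
  induction z with
  | zero => simp only [map_zero]
  | add a b ha hb => simp only [map_add, ha, hb]
  | tmul x y =>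
    rw [tensorToCoker_tmul, LinearMap.rTensor_tmul, cokerβ_toCoker, LinearMap.rTensor_tmul,
      LinearMap.lTensor_tmul]
    show TensorProduct.comm Q _ _ (TensorProduct.AlgebraTensorModule.cancelBaseChange Q
      (Q ⧸ Ideal.span {f}) (Q ⧸ Ideal.span {f}) Y.coker X.P1 (Y.toCoker y ⊗ₜ (1 ⊗ₜ X.β x))) = _
    rw [TensorProduct.AlgebraTensorModule.cancelBaseChange_tmul, one_smul,
      TensorProduct.comm_tmul]

/-- The right side is the first component of the condition that `(z, b)` be an even cycle of `X ⊗
Y°`. -/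
theorem cokerβ_tensorToCoker_eq_zero {X Y : MatrixFactorization Q f} {z : X.P0 ⊗[Q] Y.P0} :
    X.cokerβ.rTensor Y.coker (tensorToCoker X Y z) = 0 ↔
      ∃ b, Y.α.lTensor X.P1 b = X.β.rTensor Y.P0 z := by
  rw [← (reducedTensorEquiv X.P1 Y).map_eq_zero_iff, cokerβ_tensorToCoker]
  exact lTensor_exact X.P1 Y.exact_toCoker Y.toCoker_surjective _

/-- An even cycle `(a, b)` is determined by `a`, because tensoring with a flat module keeps `Y.α`
injective. Sending the cycle to the class of `a` in `coker X ⊗ coker Y` identifies the even homology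
with the kernel on the right. -/
theorem length_H0_tensor_circ (hf : f ∈ nonZeroDivisors Q) (X Y : MatrixFactorization Q f) :
    Module.length Q (tensor (add_neg_cancel f) X Y.circ).H0 =
      Module.length (Q ⧸ Ideal.span {f}) (LinearMap.ker (X.cokerβ.rTensor Y.coker)) := by
  let T := tensor (add_neg_cancel f) X Y.circ
  let φ : T.P0 →ₗ[Q] X.coker ⊗[Q ⧸ Ideal.span {f}] Y.coker :=
    tensorToCoker X Y ∘ₗ LinearMap.fst Q (X.P0 ⊗[Q] Y.P0) (X.P1 ⊗[Q] Y.P1)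
  have hβ : ∀ (a : X.P0 ⊗[Q] Y.P0) (b : X.P1 ⊗[Q] Y.P1), T.β (a, b) = 0 ↔
      X.β.rTensor Y.P0 a = Y.α.lTensor X.P1 b ∧
        (-Y.β).lTensor X.P0 a + X.α.rTensor Y.P1 b = 0 := fun a b =>
    Prod.ext_iff.trans (and_congr_left' add_neg_eq_zero)
  have hα : ∀ (c : X.P1 ⊗[Q] Y.P0) (d : X.P0 ⊗[Q] Y.P1), T.α (c, d) =
      (X.α.rTensor Y.P0 c + Y.α.lTensor X.P0 d,
        -(-Y.β).lTensor X.P1 c + X.β.rTensor Y.P1 d) := fun c d => rfl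
  have hinj : ∀ P : Type u, ∀ [AddCommGroup P] [Module Q P] [Module.Flat Q P],
      Function.Injective (Y.α.lTensor P) := fun P _ _ _ =>
    Module.Flat.lTensor_preserves_injective_linearMap _ (Y.α_injective hf)
  let K := LinearMap.ker (X.cokerβ.rTensor Y.coker)
  let s : LinearMap.ker T.β →ₗ[Q] K :=
    { toFun := fun w => ⟨φ w.1, by
        exact cokerβ_tensorToCoker_eq_zero.2 ⟨w.1.2, ((hβ w.1.1 w.1.2).1 w.2).1.symm⟩⟩
      map_add' := fun v w => Subtype.ext (map_add φ v.1 w.1)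
      map_smul' := fun q w => Subtype.ext (map_smul φ q w.1) }
  have hs : Function.Surjective s := by
    rintro ⟨z, hz⟩
    obtain ⟨a, rfl⟩ := tensorToCoker_surjective X Y z
    obtain ⟨b, hb⟩ := cokerβ_tensorToCoker_eq_zero.1 hz
    refine ⟨⟨(a, b), (hβ a b).2 ⟨hb.symm, hinj _ ?_⟩⟩, rfl⟩
    -- The second cycle condition is tested after the injective `1 ⊗ Y.α`, where the two terms
    -- become `-f a` and `f a`; the sign in `Y.circ` makes them cancel.
    have e1 : Y.α.lTensor X.P0 ((-Y.β).lTensor X.P0 a) = -(f • a) := by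
      rw [← LinearMap.lTensor_comp_apply, show Y.α ∘ₗ (-Y.β) = (-f) • LinearMap.id by
        ext y; simp [Y.α_β], LinearMap.lTensor_smul, LinearMap.smul_apply,
        LinearMap.lTensor_id_apply, neg_smul]
    have e2 : Y.α.lTensor X.P0 (X.α.rTensor Y.P1 b) = f • a := by
      rw [← LinearMap.comp_apply, LinearMap.lTensor_comp_rTensor, ← LinearMap.rTensor_comp_lTensor,
        LinearMap.comp_apply, hb, ← LinearMap.rTensor_comp_apply,
        show X.α ∘ₗ X.β = f • LinearMap.id by ext x; simp [X.α_β], LinearMap.rTensor_smul,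
        LinearMap.smul_apply, LinearMap.rTensor_id_apply]
    rw [map_add, e1, e2, neg_add_cancel, map_zero]
  have hker : LinearMap.ker s = (LinearMap.range T.α).submoduleOf (LinearMap.ker T.β) := by
    ext w
    have h1 : w ∈ LinearMap.ker s ↔ tensorToCoker X Y w.1.1 = 0 := by
      rw [LinearMap.mem_ker, ← Subtype.coe_inj]; rfl
    refine h1.trans (tensorToCoker_eq_zero.trans ?_)
    constructor
    · rintro ⟨c, d, hcd⟩
      refine ⟨(c, d), ?_⟩
      -- The boundary `T.α (c, d)` is a cycle with the same first component as `w`, hence equal to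
      -- `w`.
      have hd : T.β (T.α (c, d)) = 0 := (T.β_α _).trans (zero_smul Q _)
      rw [hα] at hd ⊢
      have hd' := ((hβ _ _).1 hd).1
      rw [hcd] at hd'
      exact Prod.ext hcd (hinj _ (hd'.symm.trans ((hβ w.1.1 w.1.2).1 w.2).1))
    · rintro ⟨⟨c, d⟩, hcd⟩
      exact ⟨c, d, congrArg Prod.fst hcd⟩
  rw [← Module.length_eq_of_surjective (S := Q) (R := Q ⧸ Ideal.span {f}) (M := K)
    Ideal.Quotient.mk_surjective, ← (s.quotKerEquivOfSurjective hs).length_eq, hker]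

/-- Change of sign in the second component. -/
abbrev negSnd (A B : Type u) [AddCommGroup A] [AddCommGroup B] [Module Q A] [Module Q B] :
    A × B →ₗ[Q] A × B :=
  LinearMap.prodMap LinearMap.id (-LinearMap.id)

theorem negSnd_tensorα (X : MatrixFactorization Q f) (Y : MatrixFactorization Q g)
    (x : (X.P0 ⊗[Q] Y.P0) × (X.P1 ⊗[Q] Y.P1)) :
    negSnd (Q := Q) _ _ (tensorα X.swap Y x) = tensorβ X Y (negSnd (Q := Q) _ _ x) := by
  -- This is `tensorα X.swap Y` with the parts of `X.swap` unfolded, so that its types match those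
  -- of `tensorβ X Y`.
  let A : (X.P0 ⊗[Q] Y.P0) × (X.P1 ⊗[Q] Y.P1) →ₗ[Q] (X.P1 ⊗[Q] Y.P0) × (X.P0 ⊗[Q] Y.P1) :=
    LinearMap.coprod
      (LinearMap.prod (X.β.rTensor Y.P0) (-Y.β.lTensor X.P0))
      (LinearMap.prod (Y.α.lTensor X.P1) (X.α.rTensor Y.P1))
  exact prodTensor_ext (negSnd _ _ ∘ₗ A) (tensorβ X Y ∘ₗ negSnd _ _)
    (fun x y => by simp [A, tensorβ]) (fun x y => by simp [A, tensorβ]) x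

theorem negSnd_tensorβ (X : MatrixFactorization Q f) (Y : MatrixFactorization Q g)
    (x : (X.P1 ⊗[Q] Y.P0) × (X.P0 ⊗[Q] Y.P1)) :
    negSnd (Q := Q) _ _ (tensorβ X.swap Y x) = tensorα X Y (negSnd (Q := Q) _ _ x) := by
  let B : (X.P1 ⊗[Q] Y.P0) × (X.P0 ⊗[Q] Y.P1) →ₗ[Q] (X.P0 ⊗[Q] Y.P0) × (X.P1 ⊗[Q] Y.P1) :=
    LinearMap.coprod
      (LinearMap.prod (X.α.rTensor Y.P0) (Y.β.lTensor X.P1))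
      (LinearMap.prod (-Y.α.lTensor X.P0) (X.β.rTensor Y.P1))
  exact prodTensor_ext (negSnd _ _ ∘ₗ B) (tensorα X Y ∘ₗ negSnd _ _)
    (fun x y => by simp [B, tensorα]) (fun x y => by simp [B, tensorα]) x

/-- The isomorphism `X[1] ⊗ Y → (X ⊗ Y)[1]`. -/
def tensorSwap (h : f + g = e) (X : MatrixFactorization Q f) (Y : MatrixFactorization Q g) :
    Hom (tensor h X.swap Y) (tensor h X Y).swap where
  φ0 := negSnd (X.P1 ⊗[Q] Y.P0) (X.P0 ⊗[Q] Y.P1)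
  φ1 := negSnd (X.P0 ⊗[Q] Y.P0) (X.P1 ⊗[Q] Y.P1)
  comm_α := negSnd_tensorα X Y
  comm_β := negSnd_tensorβ X Y

/-- The sign change is an involution, so the two morphisms are mutually inverse and zero homotopies
suffice. -/
theorem homotopyEquivalent_tensorSwap (h : f + g = e) (X : MatrixFactorization Q f)
    (Y : MatrixFactorization Q g) :
    HomotopyEquivalent (tensor h X.swap Y) (tensor h X Y).swap := by
  have key : ∀ (A B : Type u) [AddCommGroup A] [AddCommGroup B] [Module Q A] [Module Q B]
      (x : A × B), (x.1, - -x.2) - x = 0 := fun A B _ _ _ _ x =>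
    sub_eq_zero.2 (Prod.ext rfl (neg_neg x.2))
  refine ⟨tensorSwap h X Y, (tensorSwap h X.swap Y).swap, ⟨0, 0, fun x => ?_, fun x => ?_⟩,
    0, 0, fun x => ?_, fun x => ?_⟩ <;>
  · rw [LinearMap.zero_apply, LinearMap.zero_apply, map_zero, zero_add]
    exact (key _ _ x).symm

theorem length_H1_tensor_circ (hf : f ∈ nonZeroDivisors Q) (X Y : MatrixFactorization Q f) :
    Module.length Q (tensor (add_neg_cancel f) X Y.circ).H1 =
      Module.length (Q ⧸ Ideal.span {f}) (LinearMap.ker (X.swap.cokerβ.rTensor Y.coker)) := by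
  rw [← length_H0_tensor_circ hf]
  exact (length_H0_eq_of_homotopyEquivalent (homotopyEquivalent_tensorSwap _ X Y.circ)).symm

/-! ### Torsion modules of cokernels -/

theorem lengthTor_one_coker_swap (hf : f ∈ nonZeroDivisors Q) (X : MatrixFactorization Q f)
    (N : Type u) [AddCommGroup N] [Module (Q ⧸ Ideal.span {f}) N] :
    lengthTor (Q ⧸ Ideal.span {f}) 1 X.swap.coker N =
      Module.length (Q ⧸ Ideal.span {f}) (LinearMap.ker (X.cokerβ.rTensor N)) :=
  lengthTor_one_eq N (X.cokerβ_injective hf) X.cokerβ_exact X.swap.reducedToCoker_surjective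

theorem lengthTor_coker_swap (hf : f ∈ nonZeroDivisors Q) (X : MatrixFactorization Q f)
    (N : Type u) [AddCommGroup N] [Module (Q ⧸ Ideal.span {f}) N] (n : ℕ) :
    lengthTor (Q ⧸ Ideal.span {f}) (n + 2) X.swap.coker N =
      lengthTor (Q ⧸ Ideal.span {f}) (n + 1) X.coker N :=
  lengthTor_succ_left N (X.cokerβ_injective hf) X.cokerβ_exact X.swap.reducedToCoker_surjective n

/-- The cokernels of `X` and `X.swap` are syzygies of each other, so two shifts return to `X` and
everything is decided by `Tor₁`. -/
theorem lengthTor_coker_odd (hf : f ∈ nonZeroDivisors Q) (X Y : MatrixFactorization Q f) (n : ℕ) :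
    lengthTor (Q ⧸ Ideal.span {f}) (2 * n + 1) X.coker Y.coker =
      Module.length Q (tensor (add_neg_cancel f) X Y.circ).H1 := by
  induction n with
  | zero =>
    rw [length_H1_tensor_circ hf]
    exact lengthTor_one_coker_swap hf X.swap Y.coker
  | succ n ih =>
    rw [← ih, show 2 * (n + 1) + 1 = (2 * n + 1) + 2 by ring]
    exact (lengthTor_coker_swap hf X.swap Y.coker _).trans (lengthTor_coker_swap hf X Y.coker _)

/-- The formula starts with `Tor₂`: the degree zero term is the tensor product of the cokernels, to
which dimension shifting does not apply. -/
theorem lengthTor_coker_even (hf : f ∈ nonZeroDivisors Q) (X Y : MatrixFactorization Q f) (n : ℕ) :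
    lengthTor (Q ⧸ Ideal.span {f}) (2 * n + 2) X.coker Y.coker =
      Module.length Q (tensor (add_neg_cancel f) X Y.circ).H0 := by
  induction n with
  | zero =>
    rw [length_H0_tensor_circ hf, ← lengthTor_one_coker_swap hf]
    exact lengthTor_coker_swap hf X.swap Y.coker 0
  | succ n ih =>
    rw [← ih, show 2 * (n + 1) + 2 = (2 * n + 2) + 2 by ring]
    exact (lengthTor_coker_swap hf X.swap Y.coker _).trans (lengthTor_coker_swap hf X Y.coker _)

end MatrixFactorization

/-! ### Eventual two-periodicity of Tor and its behaviour under syzygies. -/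

theorem lengthTor_congr {R : Type u} [CommRing R] {M M' N N' : Type u} [AddCommGroup M]
    [AddCommGroup M'] [AddCommGroup N] [AddCommGroup N'] [Module R M] [Module R M'] [Module R N]
    [Module R N'] (e : M ≃ₗ[R] M') (e' : N ≃ₗ[R] N') (n : ℕ) :
    lengthTor R n M N = lengthTor R n M' N' :=
  ((((CategoryTheory.Tor (ModuleCat.{u} R) n).mapIso e.toModuleIso).app (ModuleCat.of R N)) ≪≫
    (((CategoryTheory.Tor (ModuleCat.{u} R) n).obj (ModuleCat.of R M')).mapIso
      e'.toModuleIso)).toLinearEquiv.length_eq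

/-- The lengths of the torsion modules of `M` and `N` are eventually finite and two-periodic, and
`t` is their alternating difference. -/
def HasPeriodicTor (R : Type u) [CommRing R] (M N : Type u) [AddCommGroup M] [Module R M]
    [AddCommGroup N] [Module R N] (t : ℤ) : Prop :=
  ∃ a b : ℕ, (a : ℤ) - b = t ∧ ∀ᶠ n : ℕ in Filter.atTop,
    lengthTor R (2 * n) M N = a ∧ lengthTor R (2 * n + 1) M N = b

namespace HasPeriodicTor

variable {R : Type u} [CommRing R] {M N A F B : Type u} [AddCommGroup M] [Module R M]
  [AddCommGroup N] [Module R N] [AddCommGroup A] [Module R A] [AddCommGroup F] [Module R F]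
  [AddCommGroup B] [Module R B] {t : ℤ}

/-- Induction needs the two lengths to be constant separately: after a shift by one degree the
difference mixes lengths belonging to consecutive values of `n`. -/
theorem hasTheta (h : HasPeriodicTor R M N t) : HasTheta R M N t := by
  obtain ⟨a, b, rfl, h⟩ := h
  filter_upwards [h] with n hn
  rw [hn.1, hn.2]
  exact ⟨ENat.natCast_ne_top a, ENat.natCast_ne_top b, rfl⟩

theorem congr {M' N' : Type u} [AddCommGroup M'] [Module R M'] [AddCommGroup N'] [Module R N']
    (h : HasPeriodicTor R M N t) (e : M ≃ₗ[R] M') (e' : N ≃ₗ[R] N') :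
    HasPeriodicTor R M' N' t := by
  obtain ⟨a, b, hab, h⟩ := h
  refine ⟨a, b, hab, ?_⟩
  filter_upwards [h] with n hn
  rwa [← lengthTor_congr e e', ← lengthTor_congr e e']

theorem of_shift {M' N' : Type u} [AddCommGroup M'] [Module R M'] [AddCommGroup N'] [Module R N']
    (h : HasPeriodicTor R M' N' (-t))
    (hs : ∀ n, lengthTor R (n + 2) M N = lengthTor R (n + 1) M' N') : HasPeriodicTor R M N t := by
  obtain ⟨a, b, hab, h⟩ := h
  refine ⟨b, a, by omega, ?_⟩
  -- Degree `2n` shifts to `2n - 1 = 2(n - 1) + 1`, so the hypothesis is used at both `n` and `n -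
  -- 1`.
  filter_upwards [h, (Filter.tendsto_sub_atTop_nat 1).eventually h, Filter.eventually_ge_atTop 1]
    with n hn hn' hn1
  obtain ⟨m, rfl⟩ := Nat.exists_eq_add_of_le' hn1
  rw [Nat.add_sub_cancel] at hn'
  exact ⟨(hs (2 * m)).trans hn'.2, (hs (2 * m + 1)).trans hn.1⟩

theorem shift_left [Module.Flat R F] {i : A →ₗ[R] F} {p : F →ₗ[R] B} (hi : Function.Injective i)
    (hip : Function.Exact i p) (hp : Function.Surjective p) (h : HasPeriodicTor R A N (-t)) :
    HasPeriodicTor R B N t :=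
  h.of_shift (lengthTor_succ_left N hi hip hp)

theorem shift_right [Module.Flat R F] {i : A →ₗ[R] F} {p : F →ₗ[R] B} (hi : Function.Injective i)
    (hip : Function.Exact i p) (hp : Function.Surjective p) (h : HasPeriodicTor R M A (-t)) :
    HasPeriodicTor R M B t :=
  h.of_shift fun n => lengthTor_succ_right hi hip hp n M

end HasPeriodicTor

namespace MatrixFactorization

variable {Q : Type u} [CommRing Q] {f : Q}

/-! ### Stable classes -/

section StableClass

variable (hf : f ∈ nonZeroDivisors Q) (hst : Function.Bijective (cokerK0 hf))

theorem cokerK0_stableClass (M : Type u) [AddCommGroup M] [Module (Q ⧸ Ideal.span {f}) M]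
    [Module.Finite (Q ⧸ Ideal.span {f}) M] :
    cokerK0 hf (stableClass hf hst M) = G0.stableMk (Q ⧸ Ideal.span {f}) M :=
  (AddEquiv.ofBijective (cokerK0 hf) hst).apply_symm_apply (G0.stableMk _ M)

theorem stableClass_eq_cls {M : Type u} [AddCommGroup M] [Module (Q ⧸ Ideal.span {f}) M]
    [Module.Finite (Q ⧸ Ideal.span {f}) M] {X : MatrixFactorization Q f}
    (e : X.coker ≃ₗ[Q ⧸ Ideal.span {f}] M) : stableClass hf hst M = K0.cls X := by
  apply hst.1
  rw [cokerK0_stableClass, cokerK0_cls]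
  exact (G0.stableMk_eq_of_stableEquiv e.toLinearMap e.symm.toLinearMap
      (0 : _ →ₗ[_] PUnit.{u + 1}) 0 (0 : _ →ₗ[_] PUnit.{u + 1}) 0 (by simp) (by simp)).symm

theorem stableClass_eq_neg {A F B : Type u} [AddCommGroup A] [Module (Q ⧸ Ideal.span {f}) A]
    [Module.Finite (Q ⧸ Ideal.span {f}) A] [AddCommGroup F] [Module (Q ⧸ Ideal.span {f}) F]
    [Module.Finite (Q ⧸ Ideal.span {f}) F] [Module.Projective (Q ⧸ Ideal.span {f}) F]
    [AddCommGroup B] [Module (Q ⧸ Ideal.span {f}) B] [Module.Finite (Q ⧸ Ideal.span {f}) B]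
    {i : A →ₗ[Q ⧸ Ideal.span {f}] F} {p : F →ₗ[Q ⧸ Ideal.span {f}] B} (hi : Function.Injective i)
    (h : Function.Exact i p) (hp : Function.Surjective p) :
    stableClass hf hst A = -stableClass hf hst B := by
  apply hst.1
  rw [map_neg, cokerK0_stableClass, cokerK0_stableClass]
  refine eq_neg_of_add_eq_zero_left ?_
  rw [← G0.stableMk_eq_add i p hi h hp, G0.stableMk_eq_zero]

end StableClass

/-- Induction along syzygies: a property of finitely generated modules over `Q / (f)` holds for all
of them if it holds for cokernels of matrix factorizations and ascends from syzygies. -/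
theorem syzygy_induction [IsNoetherianRing Q] (hf : f ∈ nonZeroDivisors Q)
    (motive : ∀ (M : Type u) [AddCommGroup M] [Module (Q ⧸ Ideal.span {f}) M]
      [Module.Finite (Q ⧸ Ideal.span {f}) M], Prop)
    (coker : ∀ (X : MatrixFactorization Q f) (M : Type u) [AddCommGroup M]
      [Module (Q ⧸ Ideal.span {f}) M] [Module.Finite (Q ⧸ Ideal.span {f}) M],
      (X.coker ≃ₗ[Q ⧸ Ideal.span {f}] M) → motive M)
    (syzygy : ∀ (A F B : Type u) [AddCommGroup A] [Module (Q ⧸ Ideal.span {f}) A]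
      [Module.Finite (Q ⧸ Ideal.span {f}) A] [AddCommGroup F] [Module (Q ⧸ Ideal.span {f}) F]
      [Module.Finite (Q ⧸ Ideal.span {f}) F] [Module.Projective (Q ⧸ Ideal.span {f}) F]
      [AddCommGroup B] [Module (Q ⧸ Ideal.span {f}) B] [Module.Finite (Q ⧸ Ideal.span {f}) B]
      (i : A →ₗ[Q ⧸ Ideal.span {f}] F) (p : F →ₗ[Q ⧸ Ideal.span {f}] B), Function.Injective i →
      Function.Exact i p → Function.Surjective p → motive A → motive B) (n : ℕ) :
    ∀ (M : Type u) [AddCommGroup M] [Module (Q ⧸ Ideal.span {f}) M]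
      [Module.Finite (Q ⧸ Ideal.span {f}) M], OverPdLT f M (n + 2) → motive M := by
  induction n with
  | zero =>
    intro M _ _ _ hM
    obtain ⟨X, ⟨e⟩⟩ := exists_coker_equiv hM
    exact coker X M e
  | succ n ih =>
    intro M _ _ _ hM
    have hi := (LinearMap.ker (coverMap f M)).subtype_injective
    have hip := LinearMap.exact_subtype_ker_map (coverMap f M)
    exact syzygy _ _ M _ (coverMap f M) hi hip (coverMap_surjective M)
      (ih _ (OverPdLT.left hi hip (coverMap_surjective M)
        ((OverPdLT.of_projective hf).mono (by omega)) hM))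

/-! ### The theta pairing -/

section Theta

variable (hfl : ∀ (X : MatrixFactorization Q f) (Y : MatrixFactorization Q (-f)),
  tensor (add_neg_cancel f) X Y ∈ finiteLengthHomology Q)

/-- The biadditive function `(x, y) ↦ χ (x ∪ y°)`. -/
noncomputable abbrev chiCup (x y : K0 Q f) : ℤ :=
  chi Q (cup (add_neg_cancel f) (finiteLengthHomology Q) hfl x (circK0 y))

theorem chiCup_cls (X Y : MatrixFactorization Q f) :
    chiCup hfl (K0.cls X) (K0.cls Y) = (tensor (add_neg_cancel f) X Y.circ).eulerChar := by
  rw [chiCup, K0.cls, K0.cls, circK0, K0On.lift_mk, cup, K0On.lift_mk, K0On.lift_mk, chi,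
    K0On.lift_mk]

theorem hasPeriodicTor_coker (hf : f ∈ nonZeroDivisors Q) (X Y : MatrixFactorization Q f) :
    HasPeriodicTor (Q ⧸ Ideal.span {f}) X.coker Y.coker
      (chiCup hfl (K0.cls X) (K0.cls Y)) := by
  obtain ⟨h0, h1⟩ := hfl X Y.circ
  refine ⟨_, _, (chiCup_cls hfl X Y).symm, ?_⟩
  filter_upwards [Filter.eventually_ge_atTop 1] with n hn
  obtain ⟨m, rfl⟩ := Nat.exists_eq_add_of_le' hn
  exact ⟨(lengthTor_coker_even hf X Y m).trans (ENat.natCast_toNat h0).symm,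
    (lengthTor_coker_odd hf X Y (m + 1)).trans (ENat.natCast_toNat h1).symm⟩

/-- A syzygy in either variable negates both the stable class and the alternating difference of Tor
lengths, so nested inductions on the two modules reduce to a pair of cokernels. -/
theorem hasPeriodicTor_stableClass [IsNoetherianRing Q] (hf : f ∈ nonZeroDivisors Q)
    (hst : Function.Bijective (cokerK0 hf)) {n : ℕ}
    (hn : ∀ (M : Type u) [AddCommGroup M] [Module (Q ⧸ Ideal.span {f}) M]
      [Module.Finite (Q ⧸ Ideal.span {f}) M], OverPdLT f M (n + 2))
    (M N : Type u) [AddCommGroup M] [Module (Q ⧸ Ideal.span {f}) M]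
    [Module.Finite (Q ⧸ Ideal.span {f}) M] [AddCommGroup N] [Module (Q ⧸ Ideal.span {f}) N]
    [Module.Finite (Q ⧸ Ideal.span {f}) N] :
    HasPeriodicTor (Q ⧸ Ideal.span {f}) M N
      (chiCup hfl (stableClass hf hst M) (stableClass hf hst N)) := by
  refine syzygy_induction hf (fun M _ _ _ => HasPeriodicTor (Q ⧸ Ideal.span {f}) M N
    (chiCup hfl (stableClass hf hst M) (stableClass hf hst N))) ?_ ?_ n M (hn M)
  · intro X M _ _ _ e
    refine syzygy_induction hf (fun N _ _ _ => HasPeriodicTor (Q ⧸ Ideal.span {f}) M N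
      (chiCup hfl (stableClass hf hst M) (stableClass hf hst N))) ?_ ?_ n N (hn N)
    · intro Y N _ _ _ e'
      rw [stableClass_eq_cls hf hst e, stableClass_eq_cls hf hst e']
      exact (hasPeriodicTor_coker hfl hf X Y).congr e e'
    · intro A F B _ _ _ _ _ _ _ _ _ _ i p hi hip hp hA
      rw [stableClass_eq_neg hf hst hi hip hp, chiCup, map_neg, map_neg, map_neg] at hA
      exact hA.shift_right hi hip hp
  · intro A F B _ _ _ _ _ _ _ _ _ _ i p hi hip hp hA
    rw [stableClass_eq_neg hf hst hi hip hp, chiCup, map_neg, AddMonoidHom.neg_apply,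
      map_neg] at hA
    exact hA.shift_left hi hip hp

end Theta

end MatrixFactorization

theorem proposition3p10 (Q : Type u) [CommRing Q] [IsRegularLocalRing Q] (f : Q) (hf0 : f ≠ 0)
    (hfm : f ∈ IsLocalRing.maximalIdeal Q)
    (hiso : ∀ (p : Ideal (Q ⧸ Ideal.span {f})) [p.IsPrime], ¬ p.IsMaximal →
      IsRegularLocalRing (Localization.AtPrime p)) :
    ∃ (hf : f ∈ nonZeroDivisors Q) (hst : Function.Bijective (MatrixFactorization.cokerK0 hf))
      (hfl : ∀ (X : MatrixFactorization Q f) (Y : MatrixFactorization Q (-f)),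
        MatrixFactorization.tensor (add_neg_cancel f) X Y ∈
          MatrixFactorization.finiteLengthHomology Q),
      ∀ (M N : Type u) [AddCommGroup M] [Module (Q ⧸ Ideal.span {f}) M]
        [Module.Finite (Q ⧸ Ideal.span {f}) M] [AddCommGroup N]
        [Module (Q ⧸ Ideal.span {f}) N] [Module.Finite (Q ⧸ Ideal.span {f}) N],
        HasTheta (Q ⧸ Ideal.span {f}) M N
          (MatrixFactorization.chi Q
            (MatrixFactorization.cup (add_neg_cancel f)
              (MatrixFactorization.finiteLengthHomology Q) hfl
              (MatrixFactorization.stableClass hf hst M)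
              (MatrixFactorization.circK0 (MatrixFactorization.stableClass hf hst N)))) := by
  have := IsRegularLocalRing.isDomain Q
  have hf : f ∈ nonZeroDivisors Q := mem_nonZeroDivisors_of_ne_zero hf0
  obtain ⟨n, hn⟩ := IsRegularLocalRing.exists_pdLT Q
  have hn' : ∀ (M : Type u) [AddCommGroup M] [Module (Q ⧸ Ideal.span {f}) M]
      [Module.Finite (Q ⧸ Ideal.span {f}) M], MatrixFactorization.OverPdLT f M (n + 2) := by
    intro M _ _ _
    obtain ⟨_, _⟩ := MatrixFactorization.exists_isScalarTower f M
    have : Module.Finite Q M := Module.Finite.trans (Q ⧸ Ideal.span {f}) M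
    -- The bound is weakened by one because the syzygy inductions start at level `2`.
    exact (MatrixFactorization.overPdLT_iff.2 (hn M)).mono (Nat.le_succ _)
  have hst := MatrixFactorization.cokerK0_bijective hf hn'
  have hfl := MatrixFactorization.tensor_mem_finiteLengthHomology hf hiso (add_neg_cancel f)
  exact ⟨hf, hst, hfl, fun M N _ _ _ _ _ _ =>
    (MatrixFactorization.hasPeriodicTor_stableClass hfl hf hst hn' M N).hasTheta⟩
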